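/- Let $M$ be a smooth four-manifold with a coherent symplectic triple: three symplectic forms $\sigma_0,\sigma_1,\sigma_2$ which at each point span a maximal positive (three-dimensional) subspace $\Lambda^+$ of $\Lambda^2T^*M$ for the wedge pairing, with $\sigma_0\wedge\sigma_1=0=\sigma_0\wedge\sigma_2$. Define $Q=(q_{ij})_{i,j=1,2}$ by $\sigma_i\wedge\sigma_j=q_{ij}\,\sigma_0\wedge\sigma_0$ and put $h=\sqrt{\det Q}$. Let $\pi\colon\mathcal X\to M$ be a smooth principal $T^2$-bundle with connection one-form $\Theta=(\theta_1,\theta_2)$ and, suppressing pull-backs by $\pi$, put $$\sigma=h\sigma_0+h^{-1}\theta_1\wedge\theta_2,\qquad \psi_+=\sigma_1\wedge\theta_1+\sigma_2\wedge\theta_2,$$ $$\psi_-=h^{-1}\bigl(q_{22}\,\sigma_1\wedge\theta_2-q_{11}\,\sigma_2\wedge\theta_1+q_{12}(\sigma_1\wedge\theta_1-\sigma_2\wedge\theta_2)\bigr).$$ (1) Suppose that the triple is positively ordered, i.e. $\sigma_2(u,Ju)>0$ for all nonzero tangent vectors $u$, where $J$ is the endomorphism of $TM$ with $\sigma_0(Ju,\cdot)=\sigma_1(u,\cdot)$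 (on a connected $M$ this holds for exactly one of $(\sigma_0,\sigma_1,\sigma_2)$ and $(\sigma_0,\sigma_1,-\sigma_2)$). Then $(\sigma,\psi_\pm)$ defines an $SU(3)$-structure on $\mathcal X$: the forms are smooth and at each point linearly equivalent to $\sum_{j=1}^3 dx_j\wedge dy_j$ and to the real and imaginary parts of $dz_1\wedge dz_2\wedge dz_3$ on $\mathbb C^3$. (2) There are smooth two-forms $F_1,F_2$ on $M$ with $d\theta_j=\pi^*F_j$. Let $d\Theta^+=(F_1^+,F_2^+)$ be their components in $\Lambda^+$ along the wedge-orthogonal complement of $\Lambda^+$. Whether or not the triple is positively ordered, $(\sigma,\psi_\pm)$ is half-flat, that is, $\sigma\wedge d\sigma=0$ and $d\psi_+=0$, if and only if $d\Theta^+=(\sigma_1,\sigma_2)A$ for a smooth function $A$ on $M$ with values in the real $2\times2$ matrices such that $\operatorname{Tr}(AQ)=0$. -/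

import Mathlib

open scoped Manifold ContDiff Topology

noncomputable section

/-! ### Exterior algebra on one tangent space -/

theorem update_castAdd_castAdd {V : Type*} {k l : ℕ} [DecidableEq (Fin (k + l))]
    (v : Fin (k + l) → V) (a : Fin k) (z : V) :
    (fun i => Function.update v (Fin.castAdd l a) z (Fin.castAdd l i)) =
      Function.update (fun i => v (Fin.castAdd l i)) a z := by
  funext i
  simp [Function.update_apply]

theorem update_castAdd_natAdd {V : Type*} {k l : ℕ} [DecidableEq (Fin (k + l))]
    (v : Fin (k + l) → V) (a : Fin k) (z : V) :
    (fun j => Function.update v (Fin.castAdd l a) z (Fin.natAdd k j)) =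
      fun j => v (Fin.natAdd k j) := by
  funext j
  rw [Function.update_apply, if_neg]
  intro h
  have := congrArg Fin.val h
  simp at this
  omega

theorem update_natAdd_castAdd {V : Type*} {k l : ℕ} [DecidableEq (Fin (k + l))]
    (v : Fin (k + l) → V) (b : Fin l) (z : V) :
    (fun i => Function.update v (Fin.natAdd k b) z (Fin.castAdd l i)) =
      fun i => v (Fin.castAdd l i) := by
  funext i
  rw [Function.update_apply, if_neg]
  intro h
  have := congrArg Fin.val h
  simp at this
  omega

theorem update_natAdd_natAdd {V : Type*} {k l : ℕ} [DecidableEq (Fin (k + l))]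
    (v : Fin (k + l) → V) (b : Fin l) (z : V) :
    (fun j => Function.update v (Fin.natAdd k b) z (Fin.natAdd k j)) =
      Function.update (fun j => v (Fin.natAdd k j)) b z := by
  funext j
  simp [Function.update_apply]

section Linear

variable {V : Type*} [AddCommGroup V] [Module ℝ V] [TopologicalSpace V]

/-- The product `α(v₁, …, v_k) β(v_{k+1}, …, v_{k+l})` of two alternating forms, as a
multilinear form. -/
def tensorForm {k l : ℕ} (α : V [⋀^Fin k]→L[ℝ] ℝ) (β : V [⋀^Fin l]→L[ℝ] ℝ) :
    ContinuousMultilinearMap ℝ (fun _ : Fin (k + l) => V) ℝ where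
  toFun v := α (fun i => v (Fin.castAdd l i)) * β (fun j => v (Fin.natAdd k j))
  map_update_add' := by
    intro _ v i x y
    refine Fin.addCases (fun a => ?_) (fun b => ?_) i
    · simp only [update_castAdd_castAdd, update_castAdd_natAdd,
        ContinuousAlternatingMap.map_update_add]
      ring
    · simp only [update_natAdd_castAdd, update_natAdd_natAdd,
        ContinuousAlternatingMap.map_update_add]
      ring
  map_update_smul' := by
    intro _ v i c x
    refine Fin.addCases (fun a => ?_) (fun b => ?_) i
    · simp only [update_castAdd_castAdd, update_castAdd_natAdd,
        ContinuousAlternatingMap.map_update_smul, smul_eq_mul]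
      ring
    · simp only [update_natAdd_castAdd, update_natAdd_natAdd,
        ContinuousAlternatingMap.map_update_smul, smul_eq_mul]
      ring
  cont := by
    apply Continuous.mul
    · exact α.cont.comp (continuous_pi fun i => continuous_apply _)
    · exact β.cont.comp (continuous_pi fun i => continuous_apply _)

/-- The wedge product of alternating forms, with the usual normalisation
`(α ∧ β)(v) = 1/(k! l!) ∑_τ sign(τ) α(v_{τ1}, …, v_{τk}) β(v_{τ(k+1)}, …, v_{τ(k+l)})`
(so that `(a ∧ b)(u, v) = a u * b v - a v * b u` for one-forms). -/
def wedge {k l : ℕ} (α : V [⋀^Fin k]→L[ℝ] ℝ) (β : V [⋀^Fin l]→L[ℝ] ℝ) :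
    V [⋀^Fin (k + l)]→L[ℝ] ℝ :=
  ((k.factorial * l.factorial : ℕ) : ℝ)⁻¹ •
    ContinuousMultilinearMap.alternatization (tensorForm α β)

/-- A subspace `W` of `Λ²V*`, `dim V = 4`, is maximal positive if, for some orientation of `V`
(given by a nonzero four-form `ν`), the quadratic form `w ↦ w ∧ w ∈ Λ⁴V* ≅ ℝ` is positive
definite on `W`, and `dim W = 3`, the largest possible dimension because the quadratic form has
signature `(3,3)`. -/
def IsMaximalPositive (W : Submodule ℝ (V [⋀^Fin 2]→L[ℝ] ℝ)) : Prop :=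
  Module.finrank ℝ W = 3 ∧
    ∃ ν : V [⋀^Fin 4]→L[ℝ] ℝ, ν ≠ 0 ∧ ∀ w ∈ W, w ≠ 0 → ∃ c : ℝ, 0 < c ∧ wedge w w = c • ν

/-- `G` is the component `F⁺` of the two-form `F` in `Λ⁺ = span(s₀, s₁, s₂)` with respect to the
splitting `Λ² = Λ⁺ ⊕ Λ⁻`, where `Λ⁻` is the orthogonal complement of `Λ⁺` for the wedge
pairing. -/
def IsSelfDualPart (s : Fin 3 → V [⋀^Fin 2]→L[ℝ] ℝ) (F G : V [⋀^Fin 2]→L[ℝ] ℝ) : Prop :=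
  G ∈ Submodule.span ℝ (Set.range s) ∧ ∀ i, wedge (F - G) (s i) = 0

/-- `(η, ψ₊, ψ₋)` is linearly equivalent to the standard `SU(3)` forms on `ℂ³`:
`η = ∑ dxⱼ ∧ dyⱼ` and `ψ₊ + i ψ₋ = dz₁ ∧ dz₂ ∧ dz₃`. -/
def IsSU3Forms (η : V [⋀^Fin 2]→L[ℝ] ℝ) (ψp ψm : V [⋀^Fin 3]→L[ℝ] ℝ) : Prop :=
  ∃ L : V ≃ₗ[ℝ] (Fin 3 → ℂ),
    (∀ u v : V, η ![u, v] = ∑ j, ((L u j).re * (L v j).im - (L u j).im * (L v j).re)) ∧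
    (∀ u v w : V, ψp ![u, v, w] = (Matrix.det ![L u, L v, L w]).re) ∧
    (∀ u v w : V, ψm ![u, v, w] = (Matrix.det ![L u, L v, L w]).im)

end Linear

/-! ### Differential forms on manifolds modelled on `ℝⁿ` -/

section Forms

/-- (Not necessarily smooth) differential `k`-forms on an `n`-manifold. -/
abbrev DiffForm (n : ℕ) (M : Type*) [TopologicalSpace M]
    [ChartedSpace (EuclideanSpace ℝ (Fin n)) M] (k : ℕ) :=
  (x : M) → (TangentSpace (𝓡 n) x) [⋀^Fin k]→L[ℝ] ℝ

variable {m n : ℕ} {M N : Type*}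
  [TopologicalSpace M] [ChartedSpace (EuclideanSpace ℝ (Fin n)) M]
  [TopologicalSpace N] [ChartedSpace (EuclideanSpace ℝ (Fin m)) N]

/-- The pullback `f^*η`. -/
def DiffForm.pullback (f : N → M) {k : ℕ} (η : DiffForm n M k) : DiffForm m N k :=
  fun x => (η (f x)).compContinuousLinearMap (mfderiv (𝓡 m) (𝓡 n) f x)

/-- The expression of `η` in the preferred chart at `x₀`: its pullback to `ℝⁿ` by the inverse of
the chart. -/
def DiffForm.inChart {k : ℕ} (η : DiffForm n M k) (x₀ : M) :
    EuclideanSpace ℝ (Fin n) → (EuclideanSpace ℝ (Fin n)) [⋀^Fin k]→L[ℝ] ℝ :=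
  fun y => (η ((extChartAt (𝓡 n) x₀).symm y)).compContinuousLinearMap
    (mfderiv (𝓡 n) (𝓡 n) (extChartAt (𝓡 n) x₀).symm y)

/-- Smoothness of a form: all its chart expressions are smooth. -/
def DiffForm.IsSmooth {k : ℕ} (η : DiffForm n M k) : Prop :=
  ∀ x₀ : M, ContDiffOn ℝ ∞ (η.inChart x₀) (extChartAt (𝓡 n) x₀).target

/-- The exterior derivative, computed at `x` in the preferred chart at `x`. -/
def DiffForm.d {k : ℕ} (η : DiffForm n M k) : DiffForm n M (k + 1) :=
  fun x => (extDeriv (η.inChart x) (extChartAt (𝓡 n) x x)).compContinuousLinearMap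
    (mfderiv (𝓡 n) (𝓡 n) (extChartAt (𝓡 n) x) x)

/-- The wedge product of differential forms. -/
def DiffForm.wedge {k l : ℕ} (α : DiffForm n M k) (β : DiffForm n M l) : DiffForm n M (k + l) :=
  fun x => _root_.wedge (α x) (β x)

/-- The product of a function and a form. -/
def DiffForm.fsmul {k : ℕ} (f : M → ℝ) (α : DiffForm n M k) : DiffForm n M k :=
  fun x => f x • α x

/-- A symplectic form: smooth, closed and nondegenerate. -/
structure IsSymplecticForm (η : DiffForm n M 2) : Prop where
  smooth : η.IsSmooth
  closed : η.d = 0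
  nondegenerate : ∀ x (u : TangentSpace (𝓡 n) x), (∀ v, η x ![u, v] = 0) → u = 0

end Forms

/-! ### Coherent symplectic triples -/

section Triples

variable {M : Type*} [TopologicalSpace M] [ChartedSpace (EuclideanSpace ℝ (Fin 4)) M]

/-- A coherent symplectic triple `(σ₀, σ₁, σ₂)` on a four-manifold. -/
structure IsCoherentTriple (σ : Fin 3 → DiffForm 4 M 2) : Prop where
  symplectic : ∀ i, IsSymplecticForm (σ i)
  maximalPositive : ∀ x, IsMaximalPositive (Submodule.span ℝ (Set.range fun i => σ i x))
  orthogonal₁ : (σ 0).wedge (σ 1) = 0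
  orthogonal₂ : (σ 0).wedge (σ 2) = 0

/-- The triple is positively ordered: if `J` is the bundle endomorphism with
`σ₀(J u, ·) = σ₁(u, ·)`, then `σ₂(u, J u) > 0` for all nonzero tangent vectors `u`.  For a coherent
triple on a connected manifold exactly one of `(σ₀, σ₁, σ₂)` and `(σ₀, σ₁, -σ₂)` has this
property. -/
def IsPositivelyOrdered (σ : Fin 3 → DiffForm 4 M 2) : Prop :=
  ∀ (x : M) (u v : TangentSpace (𝓡 4) x), u ≠ 0 →
    (∀ w, σ 0 x ![v, w] = σ 1 x ![u, w]) → 0 < σ 2 x ![u, v]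

/-- The ratio `α / β` of two top-degree forms at a point of a four-manifold, `β ≠ 0`, computed on a
basis (the choice of which is immaterial) of the tangent space. -/
def topRatio {x : M} (α β : (TangentSpace (𝓡 4) x) [⋀^Fin 4]→L[ℝ] ℝ) : ℝ :=
  α (fun i => (EuclideanSpace.basisFun (Fin 4) ℝ i : EuclideanSpace ℝ (Fin 4))) /
    β (fun i => (EuclideanSpace.basisFun (Fin 4) ℝ i : EuclideanSpace ℝ (Fin 4)))

/-- `topRatio α β` is characterised by `α = (topRatio α β) β`. -/
theorem eq_topRatio_smul {x : M} (α β : (TangentSpace (𝓡 4) x) [⋀^Fin 4]→L[ℝ] ℝ) (hβ : β ≠ 0) :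
    α = topRatio α β • β := by
  let e : Module.Basis (Fin 4) ℝ (TangentSpace (𝓡 4) x) :=
    (EuclideanSpace.basisFun (Fin 4) ℝ).toBasis
  have he : (fun i => (EuclideanSpace.basisFun (Fin 4) ℝ i : EuclideanSpace ℝ (Fin 4))) = ⇑e := by
    funext i
    exact (OrthonormalBasis.coe_toBasis (EuclideanSpace.basisFun (Fin 4) ℝ) ▸ rfl)
  have hb : β ⇑e ≠ 0 := by
    intro h
    apply hβ
    apply ContinuousAlternatingMap.toAlternatingMap_injective
    exact e.ext_alternating fun v hv => by
      have hs : Function.Bijective v := (Fintype.bijective_iff_injective_and_card v).2 ⟨hv, rfl⟩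
      have hp := β.toAlternatingMap.map_perm ⇑e (Equiv.ofBijective v hs)
      have h' : β.toAlternatingMap ⇑e = 0 := h
      rw [h', smul_zero] at hp
      exact hp
  apply ContinuousAlternatingMap.toAlternatingMap_injective
  refine e.ext_alternating fun v hv => ?_
  have hs : Function.Bijective v := (Fintype.bijective_iff_injective_and_card v).2 ⟨hv, rfl⟩
  have hpα := α.toAlternatingMap.map_perm ⇑e (Equiv.ofBijective v hs)
  have hpβ := β.toAlternatingMap.map_perm ⇑e (Equiv.ofBijective v hs)
  have hα : (α.toAlternatingMap fun i => e (v i)) =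
    Equiv.Perm.sign (Equiv.ofBijective v hs) • α.toAlternatingMap ⇑e := hpα
  have hβ' : (β.toAlternatingMap fun i => e (v i)) =
    Equiv.Perm.sign (Equiv.ofBijective v hs) • β.toAlternatingMap ⇑e := hpβ
  have key : α ⇑e = topRatio α β * β ⇑e := by
    unfold topRatio
    rw [he, div_mul_cancel₀ _ hb]
  change (α.toAlternatingMap fun i => e (v i)) =
    topRatio α β • (β.toAlternatingMap fun i => e (v i))
  rw [hα, hβ', smul_comm]
  exact congrArg _ key

/-- The `2 × 2` intersection matrix `Q = (q_{ij})`, `σᵢ ∧ σⱼ = q_{ij} σ₀ ∧ σ₀` for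
`i, j = 1, 2`. -/
def intersectionMatrix (σ : Fin 3 → DiffForm 4 M 2) (x : M) : Matrix (Fin 2) (Fin 2) ℝ :=
  Matrix.of fun i j =>
    topRatio (wedge (σ i.succ x) (σ j.succ x)) (wedge (σ 0 x) (σ 0 x))

/-- The function `h = √(det Q)`. -/
def hFun (σ : Fin 3 → DiffForm 4 M 2) (x : M) : ℝ :=
  Real.sqrt (intersectionMatrix σ x).det

end Triples

/-! ### Principal torus bundles and connections -/

section Bundles

/-- The two-torus `T² = S¹ × S¹`. -/
abbrev Torus2 := Circle × Circle

/-- The exponential map `ℝ² → T²`, `t ↦ (e^{i t₁}, e^{i t₂})`. -/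
def torusExp (t : Fin 2 → ℝ) : Torus2 := (Circle.exp (t 0), Circle.exp (t 1))

variable {M X : Type*} [TopologicalSpace M] [ChartedSpace (EuclideanSpace ℝ (Fin 4)) M]
  [TopologicalSpace X] [ChartedSpace (EuclideanSpace ℝ (Fin 6)) X] [MulAction Torus2 X]

/-- `π : X → M` is a smooth principal `T²`-bundle over a four-manifold: `T²` acts smoothly on `X`
over `M`, and `X` is covered by equivariant local trivialisations `π⁻¹(U) ≅ U × T²`. -/
structure IsPrincipalTorusBundle (π : X → M) : Prop where
  smooth_proj : ContMDiff (𝓡 6) (𝓡 4) ∞ π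
  smooth_action : ContMDiff (((𝓡 1).prod (𝓡 1)).prod (𝓡 6)) (𝓡 6) ∞
    (fun q : Torus2 × X => q.1 • q.2)
  proj_smul : ∀ (g : Torus2) (p : X), π (g • p) = π p
  locally_trivial : ∀ x : M, ∃ U : Set M, IsOpen U ∧ x ∈ U ∧
    ∃ φ : OpenPartialHomeomorph X (M × Torus2),
      φ.source = π ⁻¹' U ∧ φ.target = U ×ˢ Set.univ ∧
      ContMDiffOn (𝓡 6) ((𝓡 4).prod ((𝓡 1).prod (𝓡 1))) ∞ φ φ.source ∧
      ContMDiffOn ((𝓡 4).prod ((𝓡 1).prod (𝓡 1))) (𝓡 6) ∞ φ.symm φ.target ∧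
      (∀ p ∈ φ.source, (φ p).1 = π p) ∧
      ∀ p ∈ φ.source, ∀ g : Torus2, φ (g • p) = (π p, g * (φ p).2)

/-- The vector field on `X` generated by the `j`-th factor of `T²`: the velocity at `t = 0` of
`t ↦ exp(t eⱼ) • p`. -/
def fundamentalField (j : Fin 2) (p : X) : TangentSpace (𝓡 6) p :=
  (mfderiv 𝓘(ℝ, ℝ) (𝓡 6) (fun t : ℝ => torusExp (Pi.single j t) • p) 0 (1 : ℝ) :
    EuclideanSpace ℝ (Fin 6))

/-- `Θ = (θ₁, θ₂)` is (the pair of components of) a connection one-form on the principal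
`T²`-bundle `X`: smooth, `T²`-invariant, and reproducing the generators of the action. -/
structure IsConnectionForm (θ : Fin 2 → DiffForm 6 X 1) : Prop where
  smooth : ∀ i, (θ i).IsSmooth
  invariant : ∀ i (g : Torus2), (θ i).pullback (fun p : X => g • p) = θ i
  vertical : ∀ i j (p : X), θ i p ![fundamentalField j p] = if i = j then 1 else 0

end Bundles

/-! ### `SU(3)`-structures and the forms on the total space -/

section SU3

variable {X : Type*} [TopologicalSpace X] [ChartedSpace (EuclideanSpace ℝ (Fin 6)) X]

/-- `(η, ψ₊, ψ₋)` defines an `SU(3)`-structure on the six-manifold `X`: the forms are smooth and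
at each point linearly equivalent to the standard `SU(3)` forms on `ℂ³`. -/
structure IsSU3Structure (η : DiffForm 6 X 2) (ψp ψm : DiffForm 6 X 3) : Prop where
  smooth_η : η.IsSmooth
  smooth_ψp : ψp.IsSmooth
  smooth_ψm : ψm.IsSmooth
  model : ∀ p, IsSU3Forms (η p) (ψp p) (ψm p)

/-- The half-flat equations `η ∧ dη = 0` and `dψ₊ = 0`. -/
def IsHalfFlat (η : DiffForm 6 X 2) (ψp : DiffForm 6 X 3) : Prop :=
  η.wedge η.d = 0 ∧ ψp.d = 0

variable {M : Type*} [TopologicalSpace M] [ChartedSpace (EuclideanSpace ℝ (Fin 4)) M]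

/-- `σ = h σ₀ + h⁻¹ θ₁ ∧ θ₂`, forms on `M` being pulled back to `X` along `π`. -/
def bundleσ (π : X → M) (σ : Fin 3 → DiffForm 4 M 2) (θ : Fin 2 → DiffForm 6 X 1) :
    DiffForm 6 X 2 :=
  DiffForm.fsmul (fun p => hFun σ (π p)) ((σ 0).pullback π) +
    DiffForm.fsmul (fun p => (hFun σ (π p))⁻¹) ((θ 0).wedge (θ 1))

/-- `ψ₊ = σ₁ ∧ θ₁ + σ₂ ∧ θ₂`. -/
def bundleψp (π : X → M) (σ : Fin 3 → DiffForm 4 M 2) (θ : Fin 2 → DiffForm 6 X 1) :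
    DiffForm 6 X 3 :=
  ((σ 1).pullback π).wedge (θ 0) + ((σ 2).pullback π).wedge (θ 1)

/-- `ψ₋ = h⁻¹ (q₂₂ σ₁ ∧ θ₂ - q₁₁ σ₂ ∧ θ₁ + q₁₂ (σ₁ ∧ θ₁ - σ₂ ∧ θ₂))`. -/
def bundleψm (π : X → M) (σ : Fin 3 → DiffForm 4 M 2) (θ : Fin 2 → DiffForm 6 X 1) :
    DiffForm 6 X 3 :=
  DiffForm.fsmul (fun p => (hFun σ (π p))⁻¹)
    (DiffForm.fsmul (fun p => intersectionMatrix σ (π p) 1 1)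
        (((σ 1).pullback π).wedge (θ 1)) -
      DiffForm.fsmul (fun p => intersectionMatrix σ (π p) 0 0)
        (((σ 2).pullback π).wedge (θ 0)) +
      DiffForm.fsmul (fun p => intersectionMatrix σ (π p) 0 1)
        (((σ 1).pullback π).wedge (θ 0) - ((σ 2).pullback π).wedge (θ 1)))

end SU3

end

/-! Part (1) is linear algebra at a point. The map `(dπ, θ₁, θ₂)` identifies a tangent space of `X`
with `T_xM ⊕ ℝ²` (`IsPrincipalTorusBundle.tangent_eq_zero`). Gram–Schmidt in `Λ⁺` replaces the
triple by `ω₀ = hσ₀`, `ω₁ = (h/√q₁₁) σ₁`, `ω₂ = √q₁₁ σ₂ - (q₁₂/√q₁₁) σ₁`, which are wedge-orthogonal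
with equal squares. Comparing `ω₁` and `ω₂` with `ω₀` gives two anticommuting complex structures,
and a single nonzero vector then generates a quaternionic frame. In the dual coordinates `ω₀` is the
standard Kähler form and `ω₁ - iω₂ = dz₁ ∧ dz₂`; the positive ordering supplies the sign needed to
extract a square root (`IsHyperTriple.exists_coordinates`). A third complex covector built from `θ₁,
θ₂` completes the model (`isSU3Forms_of_triple`).

Part (2) starts from the curvature. In the parametrisation `(y, t) ↦ exp(t) • S(y)` attached to a
local section `S`, the form `θⱼ` becomes `S^*θⱼ + dtⱼ`, so `dθⱼ` is the pullback of `Fⱼ = S^*dθⱼ`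
(`exists_curvature`). As the `σᵢ` are closed, `dψ₊ = σ₁ ∧ F₁ + σ₂ ∧ F₂`. In `σ ∧ dσ` the terms with
`dh` cancel or contain the five-form `σ₀ ∧ σ₀ ∧ dh` of a four-manifold, which leaves `σ₀ ∧ F₁ ∧ θ₂ -
σ₀ ∧ F₂ ∧ θ₁`. Half-flatness is therefore the system `σ₀ ∧ Fⱼ = 0`, `σ₁ ∧ F₁ + σ₂ ∧ F₂ = 0` on `M`
(`isHalfFlat_bundle_iff`).

The first equations say that `Fⱼ⁺` lies in the span of `σ₁, σ₂`. Writing `Fⱼ⁺ = A₁ⱼσ₁ + A₂ⱼσ₂`, the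
left side of the last one is `Tr(AQ) σ₀ ∧ σ₀`; since `Q` is positive definite, `A` is smooth by
Cramer's rule (`exists_selfDualPart_iff`). -/

noncomputable section

/-! ### Explicit formulas for the wedge product -/

/-- The signed sum of `G` over the permutations of a tuple. -/
def signedPermSum {V : Type*} {n : ℕ} (G : (Fin n → V) → ℝ) (v : Fin n → V) : ℝ :=
  ∑ τ : Equiv.Perm (Fin n), ((Equiv.Perm.sign τ : ℤ) : ℝ) * G (fun i => v (τ i))

/-- Laplace expansion: permutations are sorted by the image of `0`. Iterating it produces the
low-degree wedge formulas without listing all the permutations. -/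
theorem signedPermSum_succ {V : Type*} {n : ℕ} (G : (Fin (n + 1) → V) → ℝ) (v : Fin (n + 1) → V) :
    signedPermSum G v = ∑ i : Fin (n + 1), (-1) ^ (i : ℕ) *
      signedPermSum (fun w => G (Fin.cons (v i) w)) (fun j => v (i.succAbove j)) := by
  -- The inverse of `cycleRange i` sends `0` to `i` and `j + 1` to `i.succAbove j`, with sign
  -- `(-1)^i`; hence `f (i, τ)` puts `i` first and arranges the rest by `τ`.
  let f : Fin (n + 1) × Equiv.Perm (Fin n) → Equiv.Perm (Fin (n + 1)) :=
    fun q => (Fin.cycleRange q.1).symm * Equiv.Perm.decomposeFin.symm (0, q.2)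
  have f0 : ∀ q, f q 0 = q.1 := by
    intro q
    simp [f]
  have fs : ∀ q j, f q (Fin.succ j) = q.1.succAbove (q.2 j) := by
    intro q j
    simp [f]
  have hf : Function.Bijective f := by
    rw [Fintype.bijective_iff_injective_and_card]
    constructor
    · intro q r hqr
      have h1 : q.1 = r.1 := by rw [← f0 q, ← f0 r, hqr]
      refine Prod.ext h1 (Equiv.ext fun j => ?_)
      have h2 := fs q j
      rw [hqr, fs r j, h1] at h2
      exact (Fin.succAbove_right_injective h2).symm
    · simp [Fintype.card_perm, Nat.factorial_succ]
  have hs : ∀ q, Equiv.Perm.sign (f q) = (-1) ^ (q.1 : ℕ) * Equiv.Perm.sign q.2 := by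
    intro q
    simp [f, Equiv.Perm.decomposeFin.symm_sign, Fin.sign_cycleRange]
  unfold signedPermSum
  rw [← Function.Bijective.sum_comp hf, Fintype.sum_prod_type]
  refine Finset.sum_congr rfl fun i _ => ?_
  rw [Finset.mul_sum]
  refine Finset.sum_congr rfl fun τ _ => ?_
  rw [hs]
  have : (fun k => v (f (i, τ) k)) = Fin.cons (v i) (fun j => v (i.succAbove (τ j))) := by
    funext k
    refine Fin.cases ?_ (fun j => ?_) k
    · simp [f0]
    · simp [fs]
  rw [this]
  push_cast
  ring

/-- The sign of each permutation is cancelled by the sign from `β`, so all `n!` terms agree. -/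
theorem signedPermSum_mul_alternating {V : Type*} [AddCommGroup V] [Module ℝ V]
    [TopologicalSpace V] {n : ℕ} (c : ℝ) (β : V [⋀^Fin n]→L[ℝ] ℝ) (v : Fin n → V) :
    signedPermSum (fun w => c * β w) v = n.factorial * (c * β v) := by
  unfold signedPermSum
  have : ∀ τ : Equiv.Perm (Fin n),
      ((Equiv.Perm.sign τ : ℤ) : ℝ) * (c * β (fun i => v (τ i))) = c * β v := by
    intro τ
    have h : β (fun i => v (τ i)) = Equiv.Perm.sign τ • β v := β.toAlternatingMap.map_perm v τ
    rw [h]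
    rcases Int.units_eq_one_or (Equiv.Perm.sign τ) with h | h <;> simp [h]
  simp [this, Fintype.card_perm]

theorem vec_one_eta {V : Type*} {v : Fin 1 → V} : v = ![v 0] := by
  funext i; fin_cases i; rfl

theorem vec_two_eta {V : Type*} {v : Fin 2 → V} : v = ![v 0, v 1] := by
  funext i; fin_cases i <;> rfl

theorem vec_three_eta {V : Type*} {v : Fin 3 → V} : v = ![v 0, v 1, v 2] := by
  funext i; fin_cases i <;> rfl

theorem vec_four_eta {V : Type*} {v : Fin 4 → V} : v = ![v 0, v 1, v 2, v 3] := by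
  funext i; fin_cases i <;> rfl

theorem vec_five_eta {V : Type*} {v : Fin 5 → V} : v = ![v 0, v 1, v 2, v 3, v 4] := by
  funext i; fin_cases i <;> rfl

section Linear

variable {V : Type*} [AddCommGroup V] [Module ℝ V] [TopologicalSpace V]

theorem wedge_apply {k l : ℕ} (α : V [⋀^Fin k]→L[ℝ] ℝ) (β : V [⋀^Fin l]→L[ℝ] ℝ)
    (v : Fin (k + l) → V) :
    wedge α β v = ((k.factorial * l.factorial : ℕ) : ℝ)⁻¹ *
      signedPermSum (fun w => α (fun i => w (Fin.castAdd l i)) * β (fun j => w (Fin.natAdd k j)))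
        v := by
  simp only [wedge, ContinuousAlternatingMap.smul_apply, smul_eq_mul,
    ContinuousMultilinearMap.alternatization_apply_apply, signedPermSum]
  congr 1
  refine Finset.sum_congr rfl fun τ _ => ?_
  rcases Int.units_eq_one_or (Equiv.Perm.sign τ) with h | h <;>
    simp [h, tensorForm] <;> rfl

theorem form_two_swap (α : V [⋀^Fin 2]→L[ℝ] ℝ) (u v : V) : α ![v, u] = -α ![u, v] := by
  have h := α.toAlternatingMap.map_swap ![u, v] (i := 0) (j := 1) (by decide)
  have h2 : (![u, v] ∘ ⇑(Equiv.swap (0 : Fin 2) 1)) = ![v, u] := by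
    funext i; fin_cases i <;> rfl
  rw [h2] at h
  exact h

theorem form_two_self (α : V [⋀^Fin 2]→L[ℝ] ℝ) (u : V) : α ![u, u] = 0 := by
  have := form_two_swap α u u
  linarith

theorem wedge_one_one (α β : V [⋀^Fin 1]→L[ℝ] ℝ) (u v : V) :
    wedge α β ![u, v] = α ![u] * β ![v] - α ![v] * β ![u] := by
  rw [wedge_apply]
  have h := signedPermSum_succ (n := 1)
    (fun w => α (fun i => w (Fin.castAdd 1 i)) * β (fun j => w (Fin.natAdd 1 j))) ![u, v]
  have e : ∀ (x : V) (w : Fin 1 → V), α (fun i => (Fin.cons x w : Fin 2 → V) (Fin.castAdd 1 i)) *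
      β (fun j => (Fin.cons x w : Fin 2 → V) (Fin.natAdd 1 j)) = α ![x] * β w := by
    intro x w
    congr 2
    · funext i; fin_cases i; rfl
    · funext i; fin_cases i; rfl
  simp only [e, signedPermSum_mul_alternating] at h
  have h0 : (fun j => (![u, v] : Fin 2 → V) ((0 : Fin 2).succAbove j)) = ![v] := by
    funext i; fin_cases i; rfl
  have h1 : (fun j => (![u, v] : Fin 2 → V) ((1 : Fin 2).succAbove j)) = ![u] := by
    funext i; fin_cases i; rfl
  rw [Fin.sum_univ_two, h0, h1] at h
  refine (congrArg _ h).trans ?_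
  simp
  ring

/-- Only the choice of the ordered pair given to `α` has to be enumerated, since `β` absorbs the
rest. Each unordered pair occurs twice, and this accounts for the `2!` in the normalisation of
`wedge`. -/
theorem signedPermSum_two_add {l : ℕ} (α : V [⋀^Fin 2]→L[ℝ] ℝ) (β : V [⋀^Fin l]→L[ℝ] ℝ)
    (G : (Fin (l + 2) → V) → ℝ)
    (hG : ∀ x y w, G (Fin.cons x (Fin.cons y w)) = α ![x, y] * β w) (v : Fin (l + 2) → V) :
    signedPermSum G v = l.factorial * ∑ i : Fin (l + 2), ∑ j : Fin (l + 1), (-1) ^ (i + j : ℕ) *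
      (α ![v i, v (i.succAbove j)] * β (fun k => v (i.succAbove (j.succAbove k)))) := by
  rw [signedPermSum_succ, Finset.mul_sum]
  refine Finset.sum_congr rfl fun i _ => ?_
  rw [signedPermSum_succ, Finset.mul_sum, Finset.mul_sum]
  refine Finset.sum_congr rfl fun j _ => ?_
  simp only [hG, signedPermSum_mul_alternating]
  ring

theorem wedge_two_one (α : V [⋀^Fin 2]→L[ℝ] ℝ) (β : V [⋀^Fin 1]→L[ℝ] ℝ) (u v w : V) :
    wedge α β ![u, v, w] =
      α ![u, v] * β ![w] - α ![u, w] * β ![v] + α ![v, w] * β ![u] := by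
  rw [wedge_apply]
  have h := signedPermSum_two_add (l := 1) α β
    (fun w => α (fun i => w (Fin.castAdd 1 i)) * β (fun j => w (Fin.natAdd 2 j)))
    (fun x y w => by
      congr 2
      · funext i; fin_cases i <;> rfl
      · funext i; fin_cases i; rfl) ![u, v, w]
  refine (congrArg _ h).trans ?_
  simp only [Fin.sum_univ_succ, Fin.sum_univ_zero]
  simp only [vec_one_eta (v := fun k => (![u, v, w] : Fin 3 → V) _)]
  simp [Fin.succAbove, Fin.lt_def]
  rw [form_two_swap α u v, form_two_swap α u w, form_two_swap α v w]
  ring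

theorem wedge_two_two (α β : V [⋀^Fin 2]→L[ℝ] ℝ) (u v w x : V) :
    wedge α β ![u, v, w, x] =
      α ![u, v] * β ![w, x] - α ![u, w] * β ![v, x] + α ![u, x] * β ![v, w]
      + α ![v, w] * β ![u, x] - α ![v, x] * β ![u, w] + α ![w, x] * β ![u, v] := by
  rw [wedge_apply]
  have h := signedPermSum_two_add (l := 2) α β
    (fun w => α (fun i => w (Fin.castAdd 2 i)) * β (fun j => w (Fin.natAdd 2 j)))
    (fun x y w => by
      congr 2
      · funext i; fin_cases i <;> rfl
      · funext i; fin_cases i <;> rfl) ![u, v, w, x]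
  refine (congrArg _ h).trans ?_
  simp only [Fin.sum_univ_succ, Fin.sum_univ_zero]
  simp only [vec_two_eta (v := fun k => (![u, v, w, x] : Fin 4 → V) _)]
  simp [Fin.succAbove, Fin.lt_def]
  rw [form_two_swap α u v, form_two_swap α u w, form_two_swap α u x, form_two_swap α v w,
    form_two_swap α v x, form_two_swap α w x]
  ring

theorem wedge_two_three (α : V [⋀^Fin 2]→L[ℝ] ℝ) (β : V [⋀^Fin 3]→L[ℝ] ℝ) (u v w x y : V) :
    wedge α β ![u, v, w, x, y] =
      α ![u, v] * β ![w, x, y] - α ![u, w] * β ![v, x, y] + α ![u, x] * β ![v, w, y]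
      - α ![u, y] * β ![v, w, x] + α ![v, w] * β ![u, x, y] - α ![v, x] * β ![u, w, y]
      + α ![v, y] * β ![u, w, x] + α ![w, x] * β ![u, v, y] - α ![w, y] * β ![u, v, x]
      + α ![x, y] * β ![u, v, w] := by
  rw [wedge_apply]
  have h := signedPermSum_two_add (l := 3) α β
    (fun w => α (fun i => w (Fin.castAdd 3 i)) * β (fun j => w (Fin.natAdd 2 j)))
    (fun x y w => by
      congr 2
      · funext i; fin_cases i <;> rfl
      · funext i; fin_cases i <;> rfl) ![u, v, w, x, y]
  refine (congrArg _ h).trans ?_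
  simp only [Fin.sum_univ_succ, Fin.sum_univ_zero]
  simp only [vec_three_eta (v := fun k => (![u, v, w, x, y] : Fin 5 → V) _)]
  simp [Fin.succAbove, Fin.lt_def]
  rw [form_two_swap α u v, form_two_swap α u w, form_two_swap α u x, form_two_swap α u y,
    form_two_swap α v w, form_two_swap α v x, form_two_swap α v y, form_two_swap α w x,
    form_two_swap α w y, form_two_swap α x y,
    show (Nat.factorial 3 : ℝ) = 6 by norm_num [Nat.factorial]]
  ring

theorem wedge_comp {W : Type*} [AddCommGroup W] [Module ℝ W] [TopologicalSpace W] {k l : ℕ}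
    (α : V [⋀^Fin k]→L[ℝ] ℝ) (β : V [⋀^Fin l]→L[ℝ] ℝ) (f : W →L[ℝ] V) :
    wedge (α.compContinuousLinearMap f) (β.compContinuousLinearMap f) =
      (wedge α β).compContinuousLinearMap f := by
  ext v
  rw [ContinuousAlternatingMap.compContinuousLinearMap_apply, wedge_apply, wedge_apply]
  rfl

theorem wedge_add_left {k l : ℕ} (α α' : V [⋀^Fin k]→L[ℝ] ℝ) (β : V [⋀^Fin l]→L[ℝ] ℝ) :
    wedge (α + α') β = wedge α β + wedge α' β := by
  ext v
  simp only [wedge_apply, ContinuousAlternatingMap.add_apply, signedPermSum, ← mul_add,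
    ← Finset.sum_add_distrib, add_mul]

theorem wedge_add_right {k l : ℕ} (α : V [⋀^Fin k]→L[ℝ] ℝ) (β β' : V [⋀^Fin l]→L[ℝ] ℝ) :
    wedge α (β + β') = wedge α β + wedge α β' := by
  ext v
  simp only [wedge_apply, ContinuousAlternatingMap.add_apply, signedPermSum, ← mul_add,
    ← Finset.sum_add_distrib]

theorem wedge_smul_left {k l : ℕ} (c : ℝ) (α : V [⋀^Fin k]→L[ℝ] ℝ) (β : V [⋀^Fin l]→L[ℝ] ℝ) :
    wedge (c • α) β = c • wedge α β := by
  ext v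
  simp only [wedge_apply, ContinuousAlternatingMap.smul_apply, signedPermSum, smul_eq_mul,
    Finset.mul_sum]
  refine Finset.sum_congr rfl fun _ _ => by ring

theorem wedge_smul_right {k l : ℕ} (c : ℝ) (α : V [⋀^Fin k]→L[ℝ] ℝ) (β : V [⋀^Fin l]→L[ℝ] ℝ) :
    wedge α (c • β) = c • wedge α β := by
  ext v
  simp only [wedge_apply, ContinuousAlternatingMap.smul_apply, signedPermSum, smul_eq_mul,
    Finset.mul_sum]
  refine Finset.sum_congr rfl fun _ _ => by ring

theorem wedge_two_two_comm (α β : V [⋀^Fin 2]→L[ℝ] ℝ) : wedge α β = wedge β α := by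
  ext v
  rw [show v = ![v 0, v 1, v 2, v 3] from vec_four_eta, wedge_two_two, wedge_two_two]
  ring

end Linear

/-! ### Differential forms on normed spaces -/

section NormedForms

variable {E F G : Type*} [NormedAddCommGroup E] [NormedSpace ℝ E]
  [NormedAddCommGroup F] [NormedSpace ℝ F] [NormedAddCommGroup G] [NormedSpace ℝ G]
  {k l : ℕ} {r : WithTop ℕ∞}

theorem contDiffAt_form_apply {η : G → E [⋀^Fin k]→L[ℝ] ℝ} {y : G}
    (h : ContDiffAt ℝ r η y) (v : Fin k → E) : ContDiffAt ℝ r (fun z => η z v) y :=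
  ((ContinuousMultilinearMap.apply ℝ (fun _ : Fin k => E) ℝ v).comp
    (ContinuousAlternatingMap.toContinuousMultilinearMapCLM ℝ)).contDiff.contDiffAt.comp y h

/-- The values on tuples of basis vectors embed the alternating forms linearly in some `ℝ^N`. A
linear left inverse of this embedding is continuous in finite dimension and recovers `η` from its
values. -/
theorem contDiffAt_form_of_apply [FiniteDimensional ℝ E] {η : G → E [⋀^Fin k]→L[ℝ] ℝ} {y : G}
    (h : ∀ v : Fin k → E, ContDiffAt ℝ r (fun z => η z v) y) : ContDiffAt ℝ r η y := by
  let e := Module.finBasis ℝ E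
  let T : (E [⋀^Fin k]→L[ℝ] ℝ) →ₗ[ℝ] ((Fin k → Fin (Module.finrank ℝ E)) → ℝ) :=
    { toFun := fun α i => α (fun j => e (i j))
      map_add' := fun _ _ => rfl
      map_smul' := fun _ _ => rfl }
  have hT : LinearMap.ker T = ⊥ := by
    rw [LinearMap.ker_eq_bot']
    intro α hα
    apply ContinuousAlternatingMap.toAlternatingMap_injective
    exact e.ext_alternating fun v _ => congrFun hα v
  obtain ⟨S, hS⟩ := T.exists_leftInverse_of_injective hT
  have h1 : ContDiffAt ℝ r (fun z => T (η z)) y := by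
    rw [contDiffAt_pi]
    intro i
    exact h _
  have h2 : η = fun z => (LinearMap.toContinuousLinearMap S) (T (η z)) := by
    funext z
    exact (LinearMap.congr_fun hS (η z)).symm
  rw [h2]
  exact (LinearMap.toContinuousLinearMap S).contDiff.contDiffAt.comp y h1

theorem contDiffAt_wedge [FiniteDimensional ℝ E] {α : G → E [⋀^Fin k]→L[ℝ] ℝ}
    {β : G → E [⋀^Fin l]→L[ℝ] ℝ} {y : G} (hα : ContDiffAt ℝ r α y) (hβ : ContDiffAt ℝ r β y) :
    ContDiffAt ℝ r (fun z => wedge (α z) (β z)) y := by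
  refine contDiffAt_form_of_apply fun v => ?_
  simp only [wedge_apply, signedPermSum]
  refine contDiffAt_const.mul (ContDiffAt.sum fun τ _ => contDiffAt_const.mul ?_)
  exact (contDiffAt_form_apply hα _).mul (contDiffAt_form_apply hβ _)

theorem contDiffAt_compContinuousLinearMap [FiniteDimensional ℝ E]
    {η : G → F [⋀^Fin k]→L[ℝ] ℝ} {g : G → E →L[ℝ] F} {y : G}
    (hη : ContDiffAt ℝ r η y) (hg : ContDiffAt ℝ r g y) :
    ContDiffAt ℝ r (fun z => (η z).compContinuousLinearMap (g z)) y := by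
  refine contDiffAt_form_of_apply fun v => ?_
  have h1 : ContDiffAt ℝ r (fun z =>
      ContinuousMultilinearMap.compContinuousLinearMapContinuousMultilinear ℝ
        (fun _ : Fin k => E) (fun _ => F) ℝ (fun _ => g z)) y :=
    (ContinuousMultilinearMap.contDiff _).contDiffAt.comp y (contDiffAt_pi.2 fun _ => hg)
  have h2 : ContDiffAt ℝ r (fun z => (η z).toContinuousMultilinearMap) y :=
    (ContinuousAlternatingMap.toContinuousMultilinearMapCLM (E := F) (F := ℝ) (ι := Fin k) (𝕜 := ℝ)
      ℝ).contDiff.contDiffAt.comp y hη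
  exact (ContinuousMultilinearMap.apply ℝ (fun _ : Fin k => E) ℝ v).contDiff.contDiffAt.comp y
    (h1.clm_apply h2)

theorem contDiffAt_extDeriv {η : E → E [⋀^Fin k]→L[ℝ] ℝ} {y : E}
    (h : ContDiffAt ℝ ∞ η y) : ContDiffAt ℝ ∞ (extDeriv η) y :=
  ContDiffAt.comp (g := ContinuousAlternatingMap.alternatizeUncurryFinCLM (n := k) ℝ E ℝ) y
    (ContinuousLinearMap.contDiff _).contDiffAt (h.fderiv_right (m := ∞) (by simp))

theorem differentiableAt_form_apply {η : G → E [⋀^Fin k]→L[ℝ] ℝ} {y : G}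
    (h : DifferentiableAt ℝ η y) (v : Fin k → E) : DifferentiableAt ℝ (fun z => η z v) y :=
  ((ContinuousMultilinearMap.apply ℝ (fun _ : Fin k => E) ℝ v).comp
    (ContinuousAlternatingMap.toContinuousMultilinearMapCLM ℝ)).differentiableAt.comp y h

theorem extDeriv_one_apply {η : E → E [⋀^Fin 1]→L[ℝ] ℝ} {y : E} (h : DifferentiableAt ℝ η y)
    (u v : E) : extDeriv η y ![u, v] =
      fderiv ℝ (fun z => η z ![v]) y u - fderiv ℝ (fun z => η z ![u]) y v := by
  have r0 : Fin.removeNth (n := 1) (α := fun _ => E) 0 ![u, v] = ![v] := by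
    funext i; fin_cases i; rfl
  have r1 : Fin.removeNth (n := 1) (α := fun _ => E) 1 ![u, v] = ![u] := by
    funext i; fin_cases i; rfl
  rw [extDeriv_apply h, Fin.sum_univ_two, r0, r1]
  simp
  ring

theorem extDeriv_two_apply {η : E → E [⋀^Fin 2]→L[ℝ] ℝ} {y : E} (h : DifferentiableAt ℝ η y)
    (u v w : E) : extDeriv η y ![u, v, w] =
      fderiv ℝ (fun z => η z ![v, w]) y u - fderiv ℝ (fun z => η z ![u, w]) y v +
        fderiv ℝ (fun z => η z ![u, v]) y w := by
  have r0 : Fin.removeNth (n := 2) (α := fun _ => E) 0 ![u, v, w] = ![v, w] := by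
    funext i; fin_cases i <;> rfl
  have r1 : Fin.removeNth (n := 2) (α := fun _ => E) 1 ![u, v, w] = ![u, w] := by
    funext i; fin_cases i <;> rfl
  have r2 : Fin.removeNth (n := 2) (α := fun _ => E) 2 ![u, v, w] = ![u, v] := by
    funext i; fin_cases i <;> rfl
  rw [extDeriv_apply h, Fin.sum_univ_three, r0, r1, r2]
  simp
  ring

theorem extDeriv_three_apply {η : E → E [⋀^Fin 3]→L[ℝ] ℝ} {y : E} (h : DifferentiableAt ℝ η y)
    (u v w x : E) : extDeriv η y ![u, v, w, x] =
      fderiv ℝ (fun z => η z ![v, w, x]) y u - fderiv ℝ (fun z => η z ![u, w, x]) y v +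
        fderiv ℝ (fun z => η z ![u, v, x]) y w - fderiv ℝ (fun z => η z ![u, v, w]) y x := by
  have r0 : Fin.removeNth (n := 3) (α := fun _ => E) 0 ![u, v, w, x] = ![v, w, x] := by
    funext i; fin_cases i <;> rfl
  have r1 : Fin.removeNth (n := 3) (α := fun _ => E) 1 ![u, v, w, x] = ![u, w, x] := by
    funext i; fin_cases i <;> rfl
  have r2 : Fin.removeNth (n := 3) (α := fun _ => E) 2 ![u, v, w, x] = ![u, v, x] := by
    funext i; fin_cases i <;> rfl
  have r3 : Fin.removeNth (n := 3) (α := fun _ => E) 3 ![u, v, w, x] = ![u, v, w] := by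
    funext i; fin_cases i <;> rfl
  rw [extDeriv_apply h, Fin.sum_univ_four, r0, r1, r2, r3]
  simp
  ring

theorem fderiv_mul_apply {f g : E → ℝ} {y : E} (hf : DifferentiableAt ℝ f y)
    (hg : DifferentiableAt ℝ g y) (u : E) :
    fderiv ℝ (fun z => f z * g z) y u = f y * fderiv ℝ g y u + g y * fderiv ℝ f y u := by
  exact (DFunLike.congr_fun (hf.hasFDerivAt.mul hg.hasFDerivAt).fderiv u).trans (by simp)

theorem fderiv_mul_sub_mul_apply {f g f' g' : E → ℝ} {y : E} (hf : DifferentiableAt ℝ f y)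
    (hg : DifferentiableAt ℝ g y) (hf' : DifferentiableAt ℝ f' y) (hg' : DifferentiableAt ℝ g' y)
    (u : E) :
    fderiv ℝ (fun z => f z * g z - f' z * g' z) y u =
      (f y * fderiv ℝ g y u + g y * fderiv ℝ f y u) -
        (f' y * fderiv ℝ g' y u + g' y * fderiv ℝ f' y u) := by
  exact (DFunLike.congr_fun ((hf.hasFDerivAt.mul hg.hasFDerivAt).sub
    (hf'.hasFDerivAt.mul hg'.hasFDerivAt)).fderiv u).trans (by simp)

theorem fderiv_mul_sub_mul_add_mul_apply {f g f' g' f'' g'' : E → ℝ} {y : E}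
    (hf : DifferentiableAt ℝ f y) (hg : DifferentiableAt ℝ g y) (hf' : DifferentiableAt ℝ f' y)
    (hg' : DifferentiableAt ℝ g' y) (hf'' : DifferentiableAt ℝ f'' y)
    (hg'' : DifferentiableAt ℝ g'' y) (u : E) :
    fderiv ℝ (fun z => f z * g z - f' z * g' z + f'' z * g'' z) y u =
      (f y * fderiv ℝ g y u + g y * fderiv ℝ f y u) -
        (f' y * fderiv ℝ g' y u + g' y * fderiv ℝ f' y u) +
        (f'' y * fderiv ℝ g'' y u + g'' y * fderiv ℝ f'' y u) := by
  exact (DFunLike.congr_fun (((hf.hasFDerivAt.mul hg.hasFDerivAt).sub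
    (hf'.hasFDerivAt.mul hg'.hasFDerivAt)).add
    (hf''.hasFDerivAt.mul hg''.hasFDerivAt)).fderiv u).trans (by simp)

theorem extDeriv_smul_two [FiniteDimensional ℝ E] {f : E → ℝ} {η : E → E [⋀^Fin 2]→L[ℝ] ℝ} {y : E}
    (hf : DifferentiableAt ℝ f y) (hη : DifferentiableAt ℝ η y) (u v w : E) :
    extDeriv (fun z => f z • η z) y ![u, v, w] =
      fderiv ℝ f y u * η y ![v, w] - fderiv ℝ f y v * η y ![u, w] + fderiv ℝ f y w * η y ![u, v]
        + f y * extDeriv η y ![u, v, w] := by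
  have ha := fun a b => differentiableAt_form_apply hη ![a, b]
  have e := fun a b c => fderiv_mul_apply hf (ha a b) c
  refine (extDeriv_two_apply (hf.smul hη) u v w).trans ?_
  rw [extDeriv_two_apply hη]
  simp only [ContinuousAlternatingMap.smul_apply, smul_eq_mul, Pi.smul_apply', e]
  ring

/-- The term `-α ∧ dβ` of the Leibniz rule is written `-dβ ∧ α`, as a two-form commutes with a
one-form; this way the formula for two-form wedge one-form suffices. -/
theorem extDeriv_wedge_one_one [FiniteDimensional ℝ E] {α β : E → E [⋀^Fin 1]→L[ℝ] ℝ} {y : E}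
    (hα : ContDiffAt ℝ 1 α y) (hβ : ContDiffAt ℝ 1 β y) :
    extDeriv (fun z => wedge (α z) (β z)) y =
      wedge (extDeriv α y) (β y) - wedge (extDeriv β y) (α y) := by
  have h1 := hα.differentiableAt one_ne_zero
  have h2 := hβ.differentiableAt one_ne_zero
  have ha := fun a => differentiableAt_form_apply h1 ![a]
  have hb := fun a => differentiableAt_form_apply h2 ![a]
  ext s
  obtain ⟨u, v, w, rfl⟩ : ∃ u v w, s = ![u, v, w] := ⟨_, _, _, vec_three_eta⟩
  rw [extDeriv_two_apply ((contDiffAt_wedge hα hβ).differentiableAt one_ne_zero),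
    ContinuousAlternatingMap.sub_apply]
  rw [wedge_two_one, wedge_two_one]
  simp only [extDeriv_one_apply h1, extDeriv_one_apply h2]
  simp only [wedge_one_one]
  have e := fun a b c => fderiv_mul_sub_mul_apply (ha a) (hb b) (ha b) (hb a) c
  simp only [e]
  ring

/-- Both sides are evaluated on `v` because their degrees are written `2 + 1 + 1` and `2 + (1 + 1)`.
-/
theorem extDeriv_wedge_two_one [FiniteDimensional ℝ E] {α : E → E [⋀^Fin 2]→L[ℝ] ℝ}
    {β : E → E [⋀^Fin 1]→L[ℝ] ℝ} {y : E}
    (hα : ContDiffAt ℝ 1 α y) (hβ : ContDiffAt ℝ 1 β y) (hd : extDeriv α y = 0)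
    (v : Fin 4 → E) :
    extDeriv (fun z => wedge (α z) (β z)) y v = wedge (α y) (extDeriv β y) v := by
  have h1 := hα.differentiableAt one_ne_zero
  have h2 := hβ.differentiableAt one_ne_zero
  have ha := fun a b => differentiableAt_form_apply h1 ![a, b]
  have hb := fun a => differentiableAt_form_apply h2 ![a]
  have hd' : ∀ a b c, fderiv ℝ (fun z => α z ![b, c]) y a - fderiv ℝ (fun z => α z ![a, c]) y b +
        fderiv ℝ (fun z => α z ![a, b]) y c = 0 := by
    intro a b c
    rw [← extDeriv_two_apply h1, hd]
    rfl
  obtain ⟨a, b, c, d, rfl⟩ : ∃ a b c d, v = ![a, b, c, d] := ⟨_, _, _, _, vec_four_eta⟩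
  have e1 := extDeriv_three_apply ((contDiffAt_wedge hα hβ).differentiableAt one_ne_zero) a b c d
  refine e1.trans ?_
  rw [wedge_two_two]
  simp only [extDeriv_one_apply h2, wedge_two_one]
  have e := fun a b c d => fderiv_mul_sub_mul_add_mul_apply (ha a b) (hb c) (ha a c) (hb b)
    (ha b c) (hb a) d
  simp only [e]
  -- The product rule gives the terms of `α ∧ dβ` together with those of `dα ∧ β`; the latter vanish
  -- by closedness on each triple of vectors.
  linear_combination β y ![d] * hd' a b c - β y ![c] * hd' a b d + β y ![b] * hd' a c d
    - β y ![a] * hd' b c d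

end NormedForms

/-! ### Pullbacks to normed spaces and the exterior derivative on manifolds -/

section ManifoldForms

variable {n k l : ℕ} {M : Type*} [TopologicalSpace M] [ChartedSpace (EuclideanSpace ℝ (Fin n)) M]
  {E : Type*} [NormedAddCommGroup E] [NormedSpace ℝ E]

/-- The pullback of a form on a manifold by a map from a normed space. -/
def formPull (f : E → M) (η : DiffForm n M k) : E → E [⋀^Fin k]→L[ℝ] ℝ :=
  fun y => (η (f y)).compContinuousLinearMap (mfderiv 𝓘(ℝ, E) (𝓡 n) f y)

theorem fderiv_eq_of_hasMFDerivAt {F : Type*} [NormedAddCommGroup F] [NormedSpace ℝ F] {f : E → F}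
    {y : E} {f' : E →L[ℝ] F} (h : HasMFDerivAt 𝓘(ℝ, E) 𝓘(ℝ, F) f y f') : fderiv ℝ f y = f' :=
  have h2 : HasFDerivAt f f' y := h.hasFDerivAt
  h2.fderiv

/-- Every tangent space is the model space by definition, so the same vectors can be used at two
equal points without a cast. -/
theorem DiffForm.apply_congr (η : DiffForm n M k) {p q : M} (h : p = q)
    (w : Fin k → EuclideanSpace ℝ (Fin n)) : η p w = η q w := by
  subst h
  rfl

theorem formPull_apply_of_hasMFDerivAt {f : E → M} {y : E}
    {f' : E →L[ℝ] EuclideanSpace ℝ (Fin n)} (h : HasMFDerivAt 𝓘(ℝ, E) (𝓡 n) f y f')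
    (η : DiffForm n M k) (v : Fin k → E) : formPull f η y v = η (f y) (fun i => f' (v i)) := by
  unfold formPull
  rw [h.mfderiv]
  rfl

theorem contDiffAt_extChartAt_comp {f : E → M} {y₁ : E}
    (hf : ContMDiffAt 𝓘(ℝ, E) (𝓡 n) ∞ f y₁) :
    ContDiffAt ℝ ∞ (fun y => extChartAt (𝓡 n) (f y₁) (f y)) y₁ := by
  have h : ContMDiffAt 𝓘(ℝ, E) (𝓡 n) ∞ (fun y => extChartAt (𝓡 n) (f y₁) (f y)) y₁ :=
    (contMDiffAt_extChartAt (I := 𝓡 n) (x := f y₁) (n := ∞)).comp y₁ hf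
  exact h.contDiffAt

theorem DiffForm.IsSmooth.contDiffAt_inChart {η : DiffForm n M k} (h : η.IsSmooth) {x₀ : M}
    {y : EuclideanSpace ℝ (Fin n)} (hy : y ∈ (extChartAt (𝓡 n) x₀).target) :
    ContDiffAt ℝ ∞ (η.inChart x₀) y :=
  (h x₀).contDiffAt ((isOpen_extChartAt_target x₀).mem_nhds hy)

variable [IsManifold (𝓡 n) ∞ M]

theorem hasMFDerivAt_extChartAt_symm_self {x₀ : M} {y : EuclideanSpace ℝ (Fin n)}
    (hy : y ∈ (extChartAt (𝓡 n) x₀).target) :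
    HasMFDerivAt (𝓡 n) (𝓡 n) (extChartAt (𝓡 n) x₀).symm y
      (mfderiv (𝓡 n) (𝓡 n) (extChartAt (𝓡 n) x₀).symm y) :=
  (((contMDiffOn_extChartAt_symm (n := ∞) x₀).contMDiffAt
    ((isOpen_extChartAt_target x₀).mem_nhds hy)).mdifferentiableAt (by simp)).hasMFDerivAt

theorem contMDiffAt_extChartAt_symm {x₀ : M} {y : EuclideanSpace ℝ (Fin n)}
    (hy : y ∈ (extChartAt (𝓡 n) x₀).target) :
    ContMDiffAt (𝓡 n) (𝓡 n) ∞ (extChartAt (𝓡 n) x₀).symm y :=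
  (contMDiffOn_extChartAt_symm (n := ∞) x₀).contMDiffAt
    ((isOpen_extChartAt_target x₀).mem_nhds hy)

/-- Inserting chart and inverse chart at the fixed point `f y₁` factors `f` locally through `ℝⁿ`.
This reduces smoothness and exterior derivatives of pullbacks to calculus on normed spaces. -/
theorem formPull_eventuallyEq {f : E → M} {y₁ : E}
    (hf : ContMDiffAt 𝓘(ℝ, E) (𝓡 n) ∞ f y₁) (η : DiffForm n M k) :
    formPull f η =ᶠ[𝓝 y₁] fun y =>
      (η.inChart (f y₁) (extChartAt (𝓡 n) (f y₁) (f y))).compContinuousLinearMap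
        (fderiv ℝ (fun y => extChartAt (𝓡 n) (f y₁) (f y)) y) := by
  have hs : ∀ᶠ y in 𝓝 y₁, f y ∈ (extChartAt (𝓡 n) (f y₁)).source :=
    hf.continuousAt.eventually_mem (extChartAt_source_mem_nhds (I := 𝓡 n) (f y₁))
  have hg : ∀ᶠ y in 𝓝 y₁, DifferentiableAt ℝ (fun y => extChartAt (𝓡 n) (f y₁) (f y)) y := by
    have := (contDiffAt_extChartAt_comp hf).of_le (m := 1) (by simp)
    exact (this.eventually (by simp)).mono fun y hy => hy.differentiableAt one_ne_zero
  filter_upwards [hs.eventually_nhds, hg] with y hsy hgy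
  have hy := hsy.self_of_nhds
  set c := extChartAt (𝓡 n) (f y₁) with hc
  have h1 := hasMFDerivAt_extChartAt_symm_self (c.map_source hy)
  have h2 : HasMFDerivAt 𝓘(ℝ, E) (𝓡 n) (fun y => c (f y)) y (fderiv ℝ (fun y => c (f y)) y) :=
    hgy.hasFDerivAt.hasMFDerivAt
  have h3 := HasMFDerivAt.comp y h1 h2
  have h4 : f =ᶠ[𝓝 y] (c.symm ∘ fun y => c (f y)) := by
    filter_upwards [hsy] with z hz
    exact (c.left_inv hz).symm
  have h5 := h3.congr_of_eventuallyEq h4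
  ext v
  rw [formPull_apply_of_hasMFDerivAt h5]
  exact η.apply_congr (c.left_inv hy).symm _

theorem DiffForm.IsSmooth.contDiffAt_formPull [FiniteDimensional ℝ E] {η : DiffForm n M k}
    (h : η.IsSmooth) {f : E → M} {y₁ : E} (hf : ContMDiffAt 𝓘(ℝ, E) (𝓡 n) ∞ f y₁) :
    ContDiffAt ℝ ∞ (formPull f η) y₁ := by
  refine ContDiffAt.congr_of_eventuallyEq ?_ (formPull_eventuallyEq hf η)
  have hg := contDiffAt_extChartAt_comp hf
  refine contDiffAt_compContinuousLinearMap ?_ (hg.fderiv_right (m := ∞) (by simp))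
  exact ContDiffAt.comp y₁ (h.contDiffAt_inChart (mem_extChartAt_target _)) hg

/-- The exterior derivative commutes with pullback by a smooth map from a normed space. -/
theorem extDeriv_formPull {η : DiffForm n M k}
    (h : η.IsSmooth) {f : E → M} {y₁ : E} (hf : ContMDiffAt 𝓘(ℝ, E) (𝓡 n) ∞ f y₁) :
    extDeriv (formPull f η) y₁ = formPull f η.d y₁ := by
  have hg := contDiffAt_extChartAt_comp hf
  rw [(formPull_eventuallyEq hf η).extDeriv_eq]
  rw [extDeriv_pullback (r := ∞) (f := fun y => extChartAt (𝓡 n) (f y₁) (f y))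
    ((h.contDiffAt_inChart (mem_extChartAt_target _)).differentiableAt (by simp)) hg
    (by
      rw [minSmoothness_of_isRCLikeNormedField]
      exact WithTop.coe_le_coe.2 (le_top : (2 : ℕ∞) ≤ ⊤))]
  have h1 : MDifferentiableAt (𝓡 n) (𝓡 n) (extChartAt (𝓡 n) (f y₁)) (f y₁) :=
    (contMDiffAt_extChartAt (I := 𝓡 n) (x := f y₁) (n := ∞)).mdifferentiableAt (by simp)
  have h3 := HasMFDerivAt.comp y₁ h1.hasMFDerivAt (hf.mdifferentiableAt (by simp)).hasMFDerivAt
  have h4 := fderiv_eq_of_hasMFDerivAt h3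
  exact congrArg (fun L : E →L[ℝ] EuclideanSpace ℝ (Fin n) =>
    (extDeriv (η.inChart (f y₁)) (extChartAt (𝓡 n) (f y₁) (f y₁))).compContinuousLinearMap L) h4

end ManifoldForms

/-! ### Smoothness, products and exterior derivatives of forms on manifolds -/

section ManifoldCalculus

variable {n k l : ℕ} {M : Type*} [TopologicalSpace M] [ChartedSpace (EuclideanSpace ℝ (Fin n)) M]

theorem DiffForm.inChart_wedge (α : DiffForm n M k) (β : DiffForm n M l) (x₀ : M)
    (y : EuclideanSpace ℝ (Fin n)) :
    (α.wedge β).inChart x₀ y = _root_.wedge (α.inChart x₀ y) (β.inChart x₀ y) :=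
  (wedge_comp _ _ _).symm

theorem DiffForm.inChart_add (α β : DiffForm n M k) (x₀ : M) (y : EuclideanSpace ℝ (Fin n)) :
    (α + β).inChart x₀ y = α.inChart x₀ y + β.inChart x₀ y := rfl

theorem DiffForm.inChart_sub (α β : DiffForm n M k) (x₀ : M) (y : EuclideanSpace ℝ (Fin n)) :
    (α - β).inChart x₀ y = α.inChart x₀ y - β.inChart x₀ y := rfl

theorem DiffForm.isSmooth_of_contDiffAt {η : DiffForm n M k}
    (h : ∀ x₀ : M, ∀ y ∈ (extChartAt (𝓡 n) x₀).target, ContDiffAt ℝ ∞ (η.inChart x₀) y) :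
    η.IsSmooth :=
  fun x₀ y hy => (h x₀ y hy).contDiffWithinAt

theorem DiffForm.IsSmooth.wedge {α : DiffForm n M k} {β : DiffForm n M l} (hα : α.IsSmooth)
    (hβ : β.IsSmooth) : (α.wedge β).IsSmooth := by
  refine DiffForm.isSmooth_of_contDiffAt fun x₀ y hy => ?_
  rw [show (α.wedge β).inChart x₀ = _ from funext fun y => α.inChart_wedge β x₀ y]
  exact contDiffAt_wedge (hα.contDiffAt_inChart hy) (hβ.contDiffAt_inChart hy)

theorem DiffForm.IsSmooth.add {α β : DiffForm n M k} (hα : α.IsSmooth)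
    (hβ : β.IsSmooth) : (α + β).IsSmooth :=
  fun x₀ => (hα x₀).add (hβ x₀)

theorem DiffForm.IsSmooth.sub {α β : DiffForm n M k} (hα : α.IsSmooth)
    (hβ : β.IsSmooth) : (α - β).IsSmooth :=
  fun x₀ => (hα x₀).sub (hβ x₀)

section

variable [IsManifold (𝓡 n) ∞ M]

theorem contDiffAt_comp_extChartAt_symm {f : M → ℝ} (hf : ContMDiff (𝓡 n) 𝓘(ℝ, ℝ) ∞ f) {x₀ : M}
    {y : EuclideanSpace ℝ (Fin n)} (hy : y ∈ (extChartAt (𝓡 n) x₀).target) :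
    ContDiffAt ℝ ∞ (fun y => f ((extChartAt (𝓡 n) x₀).symm y)) y := by
  have h : ContMDiffAt (𝓡 n) 𝓘(ℝ, ℝ) ∞ (fun y => f ((extChartAt (𝓡 n) x₀).symm y)) y :=
    ContMDiffAt.comp y (hf _) (contMDiffAt_extChartAt_symm hy)
  exact h.contDiffAt

theorem DiffForm.IsSmooth.fsmul {f : M → ℝ} {α : DiffForm n M k}
    (hf : ContMDiff (𝓡 n) 𝓘(ℝ, ℝ) ∞ f) (hα : α.IsSmooth) : (DiffForm.fsmul f α).IsSmooth :=
  DiffForm.isSmooth_of_contDiffAt fun _ _ hy =>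
    (contDiffAt_comp_extChartAt_symm hf hy).smul (hα.contDiffAt_inChart hy)

/-- Chart independence of `d`, which is defined at each point by the chart of that point: the
inverse of any preferred chart is smooth, and `d` commutes with pullback along it. -/
theorem DiffForm.inChart_d {η : DiffForm n M k} (h : η.IsSmooth) {x₀ : M}
    {y : EuclideanSpace ℝ (Fin n)} (hy : y ∈ (extChartAt (𝓡 n) x₀).target) :
    η.d.inChart x₀ y = extDeriv (η.inChart x₀) y :=
  (extDeriv_formPull h (contMDiffAt_extChartAt_symm hy)).symm

theorem DiffForm.IsSmooth.d {η : DiffForm n M k} (h : η.IsSmooth) : η.d.IsSmooth := by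
  refine DiffForm.isSmooth_of_contDiffAt fun x₀ y hy => ?_
  refine (contDiffAt_extDeriv (h.contDiffAt_inChart hy)).congr_of_eventuallyEq ?_
  filter_upwards [(isOpen_extChartAt_target x₀).mem_nhds hy] with z hz
  exact DiffForm.inChart_d h hz

theorem mfderiv_extChartAt_symm_mfderiv_extChartAt (p : M) (u : EuclideanSpace ℝ (Fin n)) :
    (mfderiv (𝓡 n) (𝓡 n) (extChartAt (𝓡 n) p).symm (extChartAt (𝓡 n) p p)
      (mfderiv (𝓡 n) (𝓡 n) (extChartAt (𝓡 n) p) p u : EuclideanSpace ℝ (Fin n)) :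
        EuclideanSpace ℝ (Fin n)) = u := by
  have h1 : MDifferentiableAt (𝓡 n) (𝓡 n) (extChartAt (𝓡 n) p) p :=
    (contMDiffAt_extChartAt (I := 𝓡 n) (x := p) (n := ∞)).mdifferentiableAt (by simp)
  have h2 := hasMFDerivAt_extChartAt_symm_self (mem_extChartAt_target (I := 𝓡 n) p)
  have h3 := HasMFDerivAt.comp p h2 h1.hasMFDerivAt
  have h4 : (id : M → M) =ᶠ[𝓝 p] (extChartAt (𝓡 n) p).symm ∘ extChartAt (𝓡 n) p := by
    filter_upwards [extChartAt_source_mem_nhds (I := 𝓡 n) p] with z hz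
    exact ((extChartAt (𝓡 n) p).left_inv hz).symm
  have h5 := hasMFDerivAt_unique (h3.congr_of_eventuallyEq h4) (hasMFDerivAt_id p)
  exact DFunLike.congr_fun h5 u

/-- The differentials of the chart and of its inverse compose to the identity, so nothing is lost in
the chart. Identities of forms at `p` are verified in the chart at `p` through this. -/
theorem DiffForm.apply_eq_inChart (η : DiffForm n M k) (p : M)
    (v : Fin k → TangentSpace (𝓡 n) p) :
    η p v = η.inChart p (extChartAt (𝓡 n) p p)
      (fun i => mfderiv (𝓡 n) (𝓡 n) (extChartAt (𝓡 n) p) p (v i)) :=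
  (η.apply_congr ((extChartAt (𝓡 n) p).left_inv (mem_extChartAt_source (I := 𝓡 n) p)) v).symm.trans
    (congrArg (η ((extChartAt (𝓡 n) p).symm (extChartAt (𝓡 n) p p)))
      (funext fun i => (mfderiv_extChartAt_symm_mfderiv_extChartAt p (v i)).symm))

/-- The differential of a function, as a real-valued function of tangent vectors. -/
def differential (f : M → ℝ) (p : M) (u : TangentSpace (𝓡 n) p) : ℝ :=
  mfderiv (𝓡 n) 𝓘(ℝ, ℝ) f p u

theorem DiffForm.apply_eq_of_inChart {η η' : DiffForm n M k} {p : M}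
    (h : η.inChart p (extChartAt (𝓡 n) p p) = η'.inChart p (extChartAt (𝓡 n) p p)) :
    η p = η' p := by
  ext v
  rw [DiffForm.apply_eq_inChart, h, ← DiffForm.apply_eq_inChart]

theorem DiffForm.d_add {α β : DiffForm n M k} (hα : α.IsSmooth) (hβ : β.IsSmooth) :
    (α + β).d = α.d + β.d := by
  funext p
  apply DiffForm.apply_eq_of_inChart
  have hy := mem_extChartAt_target (I := 𝓡 n) p
  rw [DiffForm.inChart_add, DiffForm.inChart_d (hα.add hβ) hy, DiffForm.inChart_d hα hy,
    DiffForm.inChart_d hβ hy]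
  exact extDeriv_add ((hα.contDiffAt_inChart hy).differentiableAt (by simp))
    ((hβ.contDiffAt_inChart hy).differentiableAt (by simp))

theorem DiffForm.d_wedge_one_one {α β : DiffForm n M 1} (hα : α.IsSmooth) (hβ : β.IsSmooth) :
    (α.wedge β).d = α.d.wedge β - β.d.wedge α := by
  funext p
  apply DiffForm.apply_eq_of_inChart
  have hy := mem_extChartAt_target (I := 𝓡 n) p
  rw [DiffForm.inChart_sub, DiffForm.inChart_d (hα.wedge hβ) hy, DiffForm.inChart_wedge,
    DiffForm.inChart_wedge, DiffForm.inChart_d hα hy, DiffForm.inChart_d hβ hy,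
    show (α.wedge β).inChart p = _ from funext fun y => α.inChart_wedge β p y]
  exact extDeriv_wedge_one_one ((hα.contDiffAt_inChart hy).of_le (by simp))
    ((hβ.contDiffAt_inChart hy).of_le (by simp))

theorem DiffForm.d_wedge_two_one {α : DiffForm n M 2} {β : DiffForm n M 1} (hα : α.IsSmooth)
    (hd : α.d = 0) (hβ : β.IsSmooth) (p : M) (v : Fin 4 → TangentSpace (𝓡 n) p) :
    (α.wedge β).d p v = (α.wedge β.d) p v := by
  have hy := mem_extChartAt_target (I := 𝓡 n) p
  refine ((α.wedge β).d.apply_eq_inChart p v).trans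
    (Eq.trans ?_ ((α.wedge β.d).apply_eq_inChart p v).symm)
  rw [DiffForm.inChart_d (hα.wedge hβ) hy, DiffForm.inChart_wedge, DiffForm.inChart_d hβ hy,
    show (α.wedge β).inChart p = _ from funext fun y => α.inChart_wedge β p y]
  refine extDeriv_wedge_two_one ((hα.contDiffAt_inChart hy).of_le (by simp))
    ((hβ.contDiffAt_inChart hy).of_le (by simp)) ?_ _
  rw [← DiffForm.inChart_d hα hy, hd]
  rfl

theorem DiffForm.d_fsmul_two {f : M → ℝ} {α : DiffForm n M 2}
    (hf : ContMDiff (𝓡 n) 𝓘(ℝ, ℝ) ∞ f) (hα : α.IsSmooth) (p : M)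
    (u v w : TangentSpace (𝓡 n) p) :
    (DiffForm.fsmul f α).d p ![u, v, w] =
      differential f p u * α p ![v, w] - differential f p v * α p ![u, w] +
        differential f p w * α p ![u, v] + f p * α.d p ![u, v, w] := by
  have hy := mem_extChartAt_target (I := 𝓡 n) p
  -- Chain rule for `f = (f ∘ c⁻¹) ∘ c` near `p`, where `c` is the chart at `p`.
  have hD : ∀ u : TangentSpace (𝓡 n) p, differential f p u =
      fderiv ℝ (fun y => f ((extChartAt (𝓡 n) p).symm y)) (extChartAt (𝓡 n) p p)
        (mfderiv (𝓡 n) (𝓡 n) (extChartAt (𝓡 n) p) p u) := by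
    intro u
    have h1 : MDifferentiableAt (𝓡 n) (𝓡 n) (extChartAt (𝓡 n) p) p :=
      (contMDiffAt_extChartAt (I := 𝓡 n) (x := p) (n := ∞)).mdifferentiableAt (by simp)
    have h2 := ((contDiffAt_comp_extChartAt_symm hf hy).differentiableAt
      (by simp)).hasFDerivAt.hasMFDerivAt
    have h3 := HasMFDerivAt.comp p h2 h1.hasMFDerivAt
    have h4 : f =ᶠ[𝓝 p] (fun y => f ((extChartAt (𝓡 n) p).symm y)) ∘ extChartAt (𝓡 n) p := by
      filter_upwards [extChartAt_source_mem_nhds (I := 𝓡 n) p] with z hz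
      exact congrArg f ((extChartAt (𝓡 n) p).left_inv hz).symm
    have h5 := (h3.congr_of_eventuallyEq h4).mfderiv
    exact DFunLike.congr_fun h5 u
  have hα' := (hα.contDiffAt_inChart hy).differentiableAt (by simp)
  have e2 : ∀ u v : TangentSpace (𝓡 n) p, α p ![u, v] =
      α.inChart p (extChartAt (𝓡 n) p p) ![mfderiv (𝓡 n) (𝓡 n) (extChartAt (𝓡 n) p) p u,
        mfderiv (𝓡 n) (𝓡 n) (extChartAt (𝓡 n) p) p v] := by
    intro u v
    rw [α.apply_eq_inChart p ![u, v]]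
    exact congrArg _ (funext fun i => by fin_cases i <;> rfl)
  have e3 : ∀ (β : DiffForm n M 3) (u v w : TangentSpace (𝓡 n) p), β p ![u, v, w] =
      β.inChart p (extChartAt (𝓡 n) p p) ![mfderiv (𝓡 n) (𝓡 n) (extChartAt (𝓡 n) p) p u,
        mfderiv (𝓡 n) (𝓡 n) (extChartAt (𝓡 n) p) p v,
        mfderiv (𝓡 n) (𝓡 n) (extChartAt (𝓡 n) p) p w] := by
    intro β u v w
    rw [β.apply_eq_inChart p ![u, v, w]]
    exact congrArg _ (funext fun i => by fin_cases i <;> rfl)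
  have e4 : f p = f ((extChartAt (𝓡 n) p).symm (extChartAt (𝓡 n) p p)) := by
    rw [(extChartAt (𝓡 n) p).left_inv (mem_extChartAt_source (I := 𝓡 n) p)]
  rw [e3, e3 α.d, e2, e2, e2, hD, hD, hD, e4, DiffForm.inChart_d (hα.fsmul hf) hy,
    DiffForm.inChart_d hα hy]
  exact extDeriv_smul_two ((contDiffAt_comp_extChartAt_symm hf hy).differentiableAt (by simp)) hα'
    _ _ _

end

section Pullback

variable {m : ℕ} {N : Type*} [TopologicalSpace N] [ChartedSpace (EuclideanSpace ℝ (Fin m)) N]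
  {E : Type*} [NormedAddCommGroup E] [NormedSpace ℝ E]

/-- Functoriality. With `g` an inverse chart it presents the chart expression of `f^*η` as a
pullback of `η` from a normed space, where smoothness and `d` are already under control. -/
theorem formPull_pullback {f : N → M} {g : E → N} {y : E}
    (hf : MDifferentiableAt (𝓡 m) (𝓡 n) f (g y)) (hg : MDifferentiableAt 𝓘(ℝ, E) (𝓡 m) g y)
    (η : DiffForm n M k) :
      formPull g (DiffForm.pullback (m := m) f η) y = formPull (fun z => f (g z)) η y := by
  have h := HasMFDerivAt.comp y hf.hasMFDerivAt hg.hasMFDerivAt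
  ext v
  refine Eq.trans ?_ (formPull_apply_of_hasMFDerivAt h η v).symm
  rfl

variable [IsManifold (𝓡 n) ∞ M] [IsManifold (𝓡 m) ∞ N]

theorem DiffForm.IsSmooth.pullback {f : N → M} (hf : ContMDiff (𝓡 m) (𝓡 n) ∞ f)
    {η : DiffForm n M k} (hη : η.IsSmooth) : (DiffForm.pullback (m := m) f η).IsSmooth := by
  refine DiffForm.isSmooth_of_contDiffAt fun x₀ y hy => ?_
  have hc := ContMDiffAt.comp y (hf _) (contMDiffAt_extChartAt_symm hy)
  refine (hη.contDiffAt_formPull hc).congr_of_eventuallyEq ?_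
  filter_upwards [(isOpen_extChartAt_target x₀).mem_nhds hy] with z hz
  exact formPull_pullback ((hf _).mdifferentiableAt (by simp))
    ((contMDiffAt_extChartAt_symm hz).mdifferentiableAt (by simp)) η

theorem DiffForm.d_pullback {f : N → M} (hf : ContMDiff (𝓡 m) (𝓡 n) ∞ f)
    {η : DiffForm n M k} (hη : η.IsSmooth) :
    (DiffForm.pullback (m := m) f η).d = DiffForm.pullback (m := m) f η.d := by
  funext p
  apply DiffForm.apply_eq_of_inChart
  have hy := mem_extChartAt_target (I := 𝓡 m) p
  have hc := ContMDiffAt.comp _ (hf _) (contMDiffAt_extChartAt_symm hy)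
  have e : ∀ {k : ℕ} (η : DiffForm n M k), (DiffForm.pullback (m := m) f η).inChart p
      =ᶠ[𝓝 (extChartAt (𝓡 m) p p)]
      formPull (fun z => f ((extChartAt (𝓡 m) p).symm z)) η := by
    intro k η
    filter_upwards [(isOpen_extChartAt_target p).mem_nhds hy] with z hz
    exact formPull_pullback ((hf _).mdifferentiableAt (by simp))
      ((contMDiffAt_extChartAt_symm hz).mdifferentiableAt (by simp)) η
  rw [DiffForm.inChart_d (hη.pullback hf) hy, (e η).extDeriv_eq, (e η.d).self_of_nhds]
  exact extDeriv_formPull hη hc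

end Pullback

end ManifoldCalculus

section OneForms

variable {V : Type*} [AddCommGroup V] [Module ℝ V] [TopologicalSpace V]

/-- A one-form as a linear functional. -/
def oneFormLinear (α : V [⋀^Fin 1]→L[ℝ] ℝ) : V →ₗ[ℝ] ℝ where
  toFun v := α ![v]
  map_add' u v := by
    have h := α.map_update_add ![u] 0 u v
    simpa [show ∀ z : V, Function.update ![u] (0 : Fin 1) z = ![z] from fun z => by
      funext i; fin_cases i; simp] using h
  map_smul' c v := by
    have h := α.map_update_smul ![v] 0 c v
    simpa [show ∀ z : V, Function.update ![v] (0 : Fin 1) z = ![z] from fun z => by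
      funext i; fin_cases i; simp] using h

end OneForms

section FormPullComp

variable {n k : ℕ} {M : Type*} [TopologicalSpace M] [ChartedSpace (EuclideanSpace ℝ (Fin n)) M]
  {E F : Type*} [NormedAddCommGroup E] [NormedSpace ℝ E] [NormedAddCommGroup F] [NormedSpace ℝ F]

theorem formPull_comp {f : E → M} {j : F → E} {j' : F →L[ℝ] E} {y : F}
    (hf : MDifferentiableAt 𝓘(ℝ, E) (𝓡 n) f (j y)) (hj : HasFDerivAt j j' y) (η : DiffForm n M k)
    (v : Fin k → F) :
    formPull (fun z => f (j z)) η y v = formPull f η (j y) (fun i => j' (v i)) := by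
  have h := HasMFDerivAt.comp y hf.hasMFDerivAt hj.hasMFDerivAt
  exact formPull_apply_of_hasMFDerivAt h η v

theorem formPull_congr {f g : E → M} {y : E} (h : f =ᶠ[𝓝 y] g) (η : DiffForm n M k) :
    formPull f η =ᶠ[𝓝 y] formPull g η := by
  filter_upwards [h.eventually_nhds] with z hz
  ext v
  unfold formPull
  have hz' := Filter.EventuallyEq.mfderiv_eq (I := 𝓘(ℝ, E)) (I' := 𝓡 n) hz
  have e : ∀ u : E, (mfderiv 𝓘(ℝ, E) (𝓡 n) f z u : EuclideanSpace ℝ (Fin n)) =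
      mfderiv 𝓘(ℝ, E) (𝓡 n) g z u :=
    fun u => congrArg (fun L : E →L[ℝ] EuclideanSpace ℝ (Fin n) => L u) hz'
  exact (η.apply_congr hz.self_of_nhds _).trans (congrArg (η (g z)) (funext fun i => e (v i)))

end FormPullComp

/-! ### Orbits and local sections of a principal torus bundle -/

section Bundles

variable {M X : Type*} [TopologicalSpace M] [ChartedSpace (EuclideanSpace ℝ (Fin 4)) M]
  [TopologicalSpace X] [ChartedSpace (EuclideanSpace ℝ (Fin 6)) X] [MulAction Torus2 X]

theorem torusExp_add (s t : Fin 2 → ℝ) : torusExp (s + t) = torusExp s * torusExp t := by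
  simp [torusExp, Circle.exp_add]

theorem torusExp_zero : torusExp 0 = 1 := by
  simp [torusExp]

theorem torusExp_surjective : Function.Surjective torusExp := fun g =>
  ⟨![Complex.arg g.1, Complex.arg g.2], by simp [torusExp]⟩

theorem contMDiff_torusExp : ContMDiff 𝓘(ℝ, Fin 2 → ℝ) ((𝓡 1).prod (𝓡 1)) ∞ torusExp := by
  have h : ∀ i : Fin 2, ContMDiff 𝓘(ℝ, Fin 2 → ℝ) 𝓘(ℝ, ℝ) ∞ (fun t : Fin 2 → ℝ => t i) :=
    fun i => (contDiff_apply ℝ ℝ i).contMDiff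
  exact (contMDiff_circleExp.comp (h 0)).prodMk (contMDiff_circleExp.comp (h 1))

theorem IsConnectionForm.apply_vertical {θ : Fin 2 → DiffForm 6 X 1} (hθ : IsConnectionForm θ)
    (p : X) (i : Fin 2) (τ : Fin 2 → ℝ) :
    oneFormLinear (θ i p) (τ 0 • fundamentalField 0 p + τ 1 • fundamentalField 1 p) = τ i := by
  rw [map_add, map_smul, map_smul]
  have h0 : oneFormLinear (θ i p) (fundamentalField 0 p) = _ := hθ.vertical i 0 p
  have h1 : oneFormLinear (θ i p) (fundamentalField 1 p) = _ := hθ.vertical i 1 p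
  rw [h0, h1]
  fin_cases i <;> simp

namespace IsPrincipalTorusBundle

variable {π : X → M} (hπ : IsPrincipalTorusBundle π)
include hπ

theorem contMDiffAt_smul {E : Type*} [NormedAddCommGroup E] [NormedSpace ℝ E] {t : E → Fin 2 → ℝ}
    {f : E → X} {y : E} (ht : ContDiffAt ℝ ∞ t y) (hf : ContMDiffAt 𝓘(ℝ, E) (𝓡 6) ∞ f y) :
    ContMDiffAt 𝓘(ℝ, E) (𝓡 6) ∞ (fun z => torusExp (t z) • f z) y :=
  (hπ.smooth_action.contMDiffAt (x := (torusExp (t y), f y))).comp y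
    ((contMDiff_torusExp.contMDiffAt.comp y ht.contMDiffAt).prodMk hf)

theorem contMDiff_const_smul (g : Torus2) : ContMDiff (𝓡 6) (𝓡 6) ∞ (fun p : X => g • p) :=
  hπ.smooth_action.comp (contMDiff_const.prodMk contMDiff_id)

/-- The torus factor is parametrised by `ℝ²` through the surjective `torusExp`, so no charts of `T²`
are needed later; `t` is not unique. `S` is a total function, controlled over `U` only. -/
theorem exists_local_section (x : M) : ∃ S : M → X, ∃ U : Set M, IsOpen U ∧ x ∈ U ∧
    (∀ y ∈ U, ContMDiffAt (𝓡 4) (𝓡 6) ∞ S y) ∧ (∀ y ∈ U, π (S y) = y) ∧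
    ∀ p, π p ∈ U → ∃ t, p = torusExp t • S (π p) := by
  obtain ⟨U, hU, hx, φ, hs, ht, -, hφs, h1, h2⟩ := hπ.locally_trivial x
  have htar : ∀ y ∈ U, ∀ g : Torus2, (y, g) ∈ φ.target := by
    intro y hy g
    rw [ht]
    exact ⟨hy, trivial⟩
  have hsec : ∀ y ∈ U, π (φ.symm (y, 1)) = y := by
    intro y hy
    rw [← h1 _ (φ.map_target (htar y hy 1)), φ.right_inv (htar y hy 1)]
  -- The unit section of the trivialisation.
  refine ⟨fun y => φ.symm (y, 1), U, hU, hx, ?_, hsec, ?_⟩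
  · intro y hy
    have ho : φ.target ∈ 𝓝 (y, (1 : Torus2)) := φ.open_target.mem_nhds (htar y hy 1)
    exact (hφs.contMDiffAt ho).comp y (contMDiffAt_id.prodMk contMDiffAt_const)
  · intro p hp
    have hps : p ∈ φ.source := by rw [hs]; exact hp
    have hSs : φ.symm (π p, 1) ∈ φ.source := φ.map_target (htar _ hp 1)
    obtain ⟨t, hg⟩ := torusExp_surjective (φ p).2
    refine ⟨t, φ.injOn hps ?_ ?_⟩
    · rw [hs, Set.mem_preimage, hπ.proj_smul, hsec _ hp]
      exact hp
    · rw [h2 _ hSs, hsec _ hp, φ.right_inv (htar _ hp 1), hg, mul_one, ← h1 _ hps]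

theorem surjective : Function.Surjective π := fun x => by
  obtain ⟨S, U, -, hx, -, h, -⟩ := hπ.exists_local_section x
  exact ⟨S x, h x hx⟩

theorem hasMFDerivAt_orbit (p : X) :
    HasMFDerivAt 𝓘(ℝ, Fin 2 → ℝ) (𝓡 6) (fun t : Fin 2 → ℝ => torusExp t • p) 0
      (mfderiv 𝓘(ℝ, Fin 2 → ℝ) (𝓡 6) (fun t : Fin 2 → ℝ => torusExp t • p) 0) :=
  ((hπ.contMDiffAt_smul contDiffAt_id contMDiffAt_const).mdifferentiableAt (by simp)).hasMFDerivAt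

theorem mfderiv_orbit_single (p : X) (j : Fin 2) :
    (mfderiv 𝓘(ℝ, Fin 2 → ℝ) (𝓡 6) (fun t : Fin 2 → ℝ => torusExp t • p) 0
      (Pi.single j (1 : ℝ) : Fin 2 → ℝ) : EuclideanSpace ℝ (Fin 6)) = fundamentalField j p := by
  have h0 : HasFDerivAt (fun t : ℝ => (Pi.single j t : Fin 2 → ℝ))
      (ContinuousLinearMap.single ℝ (fun _ : Fin 2 => ℝ) j) 0 :=
    (ContinuousLinearMap.single ℝ (fun _ : Fin 2 => ℝ) j).hasFDerivAt
  -- The chain rule asks for the derivative at `Pi.single j 0`, not at the literal `0`, hence the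
  -- variable base point.
  have h1 : ∀ s, s = 0 → HasMFDerivAt 𝓘(ℝ, Fin 2 → ℝ) (𝓡 6)
      (fun t : Fin 2 → ℝ => torusExp t • p) s
      (mfderiv 𝓘(ℝ, Fin 2 → ℝ) (𝓡 6) (fun t : Fin 2 → ℝ => torusExp t • p) 0) := by
    rintro _ rfl
    exact hπ.hasMFDerivAt_orbit p
  have h2 := HasMFDerivAt.comp (0 : ℝ) (h1 _ (Pi.single_zero j)) h0.hasMFDerivAt
  have h3 := h2.mfderiv
  unfold fundamentalField
  have h4 := congrArg (fun L : ℝ →L[ℝ] EuclideanSpace ℝ (Fin 6) => L 1) h3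
  exact h4.symm

theorem mfderiv_orbit (p : X) (τ : Fin 2 → ℝ) :
    (mfderiv 𝓘(ℝ, Fin 2 → ℝ) (𝓡 6) (fun t : Fin 2 → ℝ => torusExp t • p) 0 τ :
      EuclideanSpace ℝ (Fin 6)) = τ 0 • (fundamentalField 0 p : EuclideanSpace ℝ (Fin 6)) +
        τ 1 • (fundamentalField 1 p : EuclideanSpace ℝ (Fin 6)) := by
  let L : (Fin 2 → ℝ) →L[ℝ] EuclideanSpace ℝ (Fin 6) :=
    mfderiv 𝓘(ℝ, Fin 2 → ℝ) (𝓡 6) (fun t : Fin 2 → ℝ => torusExp t • p) 0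
  have h : τ =
      τ 0 • (Pi.single 0 (1 : ℝ) : Fin 2 → ℝ) + τ 1 • (Pi.single 1 (1 : ℝ) : Fin 2 → ℝ) := by
    funext i; fin_cases i <;> simp
  have h2 : L τ = τ 0 • L (Pi.single 0 (1 : ℝ)) + τ 1 • L (Pi.single 1 (1 : ℝ)) := by
    conv_lhs => rw [h]
    rw [map_add, map_smul, map_smul]
  rw [show L (Pi.single 0 (1 : ℝ)) = _ from hπ.mfderiv_orbit_single p 0,
    show L (Pi.single 1 (1 : ℝ)) = _ from hπ.mfderiv_orbit_single p 1] at h2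
  exact h2

variable {θ : Fin 2 → DiffForm 6 X 1} (hθ : IsConnectionForm θ)
include hθ

theorem formPull_orbit (p : X) (i : Fin 2) (τ : Fin 2 → ℝ) :
    formPull (fun t : Fin 2 → ℝ => torusExp t • p) (θ i) 0 ![τ] = τ i := by
  rw [formPull_apply_of_hasMFDerivAt (hπ.hasMFDerivAt_orbit p)]
  refine ((θ i).apply_congr (by rw [torusExp_zero, one_smul]) _).trans ?_
  refine Eq.trans (congrArg (θ i p) (funext fun j => ?_)) (hθ.apply_vertical p i τ)
  fin_cases j
  exact hπ.mfderiv_orbit p τ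

end IsPrincipalTorusBundle

end Bundles

/-! ### Splitting of the tangent spaces by `dπ` and the connection -/

section Bundles

variable {M X : Type*} [TopologicalSpace M] [ChartedSpace (EuclideanSpace ℝ (Fin 4)) M]
  [TopologicalSpace X] [ChartedSpace (EuclideanSpace ℝ (Fin 6)) X] [MulAction Torus2 X]

namespace IsPrincipalTorusBundle

variable {π : X → M} (hπ : IsPrincipalTorusBundle π)
include hπ

theorem hasMFDerivAt_proj (p : X) :
    HasMFDerivAt (𝓡 6) (𝓡 4) π p (mfderiv (𝓡 6) (𝓡 4) π p) :=
  ((hπ.smooth_proj p).mdifferentiableAt (by simp)).hasMFDerivAt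

/-- A translate of a local section by a torus element passes through `p`, and `π` composed with it
is the identity near `π p`. -/
theorem mfderiv_proj_surjective (p : X) (v : EuclideanSpace ℝ (Fin 4)) :
    ∃ w : EuclideanSpace ℝ (Fin 6), (mfderiv (𝓡 6) (𝓡 4) π p w : EuclideanSpace ℝ (Fin 4)) = v := by
  obtain ⟨S, U, hU, hx, hS, hπS, hp⟩ := hπ.exists_local_section (π p)
  obtain ⟨t, ht⟩ := hp p hx
  have h1 : MDifferentiableAt (𝓡 4) (𝓡 6) (fun y => torusExp t • S y) (π p) :=
    ((hπ.contMDiff_const_smul (torusExp t) _).comp _ (hS _ hx)).mdifferentiableAt (by simp)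
  have h2 : ∀ q, q = p → HasMFDerivAt (𝓡 6) (𝓡 4) π q (mfderiv (𝓡 6) (𝓡 4) π p) := by
    rintro _ rfl
    exact hπ.hasMFDerivAt_proj _
  have h3 := HasMFDerivAt.comp (π p) (h2 _ ht.symm) h1.hasMFDerivAt
  have h4 : (id : M → M) =ᶠ[𝓝 (π p)] π ∘ fun y => torusExp t • S y := by
    filter_upwards [hU.mem_nhds hx] with y hy
    simp [hπ.proj_smul, hπS y hy]
  have h5 := hasMFDerivAt_unique (h3.congr_of_eventuallyEq h4) (hasMFDerivAt_id (π p))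
  exact ⟨mfderiv (𝓡 4) (𝓡 6) (fun y => torusExp t • S y) (π p) v, DFunLike.congr_fun h5 v⟩

theorem mfderiv_proj_orbit (p : X) (τ : Fin 2 → ℝ) :
    mfderiv (𝓡 6) (𝓡 4) π p (τ 0 • fundamentalField 0 p + τ 1 • fundamentalField 1 p) = 0 := by
  have h2 : ∀ q, q = p → HasMFDerivAt (𝓡 6) (𝓡 4) π q (mfderiv (𝓡 6) (𝓡 4) π p) := by
    rintro _ rfl
    exact hπ.hasMFDerivAt_proj _
  have h3 := HasMFDerivAt.comp (0 : Fin 2 → ℝ)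
    (h2 (torusExp 0 • p) (by rw [torusExp_zero, one_smul])) (hπ.hasMFDerivAt_orbit p)
  have h4 : (fun _ : Fin 2 → ℝ => π p) =ᶠ[𝓝 0] π ∘ fun t : Fin 2 → ℝ => torusExp t • p :=
    Filter.Eventually.of_forall fun t => (hπ.proj_smul _ _).symm
  have h5 := hasMFDerivAt_unique (h3.congr_of_eventuallyEq h4) (hasMFDerivAt_const (π p) 0)
  have h6 := DFunLike.congr_fun h5 τ
  refine Eq.trans (congrArg (mfderiv (𝓡 6) (𝓡 4) π p) (hπ.mfderiv_orbit p τ).symm) h6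

variable {θ : Fin 2 → DiffForm 6 X 1} (hθ : IsConnectionForm θ)
include hθ

/-- Any lift of `v` can be corrected by a vertical vector, which `dπ` kills and on which `θ` takes
arbitrary values. -/
theorem exists_tangent (p : X) (v : TangentSpace (𝓡 4) (π p)) (τ : Fin 2 → ℝ) :
    ∃ w : TangentSpace (𝓡 6) p, mfderiv (𝓡 6) (𝓡 4) π p w = v ∧
      ∀ i, oneFormLinear (θ i p) w = τ i := by
  obtain ⟨w₀, hw₀⟩ := hπ.mfderiv_proj_surjective p v
  let w₁ : TangentSpace (𝓡 6) p := w₀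
  -- The discrepancy between the prescribed values and those of `θ` on the first lift.
  let τ' : Fin 2 → ℝ := fun i => τ i - oneFormLinear (θ i p) w₁
  refine ⟨w₁ + (τ' 0 • fundamentalField 0 p + τ' 1 • fundamentalField 1 p), ?_, fun i => ?_⟩
  · rw [map_add, hπ.mfderiv_proj_orbit p τ', add_zero]
    exact hw₀
  · rw [map_add, hθ.apply_vertical p i τ']
    simp [τ']

/-- The map `(dπ, θ)` is onto by `exists_tangent`, hence injective because `6 = 4 + 2`. -/
theorem tangent_eq_zero (p : X) (w : TangentSpace (𝓡 6) p) (h0 : mfderiv (𝓡 6) (𝓡 4) π p w = 0)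
    (h1 : ∀ i, oneFormLinear (θ i p) w = 0) : w = 0 := by
  let T : EuclideanSpace ℝ (Fin 6) →ₗ[ℝ] EuclideanSpace ℝ (Fin 4) × (Fin 2 → ℝ) :=
    LinearMap.prod
      (mfderiv (𝓡 6) (𝓡 4) π p :
        EuclideanSpace ℝ (Fin 6) →L[ℝ] EuclideanSpace ℝ (Fin 4)).toLinearMap
      (LinearMap.pi fun i => oneFormLinear (θ i p))
  have hT : Function.Surjective T := by
    rintro ⟨v, τ⟩
    obtain ⟨w, hw, hw'⟩ := hπ.exists_tangent hθ p v τ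
    exact ⟨w, Prod.ext hw (funext hw')⟩
  have hd : Module.finrank ℝ (EuclideanSpace ℝ (Fin 6)) =
      Module.finrank ℝ (EuclideanSpace ℝ (Fin 4) × (Fin 2 → ℝ)) := by
    simp [Module.finrank_prod]
  have hi := (LinearMap.injective_iff_surjective_of_finrank_eq_finrank hd).2 hT
  have hz : T w = 0 := Prod.ext h0 (funext h1)
  exact hi (hz.trans (map_zero T).symm)

end IsPrincipalTorusBundle

end Bundles

/-! ### Descent of the curvature to the base -/

section Bundles

variable {M X : Type*} [TopologicalSpace M] [ChartedSpace (EuclideanSpace ℝ (Fin 4)) M]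
  [TopologicalSpace X] [ChartedSpace (EuclideanSpace ℝ (Fin 6)) X]

theorem formPull_section_fst {S : M → X} {x : M} {z : EuclideanSpace ℝ (Fin 4) × (Fin 2 → ℝ)}
    (hs : MDifferentiableAt 𝓘(ℝ, EuclideanSpace ℝ (Fin 4)) (𝓡 6)
      (fun y => S ((extChartAt (𝓡 4) x).symm y)) z.1) (η : DiffForm 6 X 1)
    (u : EuclideanSpace ℝ (Fin 4)) (τ : Fin 2 → ℝ) :
    formPull (fun z : EuclideanSpace ℝ (Fin 4) × (Fin 2 → ℝ) =>
      S ((extChartAt (𝓡 4) x).symm z.1)) η z ![(u, τ)] =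
      formPull (fun y => S ((extChartAt (𝓡 4) x).symm y)) η z.1 ![u] := by
  have h := formPull_comp (f := fun y => S ((extChartAt (𝓡 4) x).symm y)) (j := Prod.fst) (y := z)
    hs hasFDerivAt_fst η ![(u, τ)]
  refine h.trans (congrArg _ ?_)
  funext j; fin_cases j; rfl

section

variable [IsManifold (𝓡 4) ∞ M]

theorem contMDiffAt_section_chart {S : M → X} {x : M} {y : EuclideanSpace ℝ (Fin 4)}
    (hy : y ∈ (extChartAt (𝓡 4) x).target)
    (hS : ContMDiffAt (𝓡 4) (𝓡 6) ∞ S ((extChartAt (𝓡 4) x).symm y)) :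
    ContMDiffAt (𝓡 4) (𝓡 6) ∞ (fun y => S ((extChartAt (𝓡 4) x).symm y)) y :=
  hS.comp y (contMDiffAt_extChartAt_symm hy)

theorem contMDiffAt_section_fst {S : M → X} {x : M}
    {z : EuclideanSpace ℝ (Fin 4) × (Fin 2 → ℝ)}
    (hy : z.1 ∈ (extChartAt (𝓡 4) x).target)
    (hS : ContMDiffAt (𝓡 4) (𝓡 6) ∞ S ((extChartAt (𝓡 4) x).symm z.1)) :
    ContMDiffAt 𝓘(ℝ, EuclideanSpace ℝ (Fin 4) × (Fin 2 → ℝ)) (𝓡 6) ∞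
      (fun z : EuclideanSpace ℝ (Fin 4) × (Fin 2 → ℝ) => S ((extChartAt (𝓡 4) x).symm z.1)) z :=
  ContMDiffAt.comp (f := (Prod.fst : EuclideanSpace ℝ (Fin 4) × (Fin 2 → ℝ) → _))
    (g := fun y => S ((extChartAt (𝓡 4) x).symm y)) z
    (contMDiffAt_section_chart hy hS) contDiff_fst.contDiffAt.contMDiffAt

end

variable [MulAction Torus2 X]

/-- The parametrisation `(y, t) ↦ exp(t) • S(y)` of the part of the total space over a chart, given
a local section `S`. -/
def sectionParam (S : M → X) (x : M) (z : EuclideanSpace ℝ (Fin 4) × (Fin 2 → ℝ)) : X :=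
  torusExp z.2 • S ((extChartAt (𝓡 4) x).symm z.1)

variable [IsManifold (𝓡 4) ∞ M]

namespace IsPrincipalTorusBundle

variable {π : X → M} (hπ : IsPrincipalTorusBundle π)
include hπ

theorem contMDiffAt_sectionParam {S : M → X} {x : M}
    {z : EuclideanSpace ℝ (Fin 4) × (Fin 2 → ℝ)} (hy : z.1 ∈ (extChartAt (𝓡 4) x).target)
    (hS : ContMDiffAt (𝓡 4) (𝓡 6) ∞ S ((extChartAt (𝓡 4) x).symm z.1)) :
    ContMDiffAt 𝓘(ℝ, EuclideanSpace ℝ (Fin 4) × (Fin 2 → ℝ)) (𝓡 6) ∞ (sectionParam S x) z :=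
  hπ.contMDiffAt_smul contDiffAt_snd (contMDiffAt_section_fst hy hS)

variable {θ : Fin 2 → DiffForm 6 X 1} (hθ : IsConnectionForm θ)
include hθ

/-- In the parametrisation `Ψ` the connection is `s^*θᵢ + dtᵢ`, where `s` is the section in the
chart; the `ofSubsingleton` term is `dtᵢ`. Tangent vectors are split into a base part and a torus
part. -/
theorem formPull_sectionParam {S : M → X} {x : M}
    {z : EuclideanSpace ℝ (Fin 4) × (Fin 2 → ℝ)} (hy : z.1 ∈ (extChartAt (𝓡 4) x).target)
    (hS : ContMDiffAt (𝓡 4) (𝓡 6) ∞ S ((extChartAt (𝓡 4) x).symm z.1)) (i : Fin 2) :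
    formPull (sectionParam S x) (θ i) z =
      formPull (fun z : EuclideanSpace ℝ (Fin 4) × (Fin 2 → ℝ) =>
        S ((extChartAt (𝓡 4) x).symm z.1)) (θ i) z +
      ContinuousAlternatingMap.ofSubsingleton ℝ (EuclideanSpace ℝ (Fin 4) × (Fin 2 → ℝ)) ℝ
        (0 : Fin 1)
        ((ContinuousLinearMap.proj i).comp
          (ContinuousLinearMap.snd ℝ (EuclideanSpace ℝ (Fin 4)) (Fin 2 → ℝ))) := by
  have hΨ := hπ.contMDiffAt_sectionParam hy hS
  have hΨd := hΨ.mdifferentiableAt (by simp)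
  have hs := contMDiffAt_section_chart hy hS
  have hsd : MDifferentiableAt 𝓘(ℝ, EuclideanSpace ℝ (Fin 4)) (𝓡 6)
    (fun y => S ((extChartAt (𝓡 4) x).symm y)) z.1 := hs.mdifferentiableAt (by simp)
  ext v
  obtain ⟨⟨u, τ⟩, rfl⟩ : ∃ w, v = ![w] := ⟨_, vec_one_eta⟩
  rw [ContinuousAlternatingMap.add_apply]
  have e1 : formPull (sectionParam S x) (θ i) z ![(u, τ)] =
      formPull (sectionParam S x) (θ i) z ![(u, 0)] +
        formPull (sectionParam S x) (θ i) z ![(0, τ)] := by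
    have := (oneFormLinear (formPull (sectionParam S x) (θ i) z)).map_add (u, 0) (0, τ)
    simpa [oneFormLinear] using this
  -- With `t` fixed, `Ψ` is the section followed by the action of `exp(t)`, and invariance of `θ`
  -- removes the action.
  have e2 : formPull (sectionParam S x) (θ i) z ![(u, 0)] =
      formPull (fun y => S ((extChartAt (𝓡 4) x).symm y)) (θ i) z.1 ![u] := by
    have h := formPull_comp (f := sectionParam S x) (j := fun y => (y, z.2)) (y := z.1) hΨd
      ((hasFDerivAt_id _).prodMk (hasFDerivAt_const z.2 z.1)) (θ i) ![u]
    have h2 := formPull_pullback (f := fun p : X => torusExp z.2 • p)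
      (g := fun y => S ((extChartAt (𝓡 4) x).symm y)) (y := z.1)
      ((hπ.contMDiff_const_smul _ _).mdifferentiableAt (by simp)) hsd (θ i)
    rw [hθ.invariant] at h2
    rw [h2]
    refine Eq.trans (congrArg _ ?_) h.symm
    funext j; fin_cases j; rfl
  -- With `y` fixed, `exp(s + t) • S(y) = exp(s) • Ψ(z)` is the orbit map of `Ψ(z)`, where `θ`
  -- reproduces the generators.
  have e3 : formPull (sectionParam S x) (θ i) z ![(0, τ)] = τ i := by
    have hj : HasFDerivAt (fun s : Fin 2 → ℝ => (z.1, s + z.2))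
        ((0 : (Fin 2 → ℝ) →L[ℝ] EuclideanSpace ℝ (Fin 4)).prod (ContinuousLinearMap.id ℝ _)) 0 :=
      (hasFDerivAt_const z.1 _).prodMk ((hasFDerivAt_id _).add_const z.2)
    have h0 : ((z.1, 0 + z.2) : EuclideanSpace ℝ (Fin 4) × (Fin 2 → ℝ)) = z := by simp
    have h := formPull_comp (f := sectionParam S x) (by rw [h0]; exact hΨd) hj (θ i) ![τ]
    rw [h0] at h
    have h2 := hπ.formPull_orbit hθ (sectionParam S x z) i τ
    rw [← h2]
    refine Eq.trans (Eq.trans (congrArg _ ?_) h.symm) ?_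
    · funext j; fin_cases j; rfl
    · refine congrArg (fun f => formPull f (θ i) 0 ![τ]) (funext fun s => ?_)
      simp [sectionParam, torusExp_add, mul_smul]
  rw [e1, e2, e3, formPull_section_fst hsd]
  rfl

/-- The extra term `dtᵢ` has constant coefficients, so it is closed and disappears under `d`. -/
theorem formPull_sectionParam_d [IsManifold (𝓡 6) ∞ X] {S : M → X} {x : M} {U : Set M}
    (hU : IsOpen U) (hx : x ∈ U) (hS : ∀ y ∈ U, ContMDiffAt (𝓡 4) (𝓡 6) ∞ S y) (t : Fin 2 → ℝ)
    (i : Fin 2) :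
    formPull (sectionParam S x) (θ i).d (extChartAt (𝓡 4) x x, t) =
      formPull (fun z : EuclideanSpace ℝ (Fin 4) × (Fin 2 → ℝ) =>
        S ((extChartAt (𝓡 4) x).symm z.1)) (θ i).d (extChartAt (𝓡 4) x x, t) := by
  have hy := mem_extChartAt_target (I := 𝓡 4) x
  have hxx : (extChartAt (𝓡 4) x).symm (extChartAt (𝓡 4) x x) = x :=
    (extChartAt (𝓡 4) x).left_inv (mem_extChartAt_source (I := 𝓡 4) x)
  have hSx : ContMDiffAt (𝓡 4) (𝓡 6) ∞ S
      ((extChartAt (𝓡 4) x).symm (extChartAt (𝓡 4) x x, t).1) := by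
    rw [hxx]; exact hS x hx
  have hΨ := hπ.contMDiffAt_sectionParam (S := S) (x := x) (z := (extChartAt (𝓡 4) x x, t)) hy hSx
  have hh := contMDiffAt_section_fst (S := S) (x := x) (z := (extChartAt (𝓡 4) x x, t)) hy hSx
  rw [← extDeriv_formPull (hθ.smooth i) hΨ, ← extDeriv_formPull (hθ.smooth i) hh]
  have hev : ∀ᶠ z in 𝓝 ((extChartAt (𝓡 4) x x, t) : EuclideanSpace ℝ (Fin 4) × (Fin 2 → ℝ)),
      z.1 ∈ (extChartAt (𝓡 4) x).target ∧ (extChartAt (𝓡 4) x).symm z.1 ∈ U := by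
    have h1 : ∀ᶠ y in 𝓝 (extChartAt (𝓡 4) x x), y ∈ (extChartAt (𝓡 4) x).target ∧
        (extChartAt (𝓡 4) x).symm y ∈ U := by
      refine Filter.Eventually.and ((isOpen_extChartAt_target x).mem_nhds hy) ?_
      exact (continuousAt_extChartAt_symm (I := 𝓡 4) x).eventually_mem
        (by rw [hxx]; exact hU.mem_nhds hx)
    exact (continuous_fst.tendsto ((extChartAt (𝓡 4) x x, t) :
      EuclideanSpace ℝ (Fin 4) × (Fin 2 → ℝ))).eventually h1
  have heq := hev.mono fun z hz => hπ.formPull_sectionParam hθ hz.1 (hS _ hz.2) i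
  rw [Filter.EventuallyEq.extDeriv_eq heq]
  have hd := ((hθ.smooth i).contDiffAt_formPull hh).differentiableAt (by simp)
  rw [extDeriv_fun_add hd (differentiableAt_const _)]
  conv_rhs => rw [← add_zero (extDeriv _ _)]
  congr 1
  simp only [extDeriv, fderiv_fun_const, Pi.zero_apply]
  exact map_zero (ContinuousAlternatingMap.alternatizeUncurryFinCLM (n := 1) ℝ _ ℝ)

/-- This allows an identity of forms to be checked after pulling back by `Ψ`. The preimage is chosen
to match `w` under both `dπ` and `θ`, and `tangent_eq_zero` shows that nothing else has to match. -/
theorem mfderiv_sectionParam_surjective {S : M → X} {x : M} {U : Set M}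
    (hU : IsOpen U) (hx : x ∈ U) (hS : ∀ y ∈ U, ContMDiffAt (𝓡 4) (𝓡 6) ∞ S y)
    (hπS : ∀ y ∈ U, π (S y) = y) (t : Fin 2 → ℝ)
    (w : TangentSpace (𝓡 6) (sectionParam S x (extChartAt (𝓡 4) x x, t))) :
    ∃ q : EuclideanSpace ℝ (Fin 4) × (Fin 2 → ℝ),
      mfderiv 𝓘(ℝ, EuclideanSpace ℝ (Fin 4) × (Fin 2 → ℝ)) (𝓡 6) (sectionParam S x)
        (extChartAt (𝓡 4) x x, t) q = w := by
  let z₀ : EuclideanSpace ℝ (Fin 4) × (Fin 2 → ℝ) := (extChartAt (𝓡 4) x x, t)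
  have hy := mem_extChartAt_target (I := 𝓡 4) x
  have hxx : (extChartAt (𝓡 4) x).symm (extChartAt (𝓡 4) x x) = x :=
    (extChartAt (𝓡 4) x).left_inv (mem_extChartAt_source (I := 𝓡 4) x)
  have hSx : ContMDiffAt (𝓡 4) (𝓡 6) ∞ S ((extChartAt (𝓡 4) x).symm z₀.1) := by
    rw [hxx]; exact hS x hx
  have hΨ := (hπ.contMDiffAt_sectionParam (S := S) (x := x) (z := z₀) hy hSx).mdifferentiableAt
    (by simp)
  have hsd : MDifferentiableAt 𝓘(ℝ, EuclideanSpace ℝ (Fin 4)) (𝓡 6)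
    (fun y => S ((extChartAt (𝓡 4) x).symm y)) z₀.1 :=
    (contMDiffAt_section_chart hy hSx).mdifferentiableAt (by simp)
  let p : X := sectionParam S x z₀
  let D : EuclideanSpace ℝ (Fin 4) × (Fin 2 → ℝ) →L[ℝ] TangentSpace (𝓡 6) p :=
    mfderiv 𝓘(ℝ, EuclideanSpace ℝ (Fin 4) × (Fin 2 → ℝ)) (𝓡 6) (sectionParam S x) z₀
  have hD : ∀ q i, oneFormLinear (θ i p) (D q) =
      formPull (fun y => S ((extChartAt (𝓡 4) x).symm y)) (θ i) z₀.1 ![q.1] + q.2 i := by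
    intro q i
    have h := hπ.formPull_sectionParam hθ (z := z₀) hy hSx i
    have h2 := congrArg (fun α => α ![q]) h
    refine Eq.trans ?_ (h2.trans ?_)
    · refine congrArg (θ i p) ?_
      funext j; fin_cases j; rfl
    · rw [← formPull_section_fst hsd (θ i) q.1 q.2]
      rfl
  have hDπ : ∀ q, (mfderiv (𝓡 6) (𝓡 4) π p (D q) : EuclideanSpace ℝ (Fin 4)) =
      mfderiv (𝓡 4) (𝓡 4) (extChartAt (𝓡 4) x).symm (extChartAt (𝓡 4) x x) q.1 := by
    have h1 := HasMFDerivAt.comp z₀ (hπ.hasMFDerivAt_proj p) hΨ.hasMFDerivAt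
    have h2 := HasMFDerivAt.comp z₀ (hasMFDerivAt_extChartAt_symm_self hy)
      (hasFDerivAt_fst (𝕜 := ℝ) (p := z₀)).hasMFDerivAt
    have h3 : ((extChartAt (𝓡 4) x).symm ∘ Prod.fst) =ᶠ[𝓝 z₀] π ∘ sectionParam S x := by
      have h4 : ∀ᶠ y in 𝓝 (extChartAt (𝓡 4) x x), (extChartAt (𝓡 4) x).symm y ∈ U :=
        (continuousAt_extChartAt_symm (I := 𝓡 4) x).eventually_mem
          (by rw [hxx]; exact hU.mem_nhds hx)
      filter_upwards [(continuous_fst.tendsto z₀).eventually h4] with z hz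
      exact ((hπ.proj_smul _ _).trans (hπS _ hz)).symm
    have h5 := hasMFDerivAt_unique (h1.congr_of_eventuallyEq h3) h2
    exact fun q => DFunLike.congr_fun h5 q
  let v : EuclideanSpace ℝ (Fin 4) := mfderiv (𝓡 6) (𝓡 4) π p w
  let u : EuclideanSpace ℝ (Fin 4) := mfderiv (𝓡 4) (𝓡 4) (extChartAt (𝓡 4) x) x v
  let τ : Fin 2 → ℝ := fun i => oneFormLinear (θ i p) w -
    formPull (fun y => S ((extChartAt (𝓡 4) x).symm y)) (θ i) z₀.1 ![u]
  refine ⟨(u, τ), ?_⟩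
  have hz : D (u, τ) - w = 0 := by
    refine hπ.tangent_eq_zero hθ p _ ?_ fun i => ?_
    · rw [map_sub, sub_eq_zero]
      exact (hDπ (u, τ)).trans (mfderiv_extChartAt_symm_mfderiv_extChartAt x v)
    · rw [map_sub, hD]
      simp [τ]
  exact sub_eq_zero.1 hz

/-- The differentials of the components of a connection form on a principal torus bundle are the
pullbacks of smooth two-forms on the base. -/
theorem exists_curvature [IsManifold (𝓡 6) ∞ X] : ∃ F : Fin 2 → DiffForm 4 M 2,
    ∀ j, (F j).IsSmooth ∧ (F j).pullback π = (θ j).d := by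
  choose S U hU hx hS hπS hp using hπ.exists_local_section
  -- The value at `x` uses the section chosen for `x` itself. The choice may jump with `x`, so
  -- smoothness has to be recovered at the end.
  let F : Fin 2 → DiffForm 4 M 2 := fun j x => (DiffForm.pullback (m := 4) (S x) (θ j).d) x
  have hF : ∀ j, (F j).pullback π = (θ j).d := by
    intro j
    have key : ∀ (x : M) (t : Fin 2 → ℝ), (F j).pullback π
        (sectionParam (S x) x (extChartAt (𝓡 4) x x, t)) =
        (θ j).d (sectionParam (S x) x (extChartAt (𝓡 4) x x, t)) := by
      intro x t
      have hy := mem_extChartAt_target (I := 𝓡 4) x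
      have hxx : (extChartAt (𝓡 4) x).symm (extChartAt (𝓡 4) x x) = x :=
        (extChartAt (𝓡 4) x).left_inv (mem_extChartAt_source (I := 𝓡 4) x)
      let z₀ : EuclideanSpace ℝ (Fin 4) × (Fin 2 → ℝ) := (extChartAt (𝓡 4) x x, t)
      have hSx : ContMDiffAt (𝓡 4) (𝓡 6) ∞ (S x) ((extChartAt (𝓡 4) x).symm z₀.1) := by
        rw [hxx]; exact hS x x (hx x)
      have hΨ := (hπ.contMDiffAt_sectionParam (S := S x) (x := x) (z := z₀) hy
        hSx).mdifferentiableAt (by simp)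
      have h1 := hπ.formPull_sectionParam_d hθ (hU x) (hx x) (hS x) t j
      have hc : MDifferentiableAt 𝓘(ℝ, EuclideanSpace ℝ (Fin 4) × (Fin 2 → ℝ)) (𝓡 4)
          (fun z : EuclideanSpace ℝ (Fin 4) × (Fin 2 → ℝ) => (extChartAt (𝓡 4) x).symm z.1) z₀ :=
        MDifferentiableAt.comp (g := (extChartAt (𝓡 4) x).symm) z₀
          ((contMDiffAt_extChartAt_symm hy).mdifferentiableAt (by simp))
          differentiableAt_fst.mdifferentiableAt
      have h2 : formPull (sectionParam (S x) x) (DiffForm.pullback (m := 6) π (F j)) z₀ =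
          formPull (sectionParam (S x) x) (θ j).d z₀ := by
        rw [h1, formPull_pullback ((hπ.smooth_proj _).mdifferentiableAt (by simp)) hΨ]
        have h3 : (fun z => π (sectionParam (S x) x z)) =ᶠ[𝓝 z₀]
            fun z => (extChartAt (𝓡 4) x).symm z.1 := by
          have h4 : ∀ᶠ y in 𝓝 (extChartAt (𝓡 4) x x), (extChartAt (𝓡 4) x).symm y ∈ U x :=
            (continuousAt_extChartAt_symm (I := 𝓡 4) x).eventually_mem
              (by rw [hxx]; exact (hU x).mem_nhds (hx x))
          filter_upwards [(continuous_fst.tendsto z₀).eventually h4] with z hz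
          exact (hπ.proj_smul _ _).trans (hπS _ _ hz)
        rw [(formPull_congr h3 (F j)).self_of_nhds]
        have h5 := formPull_pullback (f := S x) (g := fun z : EuclideanSpace ℝ (Fin 4) × (Fin 2 → ℝ)
          => (extChartAt (𝓡 4) x).symm z.1) (y := z₀) (hSx.mdifferentiableAt (by simp)) hc (θ j).d
        rw [← h5]
        have h6 : F j ((extChartAt (𝓡 4) x).symm z₀.1) =
            (DiffForm.pullback (m := 4) (S x) (θ j).d) ((extChartAt (𝓡 4) x).symm z₀.1) :=
          congrArg (fun a => (DiffForm.pullback (m := 4) (S a) (θ j).d)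
            ((extChartAt (𝓡 4) x).symm z₀.1)) hxx
        unfold formPull
        rw [h6]
      ext v
      choose q hq using fun i => hπ.mfderiv_sectionParam_surjective hθ (hU x) (hx x) (hS x)
        (hπS x) t (v i)
      have h7 := congrArg (fun α => α q) h2
      -- Every tuple of tangent vectors is an image under `dΨ`, so the equality of pullbacks `h2` is
      -- an equality of forms.
      have h8 : v = fun i => mfderiv 𝓘(ℝ, EuclideanSpace ℝ (Fin 4) × (Fin 2 → ℝ)) (𝓡 6)
        (sectionParam (S x) x) (extChartAt (𝓡 4) x x, t) (q i) := funext fun i => (hq i).symm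
      rw [h8]
      exact h7
    funext p
    obtain ⟨t, ht⟩ := hp (π p) p (hx (π p))
    have h1 : p = sectionParam (S (π p)) (π p) (extChartAt (𝓡 4) (π p) (π p), t) := by
      rw [sectionParam, (extChartAt (𝓡 4) (π p)).left_inv (mem_extChartAt_source (I := 𝓡 4) (π p))]
      exact ht
    rw [h1]
    exact key (π p) t
  refine ⟨F, fun j => ⟨?_, hF j⟩⟩
  refine DiffForm.isSmooth_of_contDiffAt fun x₀ y hy => ?_
  have hsm := (hθ.smooth j).d
  set x := (extChartAt (𝓡 4) x₀).symm y with hxdef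
  have hc := contMDiffAt_section_chart (S := S x) (x := x₀) hy (hS x x (hx x))
  -- Near `y` one fixed section `S x` suffices: `(S x)^*dθⱼ = (S x)^*π^*Fⱼ = Fⱼ` because `π ∘ S x`
  -- is the identity on `U x`.
  refine (hsm.contDiffAt_formPull hc).congr_of_eventuallyEq ?_
  have h4 : ∀ᶠ z in 𝓝 y, (extChartAt (𝓡 4) x₀).symm z ∈ U x :=
    (contMDiffAt_extChartAt_symm hy).continuousAt.eventually_mem ((hU x).mem_nhds (hx x))
  filter_upwards [h4.eventually_nhds, (isOpen_extChartAt_target x₀).mem_nhds hy] with z hz hzt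
  have hzU := hz.self_of_nhds
  have hcz := contMDiffAt_section_chart (S := S x) (x := x₀) hzt (hS x _ hzU)
  have h5 := formPull_pullback (f := π) (g := fun y => S x ((extChartAt (𝓡 4) x₀).symm y)) (y := z)
    ((hπ.smooth_proj _).mdifferentiableAt (by simp)) (hcz.mdifferentiableAt (by simp)) (F j)
  rw [hF j] at h5
  rw [h5]
  refine (formPull_congr ?_ (F j)).self_of_nhds
  filter_upwards [hz] with a ha
  exact (hπS x _ ha).symm

end IsPrincipalTorusBundle

end Bundles

/-! ### Definite triples of two-forms on a four-dimensional space -/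

theorem update_vec_two_zero {V : Type*} (u v z : V) : Function.update ![u, v] 0 z = ![z, v] := by
  funext i; fin_cases i <;> simp

theorem update_vec_two_one {V : Type*} (u v z : V) : Function.update ![u, v] 1 z = ![u, z] := by
  funext i; fin_cases i <;> simp

section Linear

variable {V : Type*} [AddCommGroup V] [Module ℝ V] [TopologicalSpace V]

/-- A two-form as a bilinear form. -/
def twoFormLinear (α : V [⋀^Fin 2]→L[ℝ] ℝ) : V →ₗ[ℝ] V →ₗ[ℝ] ℝ :=
  LinearMap.mk₂ ℝ (fun u v => α ![u, v])
    (fun u u' v => by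
      simpa only [update_vec_two_zero] using α.map_update_add ![u, v] 0 u u')
    (fun c u v => by
      simpa only [update_vec_two_zero] using α.map_update_smul ![u, v] 0 c u)
    (fun u v v' => by
      simpa only [update_vec_two_one] using α.map_update_add ![u, v] 1 v v')
    (fun c u v => by
      simpa only [update_vec_two_one] using α.map_update_smul ![u, v] 1 c v)

theorem twoFormLinear_apply (α : V [⋀^Fin 2]→L[ℝ] ℝ) (u v : V) :
    twoFormLinear α u v = α ![u, v] := rfl

/-- A top-degree form on a four-dimensional space vanishing on a basis vanishes. -/
theorem four_form_eq_zero (μ : V [⋀^Fin 4]→L[ℝ] ℝ) (e : Module.Basis (Fin 4) ℝ V)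
    (h : μ ⇑e = 0) : μ = 0 := by
  apply ContinuousAlternatingMap.toAlternatingMap_injective
  refine e.ext_alternating fun v hv => ?_
  have hs : Function.Bijective v := (Fintype.bijective_iff_injective_and_card v).2 ⟨hv, rfl⟩
  have hp := μ.toAlternatingMap.map_perm ⇑e (Equiv.ofBijective v hs)
  have h' : μ.toAlternatingMap ⇑e = 0 := h
  rw [h', smul_zero] at hp
  exact hp

/-- A nonzero `w` extends to a basis, on which a nonzero top-degree form cannot vanish. -/
theorem eq_zero_of_contraction (hV : Module.finrank ℝ V = 4) {μ : V [⋀^Fin 4]→L[ℝ] ℝ} (hμ : μ ≠ 0)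
    {w : V} (h : ∀ a b c, μ ![w, a, b, c] = 0) : w = 0 := by
  by_contra hw
  have h1 : LinearIndependent ℝ ![w] := by
    rw [linearIndependent_unique_iff]; exact hw
  obtain ⟨a, ha⟩ := exists_linearIndependent_snoc_of_lt_finrank h1 (by omega)
  obtain ⟨b, hb⟩ := exists_linearIndependent_snoc_of_lt_finrank ha (by omega)
  obtain ⟨c, hc⟩ := exists_linearIndependent_snoc_of_lt_finrank hb (by omega)
  let e := basisOfLinearIndependentOfCardEqFinrank hc (by simp [hV])
  refine hμ (four_form_eq_zero μ e ?_)
  rw [coe_basisOfLinearIndependentOfCardEqFinrank]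
  rw [← h a b c]
  congr 1
  funext i; fin_cases i <;> rfl

/-- Pairwise wedge-orthogonal two-forms with equal nonzero squares, the first one being
nondegenerate. -/
structure IsHyperTriple (ω₀ ω₁ ω₂ : V [⋀^Fin 2]→L[ℝ] ℝ) : Prop where
  finrank_eq : Module.finrank ℝ V = 4
  nondegenerate : ∀ u, (∀ v, ω₀ ![u, v] = 0) → u = 0
  ne_zero : wedge ω₀ ω₀ ≠ 0
  wedge₀₁ : wedge ω₀ ω₁ = 0
  wedge₀₂ : wedge ω₀ ω₂ = 0
  wedge₁₂ : wedge ω₁ ω₂ = 0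
  wedge₁₁ : wedge ω₁ ω₁ = wedge ω₀ ω₀
  wedge₂₂ : wedge ω₂ ω₂ = wedge ω₀ ω₀

theorem exists_dual_of_nondegenerate (hV : Module.finrank ℝ V = 4) {α : V [⋀^Fin 2]→L[ℝ] ℝ}
    (hα : ∀ u, (∀ v, α ![u, v] = 0) → u = 0) (f : V →ₗ[ℝ] ℝ) : ∃ w, ∀ v, α ![w, v] = f v := by
  have : FiniteDimensional ℝ V := Module.finite_of_finrank_pos (by omega)
  have hi : Function.Injective (twoFormLinear α) := by
    rw [← LinearMap.ker_eq_bot, LinearMap.ker_eq_bot']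
    exact fun u hu => hα u fun v => LinearMap.congr_fun hu v
  obtain ⟨w, hw⟩ := (LinearMap.injective_iff_surjective_of_finrank_eq_finrank
    (Subspace.dual_finrank_eq (K := ℝ) (V := V)).symm).1 hi f
  exact ⟨w, fun v => LinearMap.congr_fun hw v⟩

/-- With `J` defined by `α(Ju, ·) = β(u, ·)` this is `J² = -1`. Contracting `α ∧ β = 0` with `w =
Ju` and `β ∧ β = α ∧ α` with `u` gives `(ι_u α + ι_w β) ∧ α = 0`. The bracket is `ι_{u+x} α` for
some `x`, so `α ∧ α` is killed by `u + x`, which must vanish. -/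
theorem contraction_square (hV : Module.finrank ℝ V = 4) {α β : V [⋀^Fin 2]→L[ℝ] ℝ}
    (hα : ∀ u, (∀ v, α ![u, v] = 0) → u = 0) (h0 : wedge α α ≠ 0) (h1 : wedge α β = 0)
    (h2 : wedge β β = wedge α α) {u w : V} (h : ∀ v, α ![w, v] = β ![u, v]) (v : V) :
    β ![w, v] = -α ![u, v] := by
  obtain ⟨x, hx⟩ := exists_dual_of_nondegenerate hV hα (twoFormLinear β w)
  simp only [twoFormLinear_apply] at hx
  have hz : u + x = 0 := by
    refine eq_zero_of_contraction hV h0 fun a b c => ?_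
    have e1 : wedge α β ![w, a, b, c] = 0 := by rw [h1]; rfl
    have e2 : wedge β β ![u, a, b, c] = wedge α α ![u, a, b, c] := by rw [h2]
    have ha : ∀ v, α ![u + x, v] = α ![u, v] + β ![w, v] := fun v => by
      rw [← hx, ← twoFormLinear_apply, map_add]; rfl
    rw [wedge_two_two] at e1 e2 ⊢
    rw [wedge_two_two] at e2
    simp only [ha, h] at e1 e2 ⊢
    linear_combination 2 * e1 - e2
  have : x = -u := (neg_eq_of_add_eq_zero_right hz).symm
  rw [← hx, this, ← twoFormLinear_apply, map_neg]
  rfl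

/-- The endomorphisms attached to `β` and `γ` as in `contraction_square` anticommute. Contracting
the three orthogonality relations with `y`, `x` and `u` leaves `α ∧ (ι_y β + ι_x γ) = 0`. -/
theorem contraction_anticommute (hV : Module.finrank ℝ V = 4) {α β γ : V [⋀^Fin 2]→L[ℝ] ℝ}
    (hα : ∀ u, (∀ v, α ![u, v] = 0) → u = 0) (h0 : wedge α α ≠ 0) (h1 : wedge α β = 0)
    (h2 : wedge α γ = 0) (h3 : wedge β γ = 0) {u x y : V} (hx : ∀ v, α ![x, v] = β ![u, v])
    (hy : ∀ v, α ![y, v] = γ ![u, v]) (v : V) : γ ![x, v] = -β ![y, v] := by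
  obtain ⟨a, ha⟩ := exists_dual_of_nondegenerate hV hα (twoFormLinear β y)
  obtain ⟨b, hb⟩ := exists_dual_of_nondegenerate hV hα (twoFormLinear γ x)
  simp only [twoFormLinear_apply] at ha hb
  have hz : a + b = 0 := by
    refine eq_zero_of_contraction hV h0 fun p q r => ?_
    have e1 : wedge α β ![y, p, q, r] = 0 := by rw [h1]; rfl
    have e2 : wedge α γ ![x, p, q, r] = 0 := by rw [h2]; rfl
    have e3 : wedge β γ ![u, p, q, r] = 0 := by rw [h3]; rfl
    have hab : ∀ v, α ![a + b, v] = β ![y, v] + γ ![x, v] := fun v => by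
      rw [← ha, ← hb, ← twoFormLinear_apply, map_add]; rfl
    rw [wedge_two_two] at e1 e2 e3 ⊢
    simp only [hab, hx, hy] at e1 e2 e3 ⊢
    linear_combination 2 * e1 + 2 * e2 - 2 * e3
  have : a = -b := eq_neg_of_add_eq_zero_left hz
  rw [← ha, ← hb, this, ← twoFormLinear_apply α (-b), map_neg]
  simp [twoFormLinear_apply]

theorem twoForm_expand (α : V [⋀^Fin 2]→L[ℝ] ℝ) (e : Module.Basis (Fin 4) ℝ V) (u v : V) :
    α ![u, v] =
      (e.coord 0 u * e.coord 1 v - e.coord 1 u * e.coord 0 v) * α ![e 0, e 1] +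
      (e.coord 0 u * e.coord 2 v - e.coord 2 u * e.coord 0 v) * α ![e 0, e 2] +
      (e.coord 0 u * e.coord 3 v - e.coord 3 u * e.coord 0 v) * α ![e 0, e 3] +
      (e.coord 1 u * e.coord 2 v - e.coord 2 u * e.coord 1 v) * α ![e 1, e 2] +
      (e.coord 1 u * e.coord 3 v - e.coord 3 u * e.coord 1 v) * α ![e 1, e 3] +
      (e.coord 2 u * e.coord 3 v - e.coord 3 u * e.coord 2 v) * α ![e 2, e 3] := by
  have hu := e.sum_repr u
  have hv := e.sum_repr v
  rw [← twoFormLinear_apply]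
  conv_lhs => rw [← hu, ← hv]
  simp only [Fin.sum_univ_four, map_add, map_smul, LinearMap.add_apply, LinearMap.smul_apply,
    twoFormLinear_apply, smul_eq_mul, Module.Basis.coord_apply, form_two_self]
  rw [form_two_swap α (e 0) (e 1), form_two_swap α (e 0) (e 2), form_two_swap α (e 0) (e 3),
    form_two_swap α (e 1) (e 2), form_two_swap α (e 1) (e 3), form_two_swap α (e 2) (e 3)]
  ring

/-- The hyperkähler normal form of a positively ordered hyper-triple: in suitable coordinates
`ω₀ = dx₁ ∧ dy₁ + dx₂ ∧ dy₂` and `ω₁ - i ω₂ = dz₁ ∧ dz₂`. -/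
theorem IsHyperTriple.exists_coordinates {ω₀ ω₁ ω₂ : V [⋀^Fin 2]→L[ℝ] ℝ}
    (h : IsHyperTriple ω₀ ω₁ ω₂)
    (hpos : ∀ u v, u ≠ 0 → (∀ w, ω₀ ![v, w] = ω₁ ![u, w]) → 0 < ω₂ ![u, v]) :
    ∃ x₁ y₁ x₂ y₂ : V →ₗ[ℝ] ℝ,
      (∀ u, x₁ u = 0 → y₁ u = 0 → x₂ u = 0 → y₂ u = 0 → u = 0) ∧
      (∀ u v, ω₀ ![u, v] = x₁ u * y₁ v - y₁ u * x₁ v + (x₂ u * y₂ v - y₂ u * x₂ v)) ∧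
      (∀ u v, ω₁ ![u, v] = x₁ u * x₂ v - x₂ u * x₁ v - (y₁ u * y₂ v - y₂ u * y₁ v)) ∧
      (∀ u v, ω₂ ![u, v] = -(x₁ u * y₂ v - y₂ u * x₁ v + (y₁ u * x₂ v - x₂ u * y₁ v))) := by
  have hV := h.finrank_eq
  have hnd := h.nondegenerate
  have : Nontrivial V := Module.nontrivial_of_finrank_pos (R := ℝ) (by omega)
  obtain ⟨a, ha⟩ := exists_ne (0 : V)
  -- With `J₁, J₂` attached to `ω₁, ω₂`, the frame is `a`, `b = J₁a`, `c = J₂a`, `d = J₁J₂a`.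
  obtain ⟨b, hb⟩ := exists_dual_of_nondegenerate hV hnd (twoFormLinear ω₁ a)
  obtain ⟨c, hc⟩ := exists_dual_of_nondegenerate hV hnd (twoFormLinear ω₂ a)
  obtain ⟨d, hd⟩ := exists_dual_of_nondegenerate hV hnd (twoFormLinear ω₁ c)
  simp only [twoFormLinear_apply] at hb hc hd
  have hb1 := contraction_square hV hnd h.ne_zero h.wedge₀₁ h.wedge₁₁ hb
  have hc2 := contraction_square hV hnd h.ne_zero h.wedge₀₂ h.wedge₂₂ hc
  have hd1 := contraction_square hV hnd h.ne_zero h.wedge₀₁ h.wedge₁₁ hd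
  have hb2 := contraction_anticommute hV hnd h.ne_zero h.wedge₀₁ h.wedge₀₂ h.wedge₁₂ hb hc
  have hneg : ∀ (α : V [⋀^Fin 2]→L[ℝ] ℝ) u v, α ![-u, v] = -α ![u, v] := fun α u v => by
    rw [← twoFormLinear_apply, map_neg]; rfl
  -- Anticommutation gives `J₂b = -d`, and `J₂² = -1` is then applied to `b`.
  have hd2 : ∀ v, ω₂ ![d, v] = ω₀ ![b, v] := by
    intro v
    have := contraction_square hV hnd h.ne_zero h.wedge₀₂ h.wedge₂₂ (u := b) (w := -d)
      (fun v => by rw [hneg, hd, hb2]) v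
    rw [hneg] at this
    linarith
  have hg := hpos a b ha hb
  -- By the quaternion relations every pairing in the frame is `0` or `±g`; positivity of `g` is
  -- what the ordering of the triple provides.
  set g := ω₂ ![a, b] with hgdef
  have s0 := form_two_swap ω₀
  have s1 := form_two_swap ω₁
  have s2 := form_two_swap ω₂
  have aa := form_two_self ω₀
  have z1 := form_two_self ω₁
  have z2 := form_two_self ω₂
  have g01 : ω₀ ![a, b] = 0 := by
    rw [s0 b a, hb, z1, neg_zero]
  have g02 : ω₀ ![a, c] = 0 := by
    rw [s0 c a, hc, z2, neg_zero]
  have g12 : ω₀ ![b, c] = -g := by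
    rw [s0 c b, hc]
  have g03 : ω₀ ![a, d] = -g := by
    rw [s0 d a, hd, s1 a c, ← hb, g12]; ring
  have g13 : ω₀ ![b, d] = 0 := by
    rw [← hd2, z2]
  have g23 : ω₀ ![c, d] = 0 := by
    rw [s0 d c, hd, z1, neg_zero]
  have hli : LinearIndependent ℝ ![a, b, c, d] := by
    rw [Fintype.linearIndependent_iff]
    intro k hk
    simp only [Fin.sum_univ_four, Matrix.cons_val_zero, Matrix.cons_val_one, Matrix.cons_val] at hk
    -- Each of `a, b, c, d` pairs nontrivially under `ω₀` with just one frame vector, so pairing a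
    -- relation with the frame isolates every coefficient times `g`.
    have hk' : ∀ v,
        k 0 * ω₀ ![a, v] + k 1 * ω₀ ![b, v] + k 2 * ω₀ ![c, v] + k 3 * ω₀ ![d, v] = 0 := by
      intro v
      have := congrArg (fun u => twoFormLinear ω₀ u v) hk
      simpa [twoFormLinear_apply] using this
    have ka := hk' a
    have kb := hk' b
    have kc := hk' c
    have kd := hk' d
    rw [aa, s0 a b, s0 a c, s0 a d, g01, g02, g03] at ka
    rw [aa, s0 b c, s0 b d, g01, g12, g13] at kb
    rw [aa, s0 c d, g02, g12, g23] at kc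
    rw [aa, g03, g13, g23] at kd
    have hg' := hg.ne'
    intro i
    fin_cases i
    · exact (mul_eq_zero.1 (by linarith : k 0 * g = 0)).resolve_right hg'
    · exact (mul_eq_zero.1 (by linarith : k 1 * g = 0)).resolve_right hg'
    · exact (mul_eq_zero.1 (by linarith : k 2 * g = 0)).resolve_right hg'
    · exact (mul_eq_zero.1 (by linarith : k 3 * g = 0)).resolve_right hg'
  let e := basisOfLinearIndependentOfCardEqFinrank hli (by simp [hV])
  have he : ⇑e = ![a, b, c, d] := coe_basisOfLinearIndependentOfCardEqFinrank _ _
  have e0 : e 0 = a := congrFun he 0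
  have e1 : e 1 = b := congrFun he 1
  have e2 : e 2 = c := congrFun he 2
  have e3 : e 3 = d := congrFun he 3
  have hr := Real.mul_self_sqrt hg.le
  set r := Real.sqrt g with hrdef
  have hr0 : r ≠ 0 := by
    rintro h0
    rw [h0] at hr
    linarith
  -- Up to antisymmetry the only nonzero pairings of `ω₀` are `ω₀(a, d) = ω₀(b, c) = -g`. This
  -- dictates the partners `(0, 3)` and `(2, 1)` and, together with the formulas for `ω₁` and `ω₂`,
  -- the signs; the scale is `r² = g`.
  refine ⟨r • e.coord 0, -r • e.coord 3, -r • e.coord 2, -r • e.coord 1, ?_, ?_, ?_, ?_⟩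
  · intro u h1 h2 h3 h4
    simp only [LinearMap.smul_apply, smul_eq_mul, mul_eq_zero, neg_eq_zero, hr0, false_or]
      at h1 h2 h3 h4
    refine e.ext_elem fun i => ?_
    rw [map_zero]
    fin_cases i
    · exact h1
    · exact h4
    · exact h3
    · exact h2
  · intro u v
    rw [twoForm_expand ω₀ e u v, e0, e1, e2, e3, g01, g02, g03, g12, g13, g23]
    simp only [LinearMap.smul_apply, smul_eq_mul]
    rw [← hr]
    ring
  · intro u v
    rw [twoForm_expand ω₁ e u v, e0, e1, e2, e3, ← hb, ← hb, ← hb, hb1, hb1, ← hd, aa, aa, g12, g13,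
      g02, g03]
    simp only [LinearMap.smul_apply, smul_eq_mul]
    rw [← hr]
    ring
  · intro u v
    have b2c : ω₂ ![b, c] = 0 := by rw [hb2, ← hd, s0 c d, g23]; ring
    have b2d : ω₂ ![b, d] = 0 := by rw [hb2, ← hd, aa]; ring
    rw [twoForm_expand ω₂ e u v, e0, e1, e2, e3, ← hgdef, ← hc, ← hc, b2c, b2d, hc2, aa, g23, g03]
    simp only [LinearMap.smul_apply, smul_eq_mul]
    rw [← hr]
    ring

/-- Forms given by the standard formulas in real coordinates are `SU(3)` forms. -/
theorem isSU3Forms_of_coordinates (hV : Module.finrank ℝ V = 6) {η : V [⋀^Fin 2]→L[ℝ] ℝ}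
    {ψp ψm : V [⋀^Fin 3]→L[ℝ] ℝ} (x y : Fin 3 → V →ₗ[ℝ] ℝ)
    (hxy : ∀ u, (∀ j, x j u = 0) → (∀ j, y j u = 0) → u = 0)
    (hη : ∀ u v, η ![u, v] = ∑ j, (x j u * y j v - y j u * x j v))
    (α β : V → V → ℝ)
    (hα : ∀ u v, α u v = x 0 u * x 1 v - x 1 u * x 0 v - (y 0 u * y 1 v - y 1 u * y 0 v))
    (hβ : ∀ u v, β u v = x 0 u * y 1 v - y 1 u * x 0 v + (y 0 u * x 1 v - x 1 u * y 0 v))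
    (hp : ∀ u v w, ψp ![u, v, w] = (α u v * x 2 w - α u w * x 2 v + α v w * x 2 u) -
      (β u v * y 2 w - β u w * y 2 v + β v w * y 2 u))
    (hm : ∀ u v w, ψm ![u, v, w] = (α u v * y 2 w - α u w * y 2 v + α v w * y 2 u) +
      (β u v * x 2 w - β u w * x 2 v + β v w * x 2 u)) :
    IsSU3Forms η ψp ψm := by
  have : FiniteDimensional ℝ V := Module.finite_of_finrank_pos (by omega)
  let L : V →ₗ[ℝ] (Fin 3 → ℂ) :=
    { toFun := fun u j => ⟨x j u, y j u⟩
      map_add' := fun u v => by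
        funext j
        apply Complex.ext <;> simp
      map_smul' := fun c u => by
        funext j
        apply Complex.ext <;> simp }
  have hL : Function.Injective L := by
    rw [← LinearMap.ker_eq_bot, LinearMap.ker_eq_bot']
    intro u hu
    refine hxy u (fun j => ?_) (fun j => ?_)
    · exact congrArg Complex.re (congrFun hu j)
    · exact congrArg Complex.im (congrFun hu j)
  have hd : Module.finrank ℝ V = Module.finrank ℝ (Fin 3 → ℂ) := by
    rw [hV, Module.finrank_pi_fintype]
    simp [Complex.finrank_real_complex]
  have hs := (LinearMap.injective_iff_surjective_of_finrank_eq_finrank hd).1 hL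
  refine ⟨LinearEquiv.ofBijective L ⟨hL, hs⟩, hη, fun u v w => ?_, fun u v w => ?_⟩
  · refine Eq.trans ?_ (congrArg Complex.re (Matrix.det_fin_three ![L u, L v, L w]).symm)
    rw [hp]
    simp only [hα, hβ]
    simp [L]
    ring
  · refine Eq.trans ?_ (congrArg Complex.im (Matrix.det_fin_three ![L u, L v, L w]).symm)
    rw [hm]
    simp only [hα, hβ]
    simp [L]
    ring

end Linear

/-! ### From a definite triple to the `SU(3)` model -/

section Linear

variable {V W : Type*} [AddCommGroup V] [Module ℝ V] [TopologicalSpace V]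
  [AddCommGroup W] [Module ℝ W] [TopologicalSpace W]

/-- The pointwise construction of an `SU(3)`-structure from a definite triple of two-forms on a
four-dimensional quotient and a complementary coframe. -/
theorem isSU3Forms_of_triple (hV : Module.finrank ℝ V = 4) (hW : Module.finrank ℝ W = 6)
    {s₀ s₁ s₂ : V [⋀^Fin 2]→L[ℝ] ℝ} (hnd : ∀ u, (∀ v, s₀ ![u, v] = 0) → u = 0)
    (hμ : wedge s₀ s₀ ≠ 0) (h01 : wedge s₀ s₁ = 0) (h02 : wedge s₀ s₂ = 0) {a b c h : ℝ}
    (h11 : wedge s₁ s₁ = a • wedge s₀ s₀) (h12 : wedge s₁ s₂ = b • wedge s₀ s₀)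
    (h22 : wedge s₂ s₂ = c • wedge s₀ s₀) (ha : 0 < a) (hh : 0 < h) (hdet : h * h = a * c - b * b)
    (hpos : ∀ u v, u ≠ 0 → (∀ w, s₀ ![v, w] = s₁ ![u, w]) → 0 < s₂ ![u, v])
    (P : W →ₗ[ℝ] V) (t₁ t₂ : W →ₗ[ℝ] ℝ) (hinj : ∀ w, P w = 0 → t₁ w = 0 → t₂ w = 0 → w = 0)
    {η : W [⋀^Fin 2]→L[ℝ] ℝ} {ψp ψm : W [⋀^Fin 3]→L[ℝ] ℝ}
    (hη : ∀ u v, η ![u, v] = h * s₀ ![P u, P v] + h⁻¹ * (t₁ u * t₂ v - t₁ v * t₂ u))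
    (hp : ∀ u v w, ψp ![u, v, w] =
      (s₁ ![P u, P v] * t₁ w - s₁ ![P u, P w] * t₁ v + s₁ ![P v, P w] * t₁ u) +
      (s₂ ![P u, P v] * t₂ w - s₂ ![P u, P w] * t₂ v + s₂ ![P v, P w] * t₂ u))
    (hm : ∀ u v w, ψm ![u, v, w] = h⁻¹ * (
      c * (s₁ ![P u, P v] * t₂ w - s₁ ![P u, P w] * t₂ v + s₁ ![P v, P w] * t₂ u) -
      a * (s₂ ![P u, P v] * t₁ w - s₂ ![P u, P w] * t₁ v + s₂ ![P v, P w] * t₁ u) +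
      b * ((s₁ ![P u, P v] * t₁ w - s₁ ![P u, P w] * t₁ v + s₁ ![P v, P w] * t₁ u) -
        (s₂ ![P u, P v] * t₂ w - s₂ ![P u, P w] * t₂ v + s₂ ![P v, P w] * t₂ u)))) :
    IsSU3Forms η ψp ψm := by
  obtain ⟨k, hk, hka⟩ : ∃ k : ℝ, 0 < k ∧ a = k * k :=
    ⟨√a, Real.sqrt_pos.2 ha, (Real.mul_self_sqrt ha.le).symm⟩
  have hk0 := hk.ne'
  have hh0 := hh.ne'
  have hc : c = (h * h + b * b) / (k * k) := by
    rw [eq_div_iff (by positivity), ← hka]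
    linarith
  have h21 : wedge s₂ s₁ = b • wedge s₀ s₀ := by rw [wedge_two_two_comm, h12]
  -- Gram–Schmidt on `s₁, s₂` with `k² = a = q₁₁`, scaled so that all squares equal `h² s₀ ∧ s₀`;
  -- this uses `h² = ac - b²`.
  have hT : IsHyperTriple (h • s₀) ((h / k) • s₁) ((-b / k) • s₁ + k • s₂) := by
    refine ⟨hV, fun u hu => hnd u fun v => ?_, ?_, ?_, ?_, ?_, ?_, ?_⟩
    · have := hu v
      simpa [hh0] using this
    · rw [wedge_smul_left, wedge_smul_right, smul_smul]
      exact smul_ne_zero (mul_ne_zero hh0 hh0) hμ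
    · rw [wedge_smul_left, wedge_smul_right, h01, smul_zero, smul_zero]
    · rw [wedge_smul_left, wedge_add_right, wedge_smul_right, wedge_smul_right, h01, h02, smul_zero,
        smul_zero, add_zero, smul_zero]
    · rw [wedge_smul_left, wedge_add_right, wedge_smul_right, wedge_smul_right, h11, h12, smul_smul,
        smul_smul, ← add_smul, smul_smul, hka]
      convert zero_smul ℝ _ using 2
      field_simp
      ring
    · simp only [wedge_smul_left, wedge_smul_right, h11, smul_smul]
      congr 1
      rw [hka]
      field_simp
    · simp only [wedge_smul_left, wedge_smul_right, wedge_add_left, wedge_add_right, h11, h12, h21,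
        h22, smul_smul, ← add_smul]
      congr 1
      rw [hka, hc]
      field_simp
      ring
  -- Rescaling replaces `v` by `k v` in the ordering condition. The admixture of `s₁` in the third
  -- form does not matter, as `s₁(u, v) = s₀(k v, v) = 0`.
  obtain ⟨x₁, y₁, x₂, y₂, hxy, e0, e1, e2⟩ := hT.exists_coordinates (by
    intro u v hu huv
    simp only [ContinuousAlternatingMap.add_apply, ContinuousAlternatingMap.smul_apply,
      smul_eq_mul] at huv ⊢
    have huv' : ∀ w, s₀ ![k • v, w] = s₁ ![u, w] := by
      intro w
      have h3 := huv w
      rw [← twoFormLinear_apply, map_smul, LinearMap.smul_apply, twoFormLinear_apply, smul_eq_mul]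
      field_simp at h3
      linarith
    have h1 := hpos u (k • v) hu huv'
    have h2 : s₁ ![u, v] = 0 := by
      rw [← huv', ← twoFormLinear_apply, map_smul, LinearMap.smul_apply, twoFormLinear_apply,
        form_two_self, smul_zero]
    rw [← twoFormLinear_apply, map_smul, twoFormLinear_apply, smul_eq_mul] at h1
    rw [h2, mul_zero, zero_add]
    exact h1)
  simp only [ContinuousAlternatingMap.add_apply, ContinuousAlternatingMap.smul_apply,
      smul_eq_mul] at e0 e1 e2
  -- The third covector `dz₃ = (k/h) t₁ + (b/(kh)) t₂ + (i/k) t₂` satisfies `dx₃ ∧ dy₃ = h⁻¹ t₁ ∧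
  -- t₂`, and its `b` term cancels the admixture of `s₁` in the real part of `(ω₁ - iω₂) ∧ dz₃`.
  refine isSU3Forms_of_coordinates hW
    ![x₁ ∘ₗ P, x₂ ∘ₗ P, (k / h) • t₁ + (b / (k * h)) • t₂] ![y₁ ∘ₗ P, y₂ ∘ₗ P, k⁻¹ • t₂] ?_ ?_
    (fun u v => (h / k) * s₁ ![P u, P v])
    (fun u v => -((-b / k) * s₁ ![P u, P v] + k * s₂ ![P u, P v])) ?_ ?_ ?_ ?_
  · intro u hx hy
    have hx0 := hx 0
    have hx1 := hx 1
    have hx2 := hx 2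
    have hy0 := hy 0
    have hy1 := hy 1
    have hy2 := hy 2
    simp at hx0 hx1 hx2 hy0 hy1 hy2
    have ht2 : t₂ u = 0 := hy2.resolve_left hk0
    rw [ht2, mul_zero, add_zero] at hx2
    have ht1 : t₁ u = 0 := (mul_eq_zero.1 hx2).resolve_left (div_ne_zero hk0 hh0)
    exact hinj u (hxy _ hx0 hy0 hx1 hy1) ht1 ht2
  · intro u v
    rw [hη, e0, Fin.sum_univ_three]
    simp
    field_simp
    ring
  · intro u v
    rw [e1]
    simp
  · intro u v
    rw [e2]
    simp
  · intro u v w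
    rw [hp]
    simp
    field_simp
    ring
  · intro u v w
    rw [hm, hka, hc]
    simp
    field_simp
    ring

end Linear

/-! ### Positivity of the intersection matrix -/

section Triples

variable {M : Type*} [TopologicalSpace M] [ChartedSpace (EuclideanSpace ℝ (Fin 4)) M]
  {σ : Fin 3 → DiffForm 4 M 2}

theorem intersectionMatrix_symm (σ : Fin 3 → DiffForm 4 M 2) (x : M) :
    intersectionMatrix σ x 1 0 = intersectionMatrix σ x 0 1 := by
  simp only [intersectionMatrix, Matrix.of_apply]
  rw [wedge_two_two_comm]

theorem det_intersectionMatrix (σ : Fin 3 → DiffForm 4 M 2) (x : M) : (intersectionMatrix σ x).det =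
    intersectionMatrix σ x 0 0 * intersectionMatrix σ x 1 1 -
      intersectionMatrix σ x 0 1 * intersectionMatrix σ x 0 1 := by
  rw [Matrix.det_fin_two, intersectionMatrix_symm]

namespace IsCoherentTriple

variable (hσ : IsCoherentTriple σ) (x : M)
include hσ

/-- A three-dimensional span forces the three forms to be independent, so nonzero coefficients give
a nonzero element of `Λ⁺`. -/
theorem exists_volume : ∃ ν : (TangentSpace (𝓡 4) x) [⋀^Fin 4]→L[ℝ] ℝ, ν ≠ 0 ∧
    ∀ k : Fin 3 → ℝ, k ≠ 0 → ∃ c : ℝ, 0 < c ∧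
      wedge (∑ i, k i • σ i x) (∑ i, k i • σ i x) = c • ν := by
  obtain ⟨hf, ν, hν, h⟩ := hσ.maximalPositive x
  refine ⟨ν, hν, fun k hk => h _ ?_ ?_⟩
  · exact Submodule.sum_mem _ fun i _ => Submodule.smul_mem _ _ (Submodule.subset_span ⟨i, rfl⟩)
  · have hli : LinearIndependent ℝ (fun i => σ i x) := by
      rw [linearIndependent_iff_card_eq_finrank_span]
      exact hf.symm
    intro h0
    exact hk (funext ((Fintype.linearIndependent_iff.1 hli) k h0))

theorem wedge_zero_zero_ne_zero : wedge (σ 0 x) (σ 0 x) ≠ 0 := by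
  obtain ⟨ν, hν, h⟩ := hσ.exists_volume x
  obtain ⟨c, hc, h1⟩ := h (Pi.single 0 1) (by
    intro h0
    have := congrFun h0 0
    simp at this)
  simp only [Fin.sum_univ_three] at h1
  simp at h1
  rw [h1]
  exact smul_ne_zero hc.ne' hν

theorem wedge_succ_succ (i j : Fin 2) : wedge (σ i.succ x) (σ j.succ x) =
    intersectionMatrix σ x i j • wedge (σ 0 x) (σ 0 x) :=
  eq_topRatio_smul _ _ (hσ.wedge_zero_zero_ne_zero x)

/-- Positive definiteness of `Q`: the squares of `σ₀` and of `aσ₁ + bσ₂` are positive multiples of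
the same four-form. -/
theorem quadratic_pos (a b : ℝ) (hab : a ≠ 0 ∨ b ≠ 0) :
    0 < a * a * intersectionMatrix σ x 0 0 + 2 * (a * b) * intersectionMatrix σ x 0 1 +
      b * b * intersectionMatrix σ x 1 1 := by
  obtain ⟨ν, hν, h⟩ := hσ.exists_volume x
  obtain ⟨c, hc, h1⟩ := h ![1, 0, 0] (by
    intro h0
    have := congrFun h0 0
    simp at this)
  obtain ⟨d, hd, h2⟩ := h ![0, a, b] (by
    intro h0
    have e1 := congrFun h0 1
    have e2 := congrFun h0 2
    simp at e1 e2
    rcases hab with h | h <;> contradiction)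
  have q00 := hσ.wedge_succ_succ x 0 0
  have q01 := hσ.wedge_succ_succ x 0 1
  have q10 := hσ.wedge_succ_succ x 1 0
  have q11 := hσ.wedge_succ_succ x 1 1
  rw [intersectionMatrix_symm] at q10
  simp only [Fin.succ_zero_eq_one, Fin.succ_one_eq_two] at q00 q01 q10 q11
  simp only [Fin.sum_univ_three, Matrix.cons_val_zero, Matrix.cons_val_one, Matrix.cons_val,
    zero_smul, zero_add, add_zero, one_smul, wedge_add_left, wedge_add_right, wedge_smul_left,
    wedge_smul_right] at h1 h2
  rw [q00, q01, q10, q11, h1] at h2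
  simp only [smul_smul, ← add_smul] at h2
  have h3 := smul_left_injective ℝ hν h2
  refine pos_of_mul_pos_left (b := c) ?_ hc.le
  rw [← h3] at hd
  linarith

theorem intersectionMatrix_zero_zero_pos : 0 < intersectionMatrix σ x 0 0 := by
  have := hσ.quadratic_pos x 1 0 (by simp)
  simpa using this

theorem det_pos : 0 < (intersectionMatrix σ x).det := by
  have h0 := hσ.intersectionMatrix_zero_zero_pos x
  -- At the vector `(-q₁₂, q₁₁)` the quadratic form equals `q₁₁ det Q`.
  have h := hσ.quadratic_pos x (-intersectionMatrix σ x 0 1) (intersectionMatrix σ x 0 0)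
    (Or.inr h0.ne')
  rw [det_intersectionMatrix]
  refine pos_of_mul_pos_left (b := intersectionMatrix σ x 0 0) ?_ h0.le
  linarith

theorem hFun_pos : 0 < hFun σ x := Real.sqrt_pos.2 (hσ.det_pos x)

theorem hFun_mul_self : hFun σ x * hFun σ x =
    intersectionMatrix σ x 0 0 * intersectionMatrix σ x 1 1 -
      intersectionMatrix σ x 0 1 * intersectionMatrix σ x 0 1 := by
  rw [← det_intersectionMatrix]
  exact Real.mul_self_sqrt (hσ.det_pos x).le

end IsCoherentTriple

end Triples

/-! ### Smoothness of `Q` and `h` -/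

section Smoothness

variable {M : Type*} [TopologicalSpace M] [ChartedSpace (EuclideanSpace ℝ (Fin 4)) M]
  [IsManifold (𝓡 4) ∞ M]

/-- The basis in `topRatio` is tied to the preferred chart at each point and need not vary
continuously. The ratio does not depend on the basis, so near `x₀` it equals the quotient of the
coefficients in the single chart at `x₀`. -/
theorem contMDiff_topRatio {α β : DiffForm 4 M 4} (hα : α.IsSmooth) (hβ : β.IsSmooth)
    (h0 : ∀ x, β x ≠ 0) : ContMDiff (𝓡 4) 𝓘(ℝ, ℝ) ∞ (fun x => topRatio (α x) (β x)) := by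
  intro x₀
  let e := (EuclideanSpace.basisFun (Fin 4) ℝ).toBasis
  have hy := mem_extChartAt_target (I := 𝓡 4) x₀
  have hne : β.inChart x₀ (extChartAt (𝓡 4) x₀ x₀) ⇑e ≠ 0 := by
    intro h
    refine h0 x₀ ?_
    ext v
    rw [β.apply_eq_inChart, four_form_eq_zero _ e h]
    rfl
  have hq : ContDiffAt ℝ ∞ (fun y => α.inChart x₀ y ⇑e / β.inChart x₀ y ⇑e)
      (extChartAt (𝓡 4) x₀ x₀) :=
    (contDiffAt_form_apply (hα.contDiffAt_inChart hy) _).div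
      (contDiffAt_form_apply (hβ.contDiffAt_inChart hy) _) hne
  have hc : ContMDiffAt (𝓡 4) (𝓡 4) ∞ (extChartAt (𝓡 4) x₀) x₀ := contMDiffAt_extChartAt
  have hcomp := ContMDiffAt.comp (I' := 𝓡 4) x₀ hq.contMDiffAt hc
  refine hcomp.congr_of_eventuallyEq ?_
  have hev : ∀ᶠ y in 𝓝 (extChartAt (𝓡 4) x₀ x₀), β.inChart x₀ y ⇑e ≠ 0 :=
    (contDiffAt_form_apply (hβ.contDiffAt_inChart hy) _).continuousAt.eventually_ne hne
  filter_upwards [hc.continuousAt.eventually hev, extChartAt_source_mem_nhds (I := 𝓡 4) x₀]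
    with x hx hxs
  have hl := (extChartAt (𝓡 4) x₀).left_inv hxs
  have h1 : α.inChart x₀ (extChartAt (𝓡 4) x₀ x) ⇑e =
      topRatio (α x) (β x) * β.inChart x₀ (extChartAt (𝓡 4) x₀ x) ⇑e := by
    have h2 : topRatio (α x) (β x) =
        topRatio (α ((extChartAt (𝓡 4) x₀).symm (extChartAt (𝓡 4) x₀ x)))
          (β ((extChartAt (𝓡 4) x₀).symm (extChartAt (𝓡 4) x₀ x))) :=
      congrArg (fun z => topRatio (α z) (β z)) hl.symm
    have h3 := eq_topRatio_smul (α ((extChartAt (𝓡 4) x₀).symm (extChartAt (𝓡 4) x₀ x)))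
          (β ((extChartAt (𝓡 4) x₀).symm (extChartAt (𝓡 4) x₀ x))) (h0 _)
    rw [h2]
    exact congrArg (fun γ => γ fun i => mfderiv (𝓡 4) (𝓡 4) (extChartAt (𝓡 4) x₀).symm
      (extChartAt (𝓡 4) x₀ x) (e i)) h3
  exact (eq_div_iff hx).2 h1.symm

namespace IsCoherentTriple

variable {σ : Fin 3 → DiffForm 4 M 2} (hσ : IsCoherentTriple σ)
include hσ

omit [IsManifold (𝓡 4) ∞ M] in
theorem smooth (i : Fin 3) : (σ i).IsSmooth := (hσ.symplectic i).smooth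

theorem contMDiff_ratio {β : DiffForm 4 M 2} (hβ : β.IsSmooth) (i : Fin 3) :
    ContMDiff (𝓡 4) 𝓘(ℝ, ℝ) ∞
      (fun x => topRatio (wedge (σ i x) (β x)) (wedge (σ 0 x) (σ 0 x))) :=
  contMDiff_topRatio (α := (σ i).wedge β) (β := (σ 0).wedge (σ 0)) ((hσ.smooth i).wedge hβ)
    ((hσ.smooth 0).wedge (hσ.smooth 0)) hσ.wedge_zero_zero_ne_zero

theorem contMDiff_intersectionMatrix (i j : Fin 2) :
    ContMDiff (𝓡 4) 𝓘(ℝ, ℝ) ∞ (fun x => intersectionMatrix σ x i j) :=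
  hσ.contMDiff_ratio (hσ.smooth j.succ) i.succ

theorem contMDiff_det :
    ContMDiff (𝓡 4) 𝓘(ℝ, ℝ) ∞ (fun x => (intersectionMatrix σ x).det) := by
  simp only [det_intersectionMatrix]
  exact ((hσ.contMDiff_intersectionMatrix 0 0).mul (hσ.contMDiff_intersectionMatrix 1 1)).sub
    ((hσ.contMDiff_intersectionMatrix 0 1).mul (hσ.contMDiff_intersectionMatrix 0 1))

theorem contMDiff_hFun : ContMDiff (𝓡 4) 𝓘(ℝ, ℝ) ∞ (hFun σ) := fun x =>
  ContMDiffAt.comp (g := Real.sqrt) (f := fun x => (intersectionMatrix σ x).det) x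
    (Real.contDiffAt_sqrt (hσ.det_pos x).ne').contMDiffAt (hσ.contMDiff_det x)

theorem contMDiff_inv_hFun : ContMDiff (𝓡 4) 𝓘(ℝ, ℝ) ∞ (fun x => (hFun σ x)⁻¹) :=
  hσ.contMDiff_hFun.inv₀ fun x => (hσ.hFun_pos x).ne'

end IsCoherentTriple

end Smoothness

/-! ### The `SU(3)`-structure on the total space -/

section Structure

variable {M X : Type*} [TopologicalSpace M] [ChartedSpace (EuclideanSpace ℝ (Fin 4)) M]
  [IsManifold (𝓡 4) ∞ M] [TopologicalSpace X] [ChartedSpace (EuclideanSpace ℝ (Fin 6)) X]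
  [IsManifold (𝓡 6) ∞ X]

section

variable {π : X → M} (hπ : ContMDiff (𝓡 6) (𝓡 4) ∞ π) {σ : Fin 3 → DiffForm 4 M 2}
  (hσ : IsCoherentTriple σ) {θ : Fin 2 → DiffForm 6 X 1} (hθ : ∀ i, (θ i).IsSmooth)
include hπ hσ hθ

theorem isSmooth_bundleσ : (bundleσ π σ θ).IsSmooth :=
  (((hσ.smooth 0).pullback hπ).fsmul (hσ.contMDiff_hFun.comp hπ)).add
    (((hθ 0).wedge (hθ 1)).fsmul (hσ.contMDiff_inv_hFun.comp hπ))

theorem isSmooth_bundleψp : (bundleψp π σ θ).IsSmooth :=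
  (((hσ.smooth 1).pullback hπ).wedge (hθ 0)).add (((hσ.smooth 2).pullback hπ).wedge (hθ 1))

theorem isSmooth_bundleψm : (bundleψm π σ θ).IsSmooth := by
  have h1 := (hσ.smooth 1).pullback hπ
  have h2 := (hσ.smooth 2).pullback hπ
  have q := fun i j => (hσ.contMDiff_intersectionMatrix i j).comp hπ
  exact ((((h1.wedge (hθ 1)).fsmul (q 1 1)).sub ((h2.wedge (hθ 0)).fsmul (q 0 0))).add
    (((h1.wedge (hθ 0)).sub (h2.wedge (hθ 1))).fsmul (q 0 1))).fsmul
      (hσ.contMDiff_inv_hFun.comp hπ)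

end

omit [IsManifold (𝓡 4) ∞ M] [IsManifold (𝓡 6) ∞ X] in
theorem pullback_two_apply (π : X → M) (η : DiffForm 4 M 2) (p : X) (u v : TangentSpace (𝓡 6) p) :
    DiffForm.pullback (m := 6) π η p ![u, v] =
      η (π p) ![mfderiv (𝓡 6) (𝓡 4) π p u, mfderiv (𝓡 6) (𝓡 4) π p v] := by
  refine congrArg (η (π p)) ?_
  funext i; fin_cases i <;> rfl

omit [IsManifold (𝓡 4) ∞ M] [IsManifold (𝓡 6) ∞ X] in
theorem bundleσ_apply (π : X → M) (σ : Fin 3 → DiffForm 4 M 2) (θ : Fin 2 → DiffForm 6 X 1) (p : X)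
    (u v : TangentSpace (𝓡 6) p) :
    bundleσ π σ θ p ![u, v] = hFun σ (π p) * DiffForm.pullback (m := 6) π (σ 0) p ![u, v] +
      (hFun σ (π p))⁻¹ * (oneFormLinear (θ 0 p) u * oneFormLinear (θ 1 p) v -
        oneFormLinear (θ 0 p) v * oneFormLinear (θ 1 p) u) := by
  have h := wedge_one_one (θ 0 p) (θ 1 p) u v
  exact congrArg (fun r => hFun σ (π p) * DiffForm.pullback (m := 6) π (σ 0) p ![u, v] +
    (hFun σ (π p))⁻¹ * r) h

omit [IsManifold (𝓡 4) ∞ M] [IsManifold (𝓡 6) ∞ X] in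
theorem wedge_pullback_apply (π : X → M) (η : DiffForm 4 M 2) (θ : DiffForm 6 X 1) (p : X)
    (u v w : TangentSpace (𝓡 6) p) :
    (DiffForm.pullback (m := 6) π η).wedge θ p ![u, v, w] =
      η (π p) ![mfderiv (𝓡 6) (𝓡 4) π p u, mfderiv (𝓡 6) (𝓡 4) π p v] * oneFormLinear (θ p) w -
      η (π p) ![mfderiv (𝓡 6) (𝓡 4) π p u, mfderiv (𝓡 6) (𝓡 4) π p w] * oneFormLinear (θ p) v +
      η (π p) ![mfderiv (𝓡 6) (𝓡 4) π p v, mfderiv (𝓡 6) (𝓡 4) π p w] * oneFormLinear (θ p) u := by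
  have h := wedge_two_one (DiffForm.pullback (m := 6) π η p) (θ p) u v w
  rw [pullback_two_apply, pullback_two_apply, pullback_two_apply] at h
  exact h

theorem isSU3Structure_bundle [MulAction Torus2 X] {π : X → M} (hπ : IsPrincipalTorusBundle π)
    {σ : Fin 3 → DiffForm 4 M 2} (hσ : IsCoherentTriple σ) (hpos : IsPositivelyOrdered σ)
    {θ : Fin 2 → DiffForm 6 X 1} (hθ : IsConnectionForm θ) :
    IsSU3Structure (bundleσ π σ θ) (bundleψp π σ θ) (bundleψm π σ θ) := by
  refine ⟨isSmooth_bundleσ hπ.smooth_proj hσ hθ.smooth,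
    isSmooth_bundleψp hπ.smooth_proj hσ hθ.smooth,
    isSmooth_bundleψm hπ.smooth_proj hσ hθ.smooth, fun p => ?_⟩
  have hV : Module.finrank ℝ (TangentSpace (𝓡 4) (π p)) = 4 :=
    finrank_euclideanSpace_fin (𝕜 := ℝ) (n := 4)
  have hW : Module.finrank ℝ (TangentSpace (𝓡 6) p) = 6 :=
    finrank_euclideanSpace_fin (𝕜 := ℝ) (n := 6)
  refine isSU3Forms_of_triple hV hW ((hσ.symplectic 0).nondegenerate (π p))
    (hσ.wedge_zero_zero_ne_zero (π p)) (congrFun hσ.orthogonal₁ (π p))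
    (congrFun hσ.orthogonal₂ (π p)) (hσ.wedge_succ_succ (π p) 0 0) (hσ.wedge_succ_succ (π p) 0 1)
    (hσ.wedge_succ_succ (π p) 1 1) (hσ.intersectionMatrix_zero_zero_pos (π p))
    (hσ.hFun_pos (π p)) (hσ.hFun_mul_self (π p)) (fun u v hu h => hpos (π p) u v hu h)
    (mfderiv (𝓡 6) (𝓡 4) π p).toLinearMap (oneFormLinear (θ 0 p)) (oneFormLinear (θ 1 p))
    ?_ ?_ ?_ ?_
  · intro w h0 h1 h2
    exact hπ.tangent_eq_zero hθ p w h0 fun i => by fin_cases i <;> assumption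
  · intro u v
    rw [bundleσ_apply, pullback_two_apply]
    rfl
  · intro u v w
    exact congrArg₂ (· + ·) (wedge_pullback_apply π (σ 1) (θ 0) p u v w)
      (wedge_pullback_apply π (σ 2) (θ 1) p u v w)
  · intro u v w
    have e1 := wedge_pullback_apply π (σ 1) (θ 0) p u v w
    have e2 := wedge_pullback_apply π (σ 2) (θ 1) p u v w
    have e3 := wedge_pullback_apply π (σ 1) (θ 1) p u v w
    have e4 := wedge_pullback_apply π (σ 2) (θ 0) p u v w
    have e : bundleψm π σ θ p ![u, v, w] = (hFun σ (π p))⁻¹ *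
      (intersectionMatrix σ (π p) 1 1 *
        (DiffForm.pullback (m := 6) π (σ 1)).wedge (θ 1) p ![u, v, w]
      - intersectionMatrix σ (π p) 0 0 *
        (DiffForm.pullback (m := 6) π (σ 2)).wedge (θ 0) p ![u, v, w]
      + intersectionMatrix σ (π p) 0 1 *
        ((DiffForm.pullback (m := 6) π (σ 1)).wedge (θ 0) p ![u, v, w] -
        (DiffForm.pullback (m := 6) π (σ 2)).wedge (θ 1) p ![u, v, w])) := rfl
    rw [e, e1, e2, e3, e4]
    rfl

end Structure

/-! ### The algebra behind `σ ∧ dσ` -/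

section Linear

variable {V W : Type*} [AddCommGroup V] [Module ℝ V] [TopologicalSpace V]
  [AddCommGroup W] [Module ℝ W] [TopologicalSpace W]

theorem five_form_eq_zero (hV : Module.finrank ℝ V = 4) (μ : V [⋀^Fin 5]→L[ℝ] ℝ) : μ = 0 := by
  have : FiniteDimensional ℝ V := Module.finite_of_finrank_pos (by omega)
  ext v
  refine μ.toAlternatingMap.map_linearDependent v fun h => ?_
  have := h.fintype_card_le_finrank
  rw [hV, Fintype.card_fin] at this
  omega

/-- The wedge product of `η = h s₀ + k t₁ ∧ t₂` with a three-form that has the shape of `dη`, when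
`h k = 1` and `d` stands for `dh`. -/
theorem wedge_two_three_of_shape {η s f₁ f₂ : W [⋀^Fin 2]→L[ℝ] ℝ} {τ : W [⋀^Fin 3]→L[ℝ] ℝ}
    {d t₁ t₂ : W → ℝ} {δ : W [⋀^Fin 1]→L[ℝ] ℝ} (hδ : ∀ u, δ ![u] = d u) {h k : ℝ} (hk : h * k = 1)
    (hη : ∀ u v, η ![u, v] = h * s ![u, v] + k * (t₁ u * t₂ v - t₁ v * t₂ u))
    (hτ : ∀ u v w, τ ![u, v, w] =
      (d u * s ![v, w] - d v * s ![u, w] + d w * s ![u, v]) -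
      k * k * (d u * (t₁ v * t₂ w - t₁ w * t₂ v) - d v * (t₁ u * t₂ w - t₁ w * t₂ u) +
        d w * (t₁ u * t₂ v - t₁ v * t₂ u)) +
      k * ((f₁ ![u, v] * t₂ w - f₁ ![u, w] * t₂ v + f₁ ![v, w] * t₂ u) -
        (f₂ ![u, v] * t₁ w - f₂ ![u, w] * t₁ v + f₂ ![v, w] * t₁ u)))
    (hs : wedge s (wedge s δ) = 0) (u v w x y : W) :
    wedge η τ ![u, v, w, x, y] =
      (wedge s f₁ ![u, v, w, x] * t₂ y - wedge s f₁ ![u, v, w, y] * t₂ x +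
        wedge s f₁ ![u, v, x, y] * t₂ w - wedge s f₁ ![u, w, x, y] * t₂ v +
        wedge s f₁ ![v, w, x, y] * t₂ u) -
      (wedge s f₂ ![u, v, w, x] * t₁ y - wedge s f₂ ![u, v, w, y] * t₁ x +
        wedge s f₂ ![u, v, x, y] * t₁ w - wedge s f₂ ![u, w, x, y] * t₁ v +
        wedge s f₂ ![v, w, x, y] * t₁ u) := by
  -- Only the values of `s ∧ δ` on triples are kept, so that what follows is a polynomial identity.
  obtain ⟨γ, hγ, hsd⟩ : ∃ γ : W [⋀^Fin 3]→L[ℝ] ℝ, wedge s γ = 0 ∧ ∀ a b c, γ ![a, b, c] =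
      s ![a, b] * d c - s ![a, c] * d b + s ![b, c] * d a :=
    ⟨wedge s δ, hs, fun a b c => by rw [← hδ, ← hδ, ← hδ]; exact wedge_two_one s δ a b c⟩
  have h0 : wedge s γ ![u, v, w, x, y] = 0 := by rw [hγ]; rfl
  simp only [wedge_two_three, hsd] at h0
  have hh : h ≠ 0 := left_ne_zero_of_mul_eq_one hk
  obtain rfl : k = h⁻¹ := eq_inv_of_mul_eq_one_right hk
  rw [wedge_two_three]
  simp only [wedge_two_two]
  simp only [hη, hτ]
  field_simp
  -- The two terms in `s ∧ d ∧ t₁ ∧ t₂` cancel as `h k² = k`, repeated factors `tᵢ` vanish, and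
  -- apart from the asserted terms only a multiple of `s ∧ s ∧ δ` survives; clearing denominators
  -- raises the power of `h`.
  linear_combination h ^ 4 * h0

end Linear

/-! ### Exterior derivatives of the forms on the total space -/

section HalfFlat

variable {M X : Type*} [TopologicalSpace M] [ChartedSpace (EuclideanSpace ℝ (Fin 4)) M]
  [TopologicalSpace X] [ChartedSpace (EuclideanSpace ℝ (Fin 6)) X]

theorem wedge_pullback_pullback_apply (π : X → M) {k l : ℕ} (α : DiffForm 4 M k)
    (β : DiffForm 4 M l) (p : X) (v : Fin (k + l) → TangentSpace (𝓡 6) p) :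
    (DiffForm.pullback (m := 6) π α).wedge (DiffForm.pullback (m := 6) π β) p v =
      wedge (α (π p)) (β (π p)) fun i => mfderiv (𝓡 6) (𝓡 4) π p (v i) :=
  congrArg (fun γ => γ v) (wedge_comp (α (π p)) (β (π p)) (mfderiv (𝓡 6) (𝓡 4) π p))

variable [IsManifold (𝓡 4) ∞ M] [IsManifold (𝓡 6) ∞ X] {π : X → M}
  (hπ : ContMDiff (𝓡 6) (𝓡 4) ∞ π) {σ : Fin 3 → DiffForm 4 M 2} (hσ : IsCoherentTriple σ)
  {θ : Fin 2 → DiffForm 6 X 1} (hθ : ∀ i, (θ i).IsSmooth) {F : Fin 2 → DiffForm 4 M 2}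
  (hF : ∀ j, DiffForm.pullback (m := 6) π (F j) = (θ j).d)

include hπ hσ in
theorem d_pullback_triple (i : Fin 3) : (DiffForm.pullback (m := 6) π (σ i)).d = 0 := by
  rw [DiffForm.d_pullback hπ (hσ.smooth i), (hσ.symplectic i).closed]
  rfl

include hπ hσ hθ hF in
-- The `σᵢ` are closed, so only `σᵢ ∧ dθᵢ` remains, and `dθᵢ` is pulled back from `M`.
theorem d_bundleψp_apply (p : X) (v : Fin 4 → TangentSpace (𝓡 6) p) :
    (bundleψp π σ θ).d p v =
      (wedge (σ 1 (π p)) (F 0 (π p)) + wedge (σ 2 (π p)) (F 1 (π p)))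
        fun i => mfderiv (𝓡 6) (𝓡 4) π p (v i) := by
  have h1 := (hσ.smooth 1).pullback hπ
  have h2 := (hσ.smooth 2).pullback hπ
  have hd : (bundleψp π σ θ).d = _ := DiffForm.d_add (h1.wedge (hθ 0)) (h2.wedge (hθ 1))
  have e1 := DiffForm.d_wedge_two_one h1 (d_pullback_triple hπ hσ 1) (hθ 0) p v
  have e2 := DiffForm.d_wedge_two_one h2 (d_pullback_triple hπ hσ 2) (hθ 1) p v
  rw [← hF] at e1 e2
  refine (congrArg (fun α => α p v) hd).trans (congrArg₂ (· + ·)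
    (e1.trans (wedge_pullback_pullback_apply π (σ 1) (F 0) p v))
    (e2.trans (wedge_pullback_pullback_apply π (σ 2) (F 1) p v)))

omit [IsManifold (𝓡 6) ∞ X] in
include hπ hσ in
theorem differential_hFun_comp (p : X) (u : TangentSpace (𝓡 6) p) :
    differential (fun p => hFun σ (π p)) p u =
      differential (hFun σ) (π p) (mfderiv (𝓡 6) (𝓡 4) π p u) := by
  have h := HasMFDerivAt.comp p
    ((hσ.contMDiff_hFun (π p)).mdifferentiableAt (by simp)).hasMFDerivAt
    ((hπ p).mdifferentiableAt (by simp)).hasMFDerivAt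
  exact congrArg (fun T => T u) h.mfderiv

omit [IsManifold (𝓡 6) ∞ X] in
include hπ hσ in
theorem differential_inv_hFun_comp (p : X) (u : TangentSpace (𝓡 6) p) :
    differential (fun p => (hFun σ (π p))⁻¹) p u =
      -((hFun σ (π p))⁻¹ * (hFun σ (π p))⁻¹ *
        differential (hFun σ) (π p) (mfderiv (𝓡 6) (𝓡 4) π p u)) := by
  have hne := (hσ.hFun_pos (π p)).ne'
  have h := HasMFDerivAt.comp p (hasDerivAt_inv hne).hasFDerivAt.hasMFDerivAt
    (((hσ.contMDiff_hFun.comp hπ) p).mdifferentiableAt (by simp)).hasMFDerivAt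
  rw [← differential_hFun_comp hπ hσ]
  refine (congrArg (fun T => T u) h.mfderiv).trans ?_
  change differential (fun p => hFun σ (π p)) p u * -(hFun σ (π p) ^ 2)⁻¹ = _
  field_simp

include hπ hσ hθ hF in
-- This is `dσ = dh ∧ σ₀ - h⁻² dh ∧ θ₁ ∧ θ₂ + h⁻¹ (F₁ ∧ θ₂ - F₂ ∧ θ₁)`. The ingredients enter as
-- variables with defining equations, so that the result has exactly the shape required by
-- `wedge_two_three_of_shape`.
theorem d_bundleσ_apply (p : X) (u v w : TangentSpace (𝓡 6) p) {d : TangentSpace (𝓡 6) p → ℝ}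
    (hd : ∀ u, d u = differential (hFun σ) (π p) (mfderiv (𝓡 6) (𝓡 4) π p u))
    {s f₁ f₂ : (TangentSpace (𝓡 6) p) [⋀^Fin 2]→L[ℝ] ℝ} (hs : s = DiffForm.pullback π (σ 0) p)
    (h₁ : f₁ = DiffForm.pullback π (F 0) p) (h₂ : f₂ = DiffForm.pullback π (F 1) p)
    {t₁ t₂ : TangentSpace (𝓡 6) p → ℝ} (ht₁ : ∀ u, t₁ u = oneFormLinear (θ 0 p) u)
    (ht₂ : ∀ u, t₂ u = oneFormLinear (θ 1 p) u) {k : ℝ} (hk : k = (hFun σ (π p))⁻¹) :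
    (bundleσ π σ θ).d p ![u, v, w] =
      (d u * s ![v, w] - d v * s ![u, w] + d w * s ![u, v]) -
      k * k * (d u * (t₁ v * t₂ w - t₁ w * t₂ v) - d v * (t₁ u * t₂ w - t₁ w * t₂ u) +
        d w * (t₁ u * t₂ v - t₁ v * t₂ u)) +
      k * ((f₁ ![u, v] * t₂ w - f₁ ![u, w] * t₂ v + f₁ ![v, w] * t₂ u) -
        (f₂ ![u, v] * t₁ w - f₂ ![u, w] * t₁ v + f₂ ![v, w] * t₁ u)) := by
  have hs0 := (hσ.smooth 0).pullback hπ
  have hh := hσ.contMDiff_hFun.comp hπ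
  have hi := hσ.contMDiff_inv_hFun.comp hπ
  have hw := (hθ 0).wedge (hθ 1)
  have hsum : (bundleσ π σ θ).d = _ := DiffForm.d_add (hs0.fsmul hh) (hw.fsmul hi)
  have e1 := DiffForm.d_fsmul_two hh hs0 p u v w
  have e2 := DiffForm.d_fsmul_two hi hw p u v w
  have e0 : (DiffForm.pullback (m := 6) π (σ 0)).d p ![u, v, w] = 0 := by
    rw [d_pullback_triple hπ hσ]; rfl
  have e3 : ((θ 0).wedge (θ 1)).d p ![u, v, w] =
      (f₁ ![u, v] * t₂ w - f₁ ![u, w] * t₂ v + f₁ ![v, w] * t₂ u) -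
        (f₂ ![u, v] * t₁ w - f₂ ![u, w] * t₁ v + f₂ ![v, w] * t₁ u) := by
    rw [DiffForm.d_wedge_one_one (hθ 0) (hθ 1), ← hF, ← hF]
    simp only [ht₁, ht₂, h₁, h₂]
    exact congrArg₂ (· - ·) (wedge_two_one _ (θ 1 p) u v w) (wedge_two_one _ (θ 0 p) u v w)
  have e4 : ∀ a b, (θ 0).wedge (θ 1) p ![a, b] = t₁ a * t₂ b - t₁ b * t₂ a := fun a b => by
    rw [ht₁, ht₁, ht₂, ht₂]
    exact wedge_one_one (θ 0 p) (θ 1 p) a b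
  have d1 : ∀ a, differential (hFun σ ∘ π) p a = d a := fun a =>
    (differential_hFun_comp hπ hσ p a).trans (hd a).symm
  have d2 : ∀ a, differential ((fun x => (hFun σ x)⁻¹) ∘ π) p a = -(k * k * d a) := fun a => by
    rw [hd, hk]
    exact differential_inv_hFun_comp hπ hσ p a
  rw [e0, d1, d1, d1, ← hs] at e1
  rw [e3, d2, d2, d2, e4, e4, e4] at e2
  refine ((congrArg (fun α => α p ![u, v, w]) hsum).trans (congrArg₂ (· + ·) e1 e2)).trans ?_
  simp only [Function.comp_apply, ← hk]
  ring

include hπ hσ hθ hF in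
-- All terms with `dh` drop out, and the factors `h` and `h⁻¹` cancel in `σ₀ ∧ F₁ ∧ θ₂ - σ₀ ∧ F₂ ∧
-- θ₁`.
theorem wedge_bundleσ_d_apply (p : X) (u v w x y : TangentSpace (𝓡 6) p)
    {g₁ g₂ : (TangentSpace (𝓡 6) p) [⋀^Fin 4]→L[ℝ] ℝ}
    (h₁ : g₁ = (DiffForm.pullback (m := 6) π (σ 0)).wedge (DiffForm.pullback (m := 6) π (F 0)) p)
    (h₂ : g₂ = (DiffForm.pullback (m := 6) π (σ 0)).wedge (DiffForm.pullback (m := 6) π (F 1)) p)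
    {t₁ t₂ : TangentSpace (𝓡 6) p → ℝ} (ht₁ : ∀ u, t₁ u = oneFormLinear (θ 0 p) u)
    (ht₂ : ∀ u, t₂ u = oneFormLinear (θ 1 p) u) :
    wedge (l := 3) (bundleσ π σ θ p) ((bundleσ π σ θ).d p) ![u, v, w, x, y] =
      (g₁ ![u, v, w, x] * t₂ y - g₁ ![u, v, w, y] * t₂ x + g₁ ![u, v, x, y] * t₂ w -
        g₁ ![u, w, x, y] * t₂ v + g₁ ![v, w, x, y] * t₂ u) -
      (g₂ ![u, v, w, x] * t₁ y - g₂ ![u, v, w, y] * t₁ x + g₂ ![u, v, x, y] * t₁ w -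
        g₂ ![u, w, x, y] * t₁ v + g₂ ![v, w, x, y] * t₁ u) := by
  let D : TangentSpace (𝓡 4) (π p) →L[ℝ] ℝ := mfderiv (𝓡 4) 𝓘(ℝ, ℝ) (hFun σ) (π p)
  let δ₀ : (TangentSpace (𝓡 4) (π p)) [⋀^Fin 1]→L[ℝ] ℝ :=
    ContinuousAlternatingMap.ofSubsingleton ℝ (TangentSpace (𝓡 4) (π p)) ℝ (0 : Fin 1) D
  have hV : Module.finrank ℝ (TangentSpace (𝓡 4) (π p)) = 4 :=
    finrank_euclideanSpace_fin (𝕜 := ℝ) (n := 4)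
  -- `σ₀ ∧ σ₀ ∧ dh` is pulled back from a five-form on a four-dimensional space.
  have hs : wedge (DiffForm.pullback (m := 6) π (σ 0) p)
      (wedge (DiffForm.pullback (m := 6) π (σ 0) p)
        (δ₀.compContinuousLinearMap (mfderiv (𝓡 6) (𝓡 4) π p))) = 0 := by
    have h5 := five_form_eq_zero hV (wedge (σ 0 (π p)) (wedge (σ 0 (π p)) δ₀))
    refine (congrArg _ (wedge_comp (σ 0 (π p)) δ₀ (mfderiv (𝓡 6) (𝓡 4) π p))).trans
      ((wedge_comp (σ 0 (π p)) _ (mfderiv (𝓡 6) (𝓡 4) π p)).trans ?_)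
    rw [h5]
    rfl
  have hη : ∀ u v, bundleσ π σ θ p ![u, v] =
      hFun σ (π p) * DiffForm.pullback (m := 6) π (σ 0) p ![u, v] +
        (hFun σ (π p))⁻¹ * (t₁ u * t₂ v - t₁ v * t₂ u) := fun u v => by
    rw [ht₁, ht₁, ht₂, ht₂]
    exact bundleσ_apply π σ θ p u v
  obtain ⟨d, hd⟩ : ∃ d : TangentSpace (𝓡 6) p → ℝ, ∀ u,
      d u = differential (hFun σ) (π p) (mfderiv (𝓡 6) (𝓡 4) π p u) := ⟨_, fun _ => rfl⟩
  have hτ := fun u v w =>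
    d_bundleσ_apply hπ hσ hθ hF p u v w hd rfl rfl rfl ht₁ ht₂ rfl
  have hδ : ∀ u, (δ₀.compContinuousLinearMap (mfderiv (𝓡 6) (𝓡 4) π p)) ![u] = d u :=
    fun u => (hd u).symm
  have key := wedge_two_three_of_shape hδ (mul_inv_cancel₀ (hσ.hFun_pos (π p)).ne') hη hτ hs
    u v w x y
  rw [show wedge (DiffForm.pullback (m := 6) π (σ 0) p) (DiffForm.pullback π (F 0) p) = g₁ from
    h₁.symm, show wedge (DiffForm.pullback (m := 6) π (σ 0) p) (DiffForm.pullback π (F 1) p) = g₂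
    from h₂.symm] at key
  exact key

end HalfFlat

/-! ### Half-flatness as equations on the base -/

section HalfFlatIff

variable {M X : Type*} [TopologicalSpace M] [ChartedSpace (EuclideanSpace ℝ (Fin 4)) M]
  [IsManifold (𝓡 4) ∞ M] [TopologicalSpace X] [ChartedSpace (EuclideanSpace ℝ (Fin 6)) X]
  [IsManifold (𝓡 6) ∞ X]

theorem isHalfFlat_bundle_iff [MulAction Torus2 X] {π : X → M} (hπ : IsPrincipalTorusBundle π)
    {σ : Fin 3 → DiffForm 4 M 2} (hσ : IsCoherentTriple σ) {θ : Fin 2 → DiffForm 6 X 1}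
    (hθ : IsConnectionForm θ) {F : Fin 2 → DiffForm 4 M 2}
    (hF : ∀ j, DiffForm.pullback (m := 6) π (F j) = (θ j).d) :
    IsHalfFlat (bundleσ π σ θ) (bundleψp π σ θ) ↔
      ∀ x, (∀ j, wedge (σ 0 x) (F j x) = 0) ∧
        wedge (σ 1 x) (F 0 x) + wedge (σ 2 x) (F 1 x) = 0 := by
  have hp := hπ.smooth_proj
  constructor
  · rintro ⟨h1, h2⟩ x
    obtain ⟨p, rfl⟩ := hπ.surjective x
    have key : ∀ (v : Fin 4 → TangentSpace (𝓡 4) (π p)) (τ : Fin 2 → ℝ),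
        wedge (σ 0 (π p)) (F 0 (π p)) v * τ 1 - wedge (σ 0 (π p)) (F 1 (π p)) v * τ 0 = 0 := by
      intro v τ
      -- Four horizontal lifts and one vertical vector: on these `σ ∧ dσ` reduces to the terms in
      -- which `θ` meets the vertical vector.
      choose w hw hw0 using fun i => hπ.exists_tangent hθ p (v i) 0
      obtain ⟨z, -, hz⟩ := hπ.exists_tangent hθ p 0 τ
      have e : wedge (l := 3) (bundleσ π σ θ p) ((bundleσ π σ θ).d p)
          ![w 0, w 1, w 2, w 3, z] = 0 := by
        rw [show wedge (l := 3) (bundleσ π σ θ p) ((bundleσ π σ θ).d p) = 0 from congrFun h1 p]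
        rfl
      rw [wedge_bundleσ_d_apply hp hσ hθ.smooth hF p _ _ _ _ _ rfl rfl (fun _ => rfl)
        (fun _ => rfl)] at e
      simp only [hw0, hz, Pi.zero_apply, mul_zero, sub_zero, add_zero] at e
      have hv : ![w 0, w 1, w 2, w 3] = w := vec_four_eta.symm
      rw [hv, wedge_pullback_pullback_apply, wedge_pullback_pullback_apply] at e
      simpa only [hw] using e
    refine ⟨Fin.forall_fin_two.2 ⟨?_, ?_⟩, ?_⟩
    · ext v
      simpa using key v ![0, 1]
    · ext v
      simpa using key v ![1, 0]
    · ext v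
      choose w hw _ using fun i => hπ.exists_tangent hθ p (v i) 0
      have e := d_bundleψp_apply hp hσ hθ.smooth hF p w
      simp only [hw] at e
      exact e.symm.trans (congrArg (fun α => α w) (congrFun h2 p))
  · intro h
    refine ⟨funext fun p => ?_, funext fun p => ?_⟩
    · have hg : ∀ j, (0 : (TangentSpace (𝓡 6) p) [⋀^Fin 4]→L[ℝ] ℝ) =
          (DiffForm.pullback (m := 6) π (σ 0)).wedge (DiffForm.pullback (m := 6) π (F j)) p := by
        intro j
        ext v
        rw [wedge_pullback_pullback_apply, (h (π p)).1 j]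
        rfl
      have e : wedge (l := 3) (bundleσ π σ θ p) ((bundleσ π σ θ).d p) = 0 := by
        ext v
        rw [show v = ![v 0, v 1, v 2, v 3, v 4] from vec_five_eta,
          wedge_bundleσ_d_apply hp hσ hθ.smooth hF p _ _ _ _ _ (hg 0) (hg 1) (fun _ => rfl)
            (fun _ => rfl)]
        simp
      exact e
    · ext v
      refine (d_bundleψp_apply hp hσ hθ.smooth hF p v).trans ?_
      rw [(h (π p)).2]
      rfl

end HalfFlatIff

/-! ### Self-dual parts of the curvature and the trace condition -/

section SelfDual

theorem wedge_sub_left {V : Type*} [AddCommGroup V] [Module ℝ V] [TopologicalSpace V] {k l : ℕ}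
    (α α' : V [⋀^Fin k]→L[ℝ] ℝ) (β : V [⋀^Fin l]→L[ℝ] ℝ) :
    wedge (α - α') β = wedge α β - wedge α' β := by
  rw [eq_sub_iff_add_eq, ← wedge_add_left, sub_add_cancel]

variable {M : Type*} [TopologicalSpace M] [ChartedSpace (EuclideanSpace ℝ (Fin 4)) M]

/-- Orthogonality of `F - G` to `Λ⁺` is tested against `σ₀, σ₁, σ₂`, whose Gram matrix relative to
`σ₀ ∧ σ₀` is block diagonal with blocks `1` and `Q`. -/
theorem IsCoherentTriple.isSelfDualPart_iff {σ : Fin 3 → DiffForm 4 M 2} (hσ : IsCoherentTriple σ)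
    (x : M) (F : (TangentSpace (𝓡 4) x) [⋀^Fin 2]→L[ℝ] ℝ) (a b : ℝ) :
    IsSelfDualPart (fun i => σ i x) F (a • σ 1 x + b • σ 2 x) ↔
      wedge (σ 0 x) F = 0 ∧
      wedge (σ 1 x) F = (a * intersectionMatrix σ x 0 0 + b * intersectionMatrix σ x 0 1) •
        wedge (σ 0 x) (σ 0 x) ∧
      wedge (σ 2 x) F = (a * intersectionMatrix σ x 0 1 + b * intersectionMatrix σ x 1 1) •
        wedge (σ 0 x) (σ 0 x) := by
  have hmem : a • σ 1 x + b • σ 2 x ∈ Submodule.span ℝ (Set.range fun i => σ i x) :=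
    add_mem (Submodule.smul_mem _ _ (Submodule.subset_span ⟨1, rfl⟩))
      (Submodule.smul_mem _ _ (Submodule.subset_span ⟨2, rfl⟩))
  have hG : ∀ i, wedge (a • σ 1 x + b • σ 2 x) (σ i x) =
      a • wedge (σ 1 x) (σ i x) + b • wedge (σ 2 x) (σ i x) := fun i => by
    rw [wedge_add_left, wedge_smul_left, wedge_smul_left]
  have hi : ∀ i, wedge (F - (a • σ 1 x + b • σ 2 x)) (σ i x) = 0 ↔
      wedge (σ i x) F = a • wedge (σ 1 x) (σ i x) + b • wedge (σ 2 x) (σ i x) := fun i => by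
    rw [wedge_sub_left, hG, sub_eq_zero, wedge_two_two_comm F]
  have h10 : wedge (σ 1 x) (σ 0 x) = 0 :=
    (wedge_two_two_comm _ _).trans (congrFun hσ.orthogonal₁ x)
  have h20 : wedge (σ 2 x) (σ 0 x) = 0 :=
    (wedge_two_two_comm _ _).trans (congrFun hσ.orthogonal₂ x)
  have h11 := hσ.wedge_succ_succ x 0 0
  have h12 := hσ.wedge_succ_succ x 0 1
  have h22 := hσ.wedge_succ_succ x 1 1
  simp only [Fin.succ_zero_eq_one, Fin.succ_one_eq_two] at h11 h12 h22
  have h21 := (wedge_two_two_comm (σ 2 x) (σ 1 x)).trans h12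
  unfold IsSelfDualPart
  simp only [hmem, true_and, hi, Fin.forall_fin_succ, Fin.succ_zero_eq_one, Fin.succ_one_eq_two,
    IsEmpty.forall_iff, and_true, h10, h20, h11, h12, h21, h22, smul_zero, add_zero, smul_smul,
    ← add_smul]

theorem trace_mul_intersectionMatrix (A : Matrix (Fin 2) (Fin 2) ℝ) (σ : Fin 3 → DiffForm 4 M 2)
    (x : M) : (A * intersectionMatrix σ x).trace =
      (A 0 0 * intersectionMatrix σ x 0 0 + A 1 0 * intersectionMatrix σ x 0 1) +
        (A 0 1 * intersectionMatrix σ x 0 1 + A 1 1 * intersectionMatrix σ x 1 1) := by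
  rw [Matrix.trace_fin_two, Matrix.mul_apply, Matrix.mul_apply, Fin.sum_univ_two, Fin.sum_univ_two,
    intersectionMatrix_symm]
  ring

/-- With `σₖ ∧ Fⱼ = rₖⱼ σ₀ ∧ σ₀` for `k = 1, 2`, the matrix must solve `QA = R`, so `Tr(AQ) = Tr R`
is the coefficient of `σ₁ ∧ F₁ + σ₂ ∧ F₂`. -/
theorem IsCoherentTriple.exists_selfDualPart_iff [IsManifold (𝓡 4) ∞ M]
    {σ : Fin 3 → DiffForm 4 M 2} (hσ : IsCoherentTriple σ) {F : Fin 2 → DiffForm 4 M 2}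
    (hF : ∀ j, (F j).IsSmooth) :
    (∀ x, (∀ j, wedge (σ 0 x) (F j x) = 0) ∧
      wedge (σ 1 x) (F 0 x) + wedge (σ 2 x) (F 1 x) = 0) ↔
    ∃ A : M → Matrix (Fin 2) (Fin 2) ℝ,
      (∀ i j, ContMDiff (𝓡 4) 𝓘(ℝ, ℝ) ∞ (fun x => A x i j)) ∧
      (∀ x j, IsSelfDualPart (fun i => σ i x) (F j x) (A x 0 j • σ 1 x + A x 1 j • σ 2 x)) ∧
      ∀ x, (A x * intersectionMatrix σ x).trace = 0 := by
  simp only [hσ.isSelfDualPart_iff, trace_mul_intersectionMatrix]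
  constructor
  · intro h
    let r : Fin 3 → Fin 2 → M → ℝ := fun k j x =>
      topRatio (wedge (σ k x) (F j x)) (wedge (σ 0 x) (σ 0 x))
    have hr : ∀ k j x, wedge (σ k x) (F j x) = r k j x • wedge (σ 0 x) (σ 0 x) := fun k j x =>
      eq_topRatio_smul _ _ (hσ.wedge_zero_zero_ne_zero x)
    have hrs : ∀ k j, ContMDiff (𝓡 4) 𝓘(ℝ, ℝ) ∞ (r k j) := fun k j => hσ.contMDiff_ratio (hF j) k
    have hq := hσ.contMDiff_intersectionMatrix
    have hD := hσ.contMDiff_det.inv₀ fun x => (hσ.det_pos x).ne'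
    -- `A = Q⁻¹R` by Cramer's rule, smooth because `det Q` is smooth and positive.
    let A : M → Matrix (Fin 2) (Fin 2) ℝ := fun x => Matrix.of ![
      fun j => (intersectionMatrix σ x 1 1 * r 1 j x - intersectionMatrix σ x 0 1 * r 2 j x) *
        (intersectionMatrix σ x).det⁻¹,
      fun j => (intersectionMatrix σ x 0 0 * r 2 j x - intersectionMatrix σ x 0 1 * r 1 j x) *
        (intersectionMatrix σ x).det⁻¹]
    have hA1 : ∀ x j, A x 0 j * intersectionMatrix σ x 0 0 + A x 1 j * intersectionMatrix σ x 0 1 =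
        r 1 j x := fun x j => by
      have := (hσ.det_pos x).ne'
      simp only [A, Matrix.of_apply, Matrix.cons_val_zero, Matrix.cons_val_one]
      field_simp
      rw [det_intersectionMatrix]
      ring
    have hA2 : ∀ x j, A x 0 j * intersectionMatrix σ x 0 1 + A x 1 j * intersectionMatrix σ x 1 1 =
        r 2 j x := fun x j => by
      have := (hσ.det_pos x).ne'
      simp only [A, Matrix.of_apply, Matrix.cons_val_zero, Matrix.cons_val_one]
      field_simp
      rw [det_intersectionMatrix]
      ring
    refine ⟨A, Fin.forall_fin_two.2 ⟨fun j => ?_, fun j => ?_⟩, fun x j => ⟨(h x).1 j, ?_, ?_⟩,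
      fun x => ?_⟩
    · exact (((hq 1 1).mul (hrs 1 j)).sub ((hq 0 1).mul (hrs 2 j))).mul hD
    · exact (((hq 0 0).mul (hrs 2 j)).sub ((hq 0 1).mul (hrs 1 j))).mul hD
    · rw [hA1, ← hr]
    · rw [hA2, ← hr]
    · have h2 := (h x).2
      rw [hr, hr, ← add_smul] at h2
      rw [hA1, hA2]
      exact (smul_eq_zero.1 h2).resolve_right (hσ.wedge_zero_zero_ne_zero x)
  · rintro ⟨A, -, hA, htr⟩ x
    refine ⟨fun j => (hA x j).1, ?_⟩
    rw [(hA x 0).2.1, (hA x 1).2.2, ← add_smul, htr x, zero_smul]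

end SelfDual

end

theorem mainTheorem12
    {M : Type*} [TopologicalSpace M] [ChartedSpace (EuclideanSpace ℝ (Fin 4)) M]
    [IsManifold (𝓡 4) ∞ M]
    {X : Type*} [TopologicalSpace X] [ChartedSpace (EuclideanSpace ℝ (Fin 6)) X]
    [IsManifold (𝓡 6) ∞ X] [MulAction Torus2 X]
    (σ : Fin 3 → DiffForm 4 M 2) (hσ : IsCoherentTriple σ)
    (π : X → M) (hπ : IsPrincipalTorusBundle π)
    (θ : Fin 2 → DiffForm 6 X 1) (hθ : IsConnectionForm θ) :
    (IsPositivelyOrdered σ →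
      IsSU3Structure (bundleσ π σ θ) (bundleψp π σ θ) (bundleψm π σ θ)) ∧
    ∃ F : Fin 2 → DiffForm 4 M 2,
      (∀ j, (F j).IsSmooth ∧ (F j).pullback π = (θ j).d) ∧
      (IsHalfFlat (bundleσ π σ θ) (bundleψp π σ θ) ↔
        ∃ A : M → Matrix (Fin 2) (Fin 2) ℝ,
          (∀ i j, ContMDiff (𝓡 4) 𝓘(ℝ, ℝ) ∞ (fun x => A x i j)) ∧
          (∀ x j, IsSelfDualPart (fun i => σ i x) (F j x)
            (A x 0 j • σ 1 x + A x 1 j • σ 2 x)) ∧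
          ∀ x, (A x * intersectionMatrix σ x).trace = 0) := by
  refine ⟨fun hpos => isSU3Structure_bundle hπ hσ hpos hθ, ?_⟩
  obtain ⟨F, hF⟩ := hπ.exists_curvature hθ
  exact ⟨F, hF, (isHalfFlat_bundle_iff hπ hσ hθ fun j => (hF j).2).trans
    (hσ.exists_selfDualPart_iff fun j => (hF j).1)⟩
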